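/- Notation. Write $\langle y\rangle=(1+|y|^2)^{1/2}$, and let $\widehat f(\xi,\tau)$ be the space-time Fourier transform of a tempered distribution $f$ on $\mathbb R_x\times\mathbb R_t$ ($\xi$ dual to $x$, $\tau$ dual to $t$, angular frequencies, unitary normalization). For $\varphi:\mathbb R\to\mathbb R$ and $s,b\in\mathbb R$ put $$\|f\|_{X^{s,b}_\varphi}=\big\|\langle\xi\rangle^{s}\,\langle\tau-\varphi(\xi)\rangle^{b}\,\widehat f(\xi,\tau)\big\|_{L^2_{\xi,\tau}} .$$ Let $X^{s,b}$ be the space with $\varphi(\xi)=-|\xi|^2$, and $X^{s,b}_{\pm}$ the space with $\varphi(\xi)=\pm\langle\xi\rangle$; each is the completion of the Schwartz space $\mathcal S(\mathbb R^2)$ in its norm, that is, the space of the tempered distributions whose Fourier transform is a function and whose norm is finite. **Lemma 2.3 (Nonlinear estimates).** Let $1\le m<2$ be a real number. There exist $\epsilon$ with $0<\epsilon<1-\frac m2$ and a constant $c$, depending only on $m$ and $\epsilon$, such that with $$b=\frac{2m-1}{4m}+\epsilon,\qquad b'=-\frac12+2m\epsilon ,$$ for either choice of the sign $\pm$, and for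 all complex-valued $n_\pm\in X^{1/2,b}_\pm$ and $u\in X^{0,b}$ (which are functions), the functions $n_\pm|u|^{2(m-1)}u$ and $|u|^{2m}$ define tempered distributions that belong to $X^{0,b'}$ and $X^{-1/2,b'}_\pm$ respectively, and $$\big\|n_\pm|u|^{2(m-1)}u\big\|_{X^{0,b'}}\le c\,\|n_\pm\|_{X^{1/2,b}_\pm}\,\|u\|_{X^{0,b}}^{2m-1},$$ $$\big\||u|^{2m}\big\|_{X^{-1/2,b'}_\pm}\le c\,\|u\|_{X^{0,b}}^{2m}.$$ -/

import Mathlib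

open MeasureTheory FourierTransform
open scoped ENNReal NNReal

noncomputable section

namespace KGS

/-- The plane `ℝ_x × ℝ_t`: the coordinate `z 0` is the space variable `x`, and `z 1` is the time
variable `t`. The dual variable is written `ζ`, with `ζ 0` dual to `x` and `ζ 1` dual to `t`. -/
abbrev Spacetime : Type := EuclideanSpace ℝ (Fin 2)

/-- The Japanese bracket `⟨y⟩ = (1 + |y|²)^{1/2}`. -/
def bracket (y : ℝ) : ℝ := (1 + y ^ 2) ^ (1 / 2 : ℝ)

/-- The weight `⟨ξ⟩^s ⟨τ - φ(ξ)⟩^b`, as a function of the variable `ζ` of the Fourier transform of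
Mathlib, which has kernel `exp (-2πi ⟪z, ζ⟫)`: the (angular) frequencies `(ξ, τ)`, for which
`D_x = -i ∂_x` has symbol `ξ`, are `(2π ζ 0, 2π ζ 1)`. -/
def weight (φ : ℝ → ℝ) (s b : ℝ) (ζ : Spacetime) : ℝ :=
  bracket (2 * Real.pi * ζ 0) ^ s *
    bracket (2 * Real.pi * ζ 1 - φ (2 * Real.pi * ζ 0)) ^ b

/-- The tempered distribution `T` is the function `f`, that is, `T g = ∫ g f` for every Schwartz
function `g`, all these integrals being absolutely convergent. -/
def IsFunction (f : Spacetime → ℂ) (T : TemperedDistribution Spacetime ℂ) : Prop :=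
  ∀ g : SchwartzMap Spacetime ℂ,
    Integrable (fun z => g z * f z) volume ∧ T g = ∫ z, g z * f z

/-- The norm `‖⟨ξ⟩^s ⟨τ - φ(ξ)⟩^b 𝓕T(ξ, τ)‖_{L²(dξ dτ)}` of a tempered distribution `T` on the
plane; it is `∞` if the Fourier transform of `T` is not a function. By `IsFunction.ae_eq` the
infimum is over a single class of almost everywhere equal functions. Because of the
`L²`-isometric change of variables to `(ξ, τ)`, this is the norm taken with the unitary
normalization of the Fourier transform; in particular it is the `L²` norm if `s = b = 0`. -/
def XNorm (φ : ℝ → ℝ) (s b : ℝ) (T : TemperedDistribution Spacetime ℂ) : ℝ≥0∞ :=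
  ⨅ (h : Spacetime → ℂ) (_ : IsFunction h (𝓕 T)),
    eLpNorm (fun ζ => (weight φ s b ζ : ℂ) * h ζ) 2 volume

/-- The space `X^{s,b}_φ`: the tempered distributions of finite norm. For the two kinds of `φ` below
this is the completion of the Schwartz space in the norm `XNorm φ s b`: it is complete, being a
weighted `L²` space on the Fourier side, and see `schwartz_memX` and `exists_schwartz_near`. -/
def MemX (φ : ℝ → ℝ) (s b : ℝ) (T : TemperedDistribution Spacetime ℂ) : Prop :=
  XNorm φ s b T < ∞

/-- The symbol of the Schrödinger equation. It gives the spaces `X^{s,b}`. -/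
def schr (ξ : ℝ) : ℝ := -|ξ| ^ 2

/-- The symbol `σ⟨ξ⟩` of the half Klein-Gordon equations. It gives the spaces `X^{s,b}_+`
(for `σ = 1`) and `X^{s,b}_-` (for `σ = -1`). -/
def kg (σ : ℝ) (ξ : ℝ) : ℝ := σ * bracket ξ

/-! ### Checks of the definitions -/

lemma IsFunction.locallyIntegrable {f : Spacetime → ℂ} {T : TemperedDistribution Spacetime ℂ}
    (hf : IsFunction f T) : LocallyIntegrable f volume := by
  intro x
  obtain ⟨g, hg1, hg2, hg3, -, hg5⟩ :=
    exists_contDiff_tsupport_subset (n := (⊤ : ℕ∞)) (Filter.univ_mem : Set.univ ∈ nhds x)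
  have hc : HasCompactSupport (Complex.ofRealCLM ∘ g) := hg2.comp_left rfl
  have hs : ContDiff ℝ ((⊤ : ℕ∞) : WithTop ℕ∞) (Complex.ofRealCLM ∘ g) :=
    Complex.ofRealCLM.contDiff.comp hg3
  have hi := (hf (hc.toSchwartzMap hs)).1
  have hU : {z | (1 / 2 : ℝ) < g z} ∈ nhds x :=
    (isOpen_lt continuous_const hg3.continuous).mem_nhds (by simp [hg5]; norm_num)
  refine ⟨_, hU, ?_⟩
  have hmeas : MeasurableSet {z | (1 / 2 : ℝ) < g z} :=
    (isOpen_lt continuous_const hg3.continuous).measurableSet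
  have hb : Continuous (fun z => ((max (g z) (1 / 2) : ℝ) : ℂ)⁻¹) := by
    refine Continuous.inv₀ ?_ ?_
    · have := hg3.continuous
      fun_prop
    · intro z
      have : (0 : ℝ) < max (g z) (1 / 2) := lt_max_of_lt_right (by norm_num)
      exact_mod_cast this.ne'
  have h2 : Integrable (fun z => ((max (g z) (1 / 2) : ℝ) : ℂ)⁻¹ * ((g z : ℂ) * f z)) volume := by
    refine Integrable.bdd_mul (c := 2) (by simpa using hi) hb.aestronglyMeasurable ?_
    refine Filter.Eventually.of_forall fun z => ?_
    have h3 : (1 / 2 : ℝ) ≤ max (g z) (1 / 2) := le_max_right _ _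
    rw [norm_inv, Complex.norm_real, Real.norm_of_nonneg (by linarith)]
    calc _ ≤ (1 / 2 : ℝ)⁻¹ := inv_anti₀ (by norm_num) h3
      _ = 2 := by norm_num
  refine (h2.integrableOn (s := {z | (1 / 2 : ℝ) < g z})).congr_fun ?_ hmeas
  intro z hz
  have hz' : (1 / 2 : ℝ) < g z := hz
  have h0 : (g z : ℂ) ≠ 0 := by exact_mod_cast (by linarith : (0 : ℝ) < g z).ne'
  simp only [max_eq_left hz'.le]
  field_simp

/-- A tempered distribution is at most one function, up to equality almost everywhere. -/
lemma IsFunction.ae_eq {f f' : Spacetime → ℂ} {T : TemperedDistribution Spacetime ℂ}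
    (hf : IsFunction f T) (hf' : IsFunction f' T) : f =ᵐ[volume] f' := by
  refine ae_eq_of_integral_contDiff_smul_eq hf.locallyIntegrable hf'.locallyIntegrable ?_
  intro g hg1 hg2
  have hc : HasCompactSupport (Complex.ofRealCLM ∘ g) := hg2.comp_left rfl
  have hs : ContDiff ℝ ((⊤ : ℕ∞) : WithTop ℕ∞) (Complex.ofRealCLM ∘ g) :=
    Complex.ofRealCLM.contDiff.comp hg1
  have h := (hf (hc.toSchwartzMap hs)).2.symm.trans (hf' (hc.toSchwartzMap hs)).2
  simpa using h

lemma XNorm_eq {φ : ℝ → ℝ} {s b : ℝ} {T : TemperedDistribution Spacetime ℂ} {h : Spacetime → ℂ}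
    (hh : IsFunction h (𝓕 T)) :
    XNorm φ s b T = eLpNorm (fun ζ => (weight φ s b ζ : ℂ) * h ζ) 2 volume := by
  refine le_antisymm (iInf₂_le h hh) (le_iInf₂ fun h' hh' => le_of_eq ?_)
  refine eLpNorm_congr_ae ?_
  filter_upwards [hh.ae_eq hh'] with ζ hζ
  rw [hζ]

lemma bracket_pos (y : ℝ) : 0 < bracket y := by
  unfold bracket
  positivity

lemma weight_ne_zero (φ : ℝ → ℝ) (s b : ℝ) (ζ : Spacetime) : (weight φ s b ζ : ℂ) ≠ 0 := by
  have h : 0 < weight φ s b ζ :=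
    mul_pos (Real.rpow_pos_of_pos (bracket_pos _) _) (Real.rpow_pos_of_pos (bracket_pos _) _)
  exact_mod_cast h.ne'

lemma weight_mul_neg (φ : ℝ → ℝ) (s b : ℝ) (ζ : Spacetime) :
    (weight φ s b ζ : ℂ) * (weight φ (-s) (-b) ζ : ℂ) = 1 := by
  have h1 := Real.rpow_pos_of_pos (bracket_pos (2 * Real.pi * ζ 0)) s
  have h2 := Real.rpow_pos_of_pos
    (bracket_pos (2 * Real.pi * ζ 1 - φ (2 * Real.pi * ζ 0))) b
  have : weight φ s b ζ * weight φ (-s) (-b) ζ = 1 := by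
    unfold weight
    rw [Real.rpow_neg (bracket_pos _).le, Real.rpow_neg (bracket_pos _).le]
    field_simp
  exact_mod_cast this

lemma bracket_rpow_temperate (r : ℝ) : (fun y : ℝ => bracket y ^ r).HasTemperateGrowth := by
  have h := Function.hasTemperateGrowth_one_add_norm_sq_rpow ℝ (r / 2)
  have e : (fun y : ℝ => bracket y ^ r) = fun y : ℝ => (1 + ‖y‖ ^ 2) ^ (r / 2) := by
    funext y
    unfold bracket
    rw [← Real.rpow_mul (by positivity), Real.norm_eq_abs, sq_abs]
    ring_nf
  rw [e]
  exact h

lemma schr_temperate : schr.HasTemperateGrowth := by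
  have : schr = fun ξ : ℝ => -(ξ ^ 2) := by
    funext ξ
    simp [schr]
  rw [this]
  exact (Function.HasTemperateGrowth.id'.pow 2).neg

lemma kg_temperate (σ : ℝ) : (kg σ).HasTemperateGrowth := by
  have h := bracket_rpow_temperate 1
  simp only [Real.rpow_one] at h
  exact (Function.HasTemperateGrowth.const σ).mul h

lemma weight_temperate {φ : ℝ → ℝ} (hφ : φ.HasTemperateGrowth) (s b : ℝ) :
    (fun ζ => (weight φ s b ζ : ℂ)).HasTemperateGrowth := by
  have hx : (fun ζ : Spacetime => 2 * Real.pi * ζ 0).HasTemperateGrowth :=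
    (Function.HasTemperateGrowth.const (2 * Real.pi)).mul
      (EuclideanSpace.proj (𝕜 := ℝ) (0 : Fin 2) : Spacetime →L[ℝ] ℝ).hasTemperateGrowth
  have ht : (fun ζ : Spacetime => 2 * Real.pi * ζ 1).HasTemperateGrowth :=
    (Function.HasTemperateGrowth.const (2 * Real.pi)).mul
      (EuclideanSpace.proj (𝕜 := ℝ) (1 : Fin 2) : Spacetime →L[ℝ] ℝ).hasTemperateGrowth
  have h1 := (bracket_rpow_temperate s).comp hx
  have h2 := (bracket_rpow_temperate b).comp (ht.sub (hφ.comp hx))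
  exact Function.HasTemperateGrowth.comp Function.Complex.hasTemperateGrowth_ofReal (h1.mul h2)

lemma isFunction_schwartz (f : SchwartzMap Spacetime ℂ) :
    IsFunction f (SchwartzMap.toTemperedDistributionCLM Spacetime ℂ volume f) := by
  intro g
  refine ⟨?_, by simp⟩
  exact g.integrable.mul_of_top_left (f.memLp_top volume)

lemma isFunction_fourier_schwartz (f : SchwartzMap Spacetime ℂ) :
    IsFunction (𝓕 f : SchwartzMap Spacetime ℂ)
      (𝓕 (SchwartzMap.toTemperedDistributionCLM Spacetime ℂ volume f)) := by
  rw [TemperedDistribution.fourier_toTemperedDistributionCLM_eq]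
  exact isFunction_schwartz _

/-- Schwartz functions belong to all the spaces. -/
lemma schwartz_memX {φ : ℝ → ℝ} (hφ : φ.HasTemperateGrowth) (s b : ℝ)
    (f : SchwartzMap Spacetime ℂ) :
    MemX φ s b (SchwartzMap.toTemperedDistributionCLM Spacetime ℂ volume f) := by
  unfold MemX
  rw [XNorm_eq (isFunction_fourier_schwartz f)]
  have h := (SchwartzMap.smulLeftCLM ℂ (fun ζ => (weight φ s b ζ : ℂ)) (𝓕 f)).memLp 2 volume
  have h2 := h.eLpNorm_lt_top
  refine lt_of_eq_of_lt (congrArg (fun w => eLpNorm w 2 volume) ?_) h2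
  funext ζ
  rw [SchwartzMap.smulLeftCLM_apply_apply (weight_temperate hφ s b), smul_eq_mul]

/-- Schwartz functions are dense in all the spaces. -/
lemma exists_schwartz_near {φ : ℝ → ℝ} (hφ : φ.HasTemperateGrowth) {s b : ℝ}
    {T : TemperedDistribution Spacetime ℂ} (hT : MemX φ s b T) {δ : ℝ} (hδ : 0 < δ) :
    ∃ f : SchwartzMap Spacetime ℂ,
      XNorm φ s b (T - SchwartzMap.toTemperedDistributionCLM Spacetime ℂ volume f)
        < ENNReal.ofReal δ := by
  obtain ⟨h, hh, hlt⟩ : ∃ h, ∃ _ : IsFunction h (𝓕 T),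
      eLpNorm (fun ζ => (weight φ s b ζ : ℂ) * h ζ) 2 volume < ∞ := by
    simpa only [MemX, XNorm, iInf_lt_iff] using hT
  have hw := weight_temperate hφ s b
  have hw' := weight_temperate hφ (-s) (-b)
  have hmem : MemLp (fun ζ => (weight φ s b ζ : ℂ) * h ζ) 2 volume :=
    ⟨hw.1.continuous.aestronglyMeasurable.mul hh.locallyIntegrable.aestronglyMeasurable, hlt⟩
  obtain ⟨y, ⟨k, rfl⟩, hk⟩ := Metric.mem_closure_iff.1
    (SchwartzMap.denseRange_toLpCLM (F := ℂ) (μ := (volume : Measure Spacetime)) (p := 2)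
      (by simp) (hmem.toLp _)) δ hδ
  set k' := SchwartzMap.smulLeftCLM ℂ (fun ζ => (weight φ (-s) (-b) ζ : ℂ)) k with hk'
  refine ⟨𝓕⁻ k', ?_⟩
  have hF : IsFunction (fun ζ => h ζ - k' ζ)
      (𝓕 (T - SchwartzMap.toTemperedDistributionCLM Spacetime ℂ volume (𝓕⁻ k'))) := by
    intro g
    have e1 := hh g
    have e2 := isFunction_fourier_schwartz (𝓕⁻ k') g
    rw [FourierTransform.fourier_fourierInv_eq] at e2
    have e3 : (fun z => g z * (h z - k' z)) = fun z => g z * h z - g z * k' z := by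
      funext z
      ring
    rw [e3]
    refine ⟨e1.1.sub e2.1, ?_⟩
    rw [integral_sub e1.1 e2.1, ← e1.2, ← e2.2]
    simp only [TemperedDistribution.fourier_apply]
    rfl
  rw [XNorm_eq hF]
  rw [← edist_lt_ofReal, Lp.edist_def] at hk
  refine lt_of_eq_of_lt (eLpNorm_congr_ae ?_) hk
  filter_upwards [hmem.coeFn_toLp, k.coeFn_toLp 2 volume] with ζ h1 h2
  simp only [Pi.sub_apply, SchwartzMap.toLpCLM_apply]
  rw [h1, h2, hk', SchwartzMap.smulLeftCLM_apply_apply hw', smul_eq_mul, mul_sub, ← mul_assoc,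
    weight_mul_neg, one_mul]

end KGS

end

/-! By duality on the Fourier side it suffices to bound the absolutely convergent integrals of `|n|
|u|^(2m-1) |v|` and `|u|^(2m) |v|`, where `v` is a test function measured in `X^{0,-b'}`,
respectively `X^{1/2,-b'}_±`. Such a bound makes the pairing with `v` a continuous functional on a
weighted `L²` space, and the Riesz representation (`exists_distribution`) then produces the
distribution together with its norm.

The integrals are estimated by Hölder's inequality alone (`lintegral_triple_le`,
`lintegral_double_le`), once each factor lies in a mixed space: `u` in `L^{4m/(m+1)}_t L^∞_x` and in
`L^{4m}_t L²_x`, `n` in `L^{4m}_t L^{2/(2-m)}_x`, and `v` in `L^{4/(2-m)}_t` with values in `L²_x`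
or `L^{2/(2-m)}_x`. In each product `m` powers of `u` are taken in the sup norm.

All these embeddings come from one `TT*` argument. Since `b < 1/2`, a function in `X^{s,b}` cannot
simply be written as an integrable superposition of free solutions, so the weight is kept inside the
argument. The multiplier `⟨τ-φ⟩^(-2b)` is convolution in time, along the free flow, with a kernel
`k_b(r)` that is `O(|r|^(-2a))` for every `a > 0` above `1/2 - b`. If the free correlations decay
like `|r|^(-θ)`, the operator `TT*` has kernel at most `|r|^(-θ) k_b(r)`, which lies in `L^{q/2}`
when `(1-2b+θ) q < 2`. Young's inequality then gives `L^q` in time (`enorm_pairing_sq_le`).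

With `θ = 0` and Cauchy-Schwarz in place of dispersion, every phase gets values in `L²_x`
(`lintegral_evol_le`). Sobolev embedding in `x`, itself an instance of the same estimate, improves
this to `L^p_x`. With `θ = 1/2`, the one-dimensional Schrödinger dispersion gives values in `L^∞_x`;
the supremum is linearized along a measurable path `x = X(t)` (`lintegral_synth_path_le`).

For `ε = 0` the condition `(1-2b+θ) q < 2` would be an equality for both spaces used for `u`, and
for the one used for `n`. A positive `ε` makes it strict, and a small one leaves enough room for
`v`. -/

namespace KGS

/-! ### Young's inequality and the Bessel kernel -/

/-- Young's inequality for the quadratic form of a convolution operator. -/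
theorem lintegral_bilinear_le {κ a : ℝ → ℝ≥0∞} (hκ : Measurable κ) (ha : Measurable a) {q : ℝ}
    (hq : 2 ≤ q) :
    ∫⁻ t, ∫⁻ s, a t * a s * κ (t - s) ≤
      (∫⁻ r, κ r ^ (q / 2)) ^ (2 / q) * (∫⁻ t, a t ^ (q / (q - 1))) ^ (2 * (q - 1) / q) := by
  have hq0 : 0 < q := by linarith
  have hq1 : 0 < q - 1 := by linarith
  have hα : 0 ≤ 1 - 2 / q := by
    rw [sub_nonneg, div_le_one hq0]; exact hq
  have hβ : 0 ≤ 1 / q := by positivity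
  set A := ∫⁻ t, a t ^ (q / (q - 1)) with hA
  set K := ∫⁻ r, κ r ^ (q / 2) with hK
  -- Hölder on the plane for three functions with exponents `1-2/q`, `1/q`, `1/q`. With `q' =
  -- q/(q-1)`, each of `a t` and `a s` collects the power `q' (1 - 1/q) = 1`, and the kernel
  -- collects `(q/2)(2/q) = 1`. The three integrals factor by translation invariance as `A * A`, `A
  -- * K`, `A * K`.
  let f : Fin 3 → ℝ × ℝ → ℝ≥0∞ :=
    ![fun z => a z.1 ^ (q / (q - 1)) * a z.2 ^ (q / (q - 1)),
      fun z => a z.1 ^ (q / (q - 1)) * κ (z.1 - z.2) ^ (q / 2),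
      fun z => a z.2 ^ (q / (q - 1)) * κ (z.1 - z.2) ^ (q / 2)]
  let p : Fin 3 → ℝ := ![1 - 2 / q, 1 / q, 1 / q]
  have hf : ∀ i, Measurable (f i) := by
    have h0 : Measurable fun z : ℝ × ℝ => a z.1 ^ (q / (q - 1)) * a z.2 ^ (q / (q - 1)) := by
      fun_prop
    have h1 : Measurable fun z : ℝ × ℝ => a z.1 ^ (q / (q - 1)) * κ (z.1 - z.2) ^ (q / 2) := by
      fun_prop
    have h2 : Measurable fun z : ℝ × ℝ => a z.2 ^ (q / (q - 1)) * κ (z.1 - z.2) ^ (q / 2) := by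
      fun_prop
    intro i
    fin_cases i
    exacts [h0, h1, h2]
  have h := ENNReal.lintegral_prod_norm_pow_le (μ := (volume : Measure ℝ).prod volume)
    Finset.univ (f := f) (fun i _ => (hf i).aemeasurable) (p := p)
    (by simp only [p, Fin.sum_univ_three, Matrix.cons_val]; ring)
    (by intro i _; fin_cases i <;> simp only [p] <;> assumption)
  have e0 : ∫⁻ z, f 0 z ∂((volume : Measure ℝ).prod volume) = A * A := by
    rw [hA, ← lintegral_prod_mul (by fun_prop) (by fun_prop)]
    rfl
  have e1 : ∫⁻ z, f 1 z ∂((volume : Measure ℝ).prod volume) = A * K := by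
    rw [lintegral_prod _ (hf 1).aemeasurable, hA, ← lintegral_mul_const _ (by fun_prop)]
    refine lintegral_congr fun t => ?_
    change ∫⁻ s, a t ^ (q / (q - 1)) * κ (t - s) ^ (q / 2) = _
    rw [lintegral_const_mul _ (by fun_prop),
      lintegral_sub_left_eq_self (fun r => κ r ^ (q / 2)) t]
  have e2 : ∫⁻ z, f 2 z ∂((volume : Measure ℝ).prod volume) = A * K := by
    rw [lintegral_prod_symm _ (hf 2).aemeasurable, hA, ← lintegral_mul_const _ (by fun_prop)]
    refine lintegral_congr fun t => ?_
    change ∫⁻ s, a t ^ (q / (q - 1)) * κ (s - t) ^ (q / 2) = _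
    rw [lintegral_const_mul _ (by fun_prop),
      lintegral_sub_right_eq_self (fun r => κ r ^ (q / 2)) t]
  simp only [Fin.prod_univ_three, e0, e1, e2] at h
  rw [lintegral_prod _ (by
    refine Measurable.aemeasurable ?_
    have := hf 0; have := hf 1; have := hf 2
    fun_prop)] at h
  have hs : 1 - 2 / q + 1 / q = (q - 1) / q := by field_simp; ring
  calc _ ≤ _ := le_of_eq ?_
    _ ≤ _ := h
    _ = _ := ?_
  · refine lintegral_congr fun t => lintegral_congr fun s => ?_
    simp only [f, p, Matrix.cons_val]
    rw [ENNReal.mul_rpow_of_nonneg _ _ hα, ENNReal.mul_rpow_of_nonneg _ _ hβ,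
      ENNReal.mul_rpow_of_nonneg _ _ hβ]
    have key : ∀ x : ℝ≥0∞, (x ^ (q / (q - 1))) ^ (1 - 2 / q) * (x ^ (q / (q - 1))) ^ (1 / q) = x := by
      intro x
      rw [← ENNReal.rpow_add_of_nonneg _ _ hα hβ, ← ENNReal.rpow_mul, hs]
      convert ENNReal.rpow_one x using 2
      field_simp
    have key2 : ∀ x : ℝ≥0∞, (x ^ (q / 2)) ^ (1 / q) * (x ^ (q / 2)) ^ (1 / q) = x := by
      intro x
      rw [← ENNReal.rpow_add_of_nonneg _ _ hβ hβ, ← ENNReal.rpow_mul]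
      convert ENNReal.rpow_one x using 2
      field_simp
      norm_num
    nth_rw 1 [← key (a t), ← key (a s), ← key2 (κ (t - s))]
    ring
  · simp only [p, Matrix.cons_val]
    rw [ENNReal.mul_rpow_of_nonneg _ _ hα, ENNReal.mul_rpow_of_nonneg _ _ hβ]
    have e3 : A ^ (2 * (q - 1) / q) =
        A ^ (1 - 2 / q) * A ^ (1 / q) * (A ^ (1 - 2 / q) * A ^ (1 / q)) := by
      rw [← ENNReal.rpow_add_of_nonneg _ _ hα hβ, hs,
        ← ENNReal.rpow_add_of_nonneg _ _ (by positivity) (by positivity)]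
      congr 1; ring
    have e4 : K ^ (2 / q) = K ^ (1 / q) * K ^ (1 / q) := by
      rw [← ENNReal.rpow_add_of_nonneg _ _ hβ hβ]
      congr 1; ring
    rw [e3, e4]
    ring

/-- The kernel of the Fourier multiplier `Γ(b) ⟨2πσ⟩ ^ (-2b)`, as a superposition of Gaussians. -/
noncomputable def besselKernel (b r : ℝ) : ℝ≥0∞ :=
  ∫⁻ δ in Set.Ioi (0 : ℝ),
    ENNReal.ofReal (Real.exp (-δ) * δ ^ (b - 1)) *
      ENNReal.ofReal ((4 * Real.pi * δ) ^ (-1 / 2 : ℝ) * Real.exp (-r ^ 2 / (4 * δ)))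

theorem measurable_besselKernel (b : ℝ) : Measurable (besselKernel b) := by
  unfold besselKernel
  refine Measurable.lintegral_prod_right' (f := fun z : ℝ × ℝ =>
    ENNReal.ofReal (Real.exp (-z.2) * z.2 ^ (b - 1)) *
      ENNReal.ofReal ((4 * Real.pi * z.2) ^ (-1 / 2 : ℝ) * Real.exp (-z.1 ^ 2 / (4 * z.2)))) ?_
  fun_prop

theorem exp_neg_le_rpow {a : ℝ} (ha : 0 < a) {x : ℝ} (hx : 0 < x) :
    Real.exp (-x) ≤ a ^ a * x ^ (-a) := by
  have h1 : x / a ≤ Real.exp (x / a) := by linarith [Real.add_one_le_exp (x / a)]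
  have h2 : (x / a) ^ a ≤ Real.exp x := by
    calc _ ≤ (Real.exp (x / a)) ^ a := by gcongr
      _ = Real.exp x := by
        rw [← Real.exp_mul]
        congr 1
        field_simp
  rw [Real.exp_neg, Real.rpow_neg hx.le, ← div_eq_mul_inv, inv_eq_one_div,
    div_le_div_iff₀ (Real.exp_pos _) (by positivity), one_mul]
  rw [Real.div_rpow hx.le ha.le, div_le_iff₀ (by positivity)] at h2
  linarith

theorem lintegral_exp_neg_mul_rpow {c : ℝ} (hc : 0 < c) :
    ∫⁻ δ in Set.Ioi (0 : ℝ), ENNReal.ofReal (Real.exp (-δ) * δ ^ (c - 1)) =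
      ENNReal.ofReal (Real.Gamma c) := by
  rw [Real.Gamma_eq_integral hc, ofReal_integral_eq_lintegral_ofReal
    (Real.GammaIntegral_convergent hc)]
  filter_upwards [ae_restrict_mem measurableSet_Ioi] with δ hδ
  have : (0 : ℝ) < δ := hδ
  positivity

/-- The Gaussian factor is bounded by a power, `e^(-x) ≤ a^a x^(-a)` with `x = r²/(4δ)`. The
remaining `δ`-integral is the Gamma integral at `b - 1/2 + a`, whose convergence is the condition on
`a`. The free exponent `a` gives the almost optimal singularity at `r = 0` and arbitrarily fast
polynomial decay at infinity. -/
theorem besselKernel_le {b a : ℝ} (ha : 0 < a) (hab : 1 / 2 - b < a) :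
    ∃ C : ℝ≥0, ∀ r : ℝ, r ≠ 0 → besselKernel b r ≤ C * ENNReal.ofReal (|r| ^ (-2 * a)) := by
  refine ⟨Real.toNNReal ((4 * Real.pi) ^ (-1 / 2 : ℝ) * (a ^ a * 4 ^ a) *
    Real.Gamma (b - 1 / 2 + a)), fun r hr => ?_⟩
  have hc : 0 < b - 1 / 2 + a := by linarith
  have hr' : 0 < |r| := abs_pos.2 hr
  calc besselKernel b r
      ≤ ∫⁻ δ in Set.Ioi (0 : ℝ), ENNReal.ofReal ((4 * Real.pi) ^ (-1 / 2 : ℝ) * (a ^ a * 4 ^ a) *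
          |r| ^ (-2 * a)) * ENNReal.ofReal (Real.exp (-δ) * δ ^ (b - 1 / 2 + a - 1)) := by
        unfold besselKernel
        refine setLIntegral_mono (by fun_prop) fun δ hδ => ?_
        have hδ' : 0 < δ := hδ
        rw [← ENNReal.ofReal_mul (by positivity), ← ENNReal.ofReal_mul (by positivity)]
        refine ENNReal.ofReal_le_ofReal ?_
        have h1 := exp_neg_le_rpow ha (x := r ^ 2 / (4 * δ)) (by positivity)
        have h2 : (r ^ 2 / (4 * δ)) ^ (-a) = 4 ^ a * δ ^ a * |r| ^ (-2 * a) := by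
          rw [← sq_abs, Real.div_rpow (by positivity) (by positivity),
            Real.mul_rpow (by norm_num) hδ'.le, ← Real.rpow_natCast, ← Real.rpow_mul hr'.le,
            Real.rpow_neg (by norm_num : (0:ℝ) ≤ 4), Real.rpow_neg hδ'.le]
          field_simp
          congr 1
          push_cast; ring
        rw [h2] at h1
        have h3 : (4 * Real.pi * δ) ^ (-1 / 2 : ℝ) = (4 * Real.pi) ^ (-1 / 2 : ℝ) * δ ^ (-1 / 2 : ℝ) :=
          Real.mul_rpow (by positivity) hδ'.le
        have h4 : δ ^ (b - 1 / 2 + a - 1) = δ ^ (b - 1) * δ ^ (-1 / 2 : ℝ) * δ ^ a := by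
          rw [← Real.rpow_add hδ', ← Real.rpow_add hδ']
          congr 1; ring
        rw [h3, h4, show -r ^ 2 / (4 * δ) = -(r ^ 2 / (4 * δ)) by ring]
        calc _ ≤ Real.exp (-δ) * δ ^ (b - 1) * ((4 * Real.pi) ^ (-1 / 2 : ℝ) * δ ^ (-1 / 2 : ℝ) *
              (a ^ a * (4 ^ a * δ ^ a * |r| ^ (-2 * a)))) := by gcongr
          _ = _ := by ring
    _ = _ := by
        rw [lintegral_const_mul _ (by fun_prop), lintegral_exp_neg_mul_rpow hc,
          ENNReal.ofReal_mul (by positivity), ENNReal.ofNNReal_toNNReal,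
          ENNReal.ofReal_mul (p := _ * _) (by positivity)]
        ring

theorem lintegral_abs_symm {f : ℝ → ℝ≥0∞} (he : ∀ r, f (-r) = f r) :
    ∫⁻ r, f r = 2 * ∫⁻ r in Set.Ioi (0 : ℝ), f r := by
  have h1 : ∫⁻ r in Set.Iio (0 : ℝ), f r = ∫⁻ r in Set.Ioi (0 : ℝ), f r := by
    rw [← lintegral_indicator measurableSet_Iio, ← lintegral_indicator measurableSet_Ioi,
      ← lintegral_neg_eq_self]
    refine lintegral_congr fun r => ?_
    by_cases h : 0 < r
    · simp [Set.indicator, h, he]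
    · simp [Set.indicator, h]
  rw [← lintegral_add_compl f measurableSet_Ioi, Set.compl_Ioi,
    setLIntegral_congr (Iio_ae_eq_Iic (a := (0 : ℝ))).symm, h1, two_mul]

/-- The kernel `|r| ^ (-θ) k_b(r)` belongs to `L^s` for `(1 - 2b + θ) s < 1`. -/
theorem lintegral_besselKernel_lt_top {b θ s : ℝ} (hb : b < 1 / 2) (hθ : 0 ≤ θ) (hs : 0 < s)
    (h : (1 - 2 * b + θ) * s < 1) :
    ∫⁻ r, (ENNReal.ofReal (|r| ^ (-θ)) * besselKernel b r) ^ s < ∞ := by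
  have heven : ∀ r, besselKernel b (-r) = besselKernel b r := by
    intro r; simp [besselKernel]
  rw [lintegral_abs_symm (by simp [heven])]
  refine ENNReal.mul_lt_top (by simp) ?_
  have key : ∀ a : ℝ, 0 < a → 1 / 2 - b < a → ∃ C : ℝ≥0, ∀ r : ℝ, 0 < r →
      (ENNReal.ofReal (|r| ^ (-θ)) * besselKernel b r) ^ s ≤
        C * ENNReal.ofReal (r ^ (-(2 * a + θ) * s)) := by
    intro a ha hab
    obtain ⟨C, hC⟩ := besselKernel_le ha hab
    refine ⟨C ^ s, fun r hr => ?_⟩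
    calc _ ≤ (ENNReal.ofReal (|r| ^ (-θ)) * (C * ENNReal.ofReal (|r| ^ (-2 * a)))) ^ s := by
          gcongr
          exact hC r hr.ne'
      _ = _ := by
          rw [mul_left_comm, ← ENNReal.ofReal_mul (by positivity), abs_of_pos hr,
            ← Real.rpow_add hr, ENNReal.mul_rpow_of_nonneg _ _ hs.le,
            ENNReal.ofReal_rpow_of_nonneg (by positivity) hs.le, ← Real.rpow_mul hr.le,
            ENNReal.coe_rpow_of_nonneg _ hs.le]
          ring_nf
  -- Near `0` the exponent must exceed `1/2 - b` only slightly, so that the power stays integrable;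
  -- the strict inequality in the hypothesis leaves room for this.
  obtain ⟨a₁, ha₁, h₁⟩ : ∃ a, 1 / 2 - b < a ∧ (2 * a + θ) * s < 1 := by
    refine ⟨1 / 2 - b + (1 - (1 - 2 * b + θ) * s) / (4 * s), ?_, ?_⟩
    · have : 0 < (1 - (1 - 2 * b + θ) * s) / (4 * s) := by
        apply div_pos <;> linarith
      linarith
    · have : (2 * (1 / 2 - b + (1 - (1 - 2 * b + θ) * s) / (4 * s)) + θ) * s =
          (1 + (1 - 2 * b + θ) * s) / 2 := by
        field_simp
        ring
      rw [this]
      linarith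
  obtain ⟨C₁, hC₁⟩ := key a₁ (by linarith) ha₁
  -- Away from `0` a large exponent is wanted: this one gives the power `-((1-2b+θ)s + 2)`,
  -- integrable at infinity.
  obtain ⟨C₂, hC₂⟩ := key (1 / 2 - b + 1 / s) (by
    have : 0 < 1 / s := by positivity
    linarith) (by
    have : 0 < 1 / s := by positivity
    linarith)
  have hU : Set.Ioi (0 : ℝ) = Set.Ioo 0 1 ∪ Set.Ici 1 := by
    ext x; simp only [Set.mem_Ioi, Set.mem_union, Set.mem_Ioo, Set.mem_Ici]
    constructor
    · intro hx
      rcases lt_or_ge x 1 with h | h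
      · exact Or.inl ⟨hx, h⟩
      · exact Or.inr h
    · rintro (h | h)
      · exact h.1
      · linarith
  have fin : ∀ {c : ℝ} {S : Set ℝ}, MeasurableSet S → S ⊆ Set.Ioi 0 →
      IntegrableOn (fun r : ℝ => r ^ c) S → ∀ C : ℝ≥0,
      ∫⁻ r in S, C * ENNReal.ofReal (r ^ c) < ∞ := by
    intro c S hS hSp hi C
    rw [lintegral_const_mul _ (by fun_prop)]
    refine ENNReal.mul_lt_top (by simp) ?_
    refine lt_of_le_of_lt ?_ hi.2
    exact lintegral_mono fun r => Real.ofReal_le_enorm _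
  rw [hU]
  refine lt_of_le_of_lt (lintegral_union_le _ _ _) (ENNReal.add_lt_top.2 ⟨?_, ?_⟩)
  · refine lt_of_le_of_lt (setLIntegral_mono (by fun_prop) fun r hr => hC₁ r hr.1) ?_
    refine fin measurableSet_Ioo (fun x hx => hx.1) ?_ C₁
    rw [intervalIntegral.integrableOn_Ioo_rpow_iff zero_lt_one]
    linarith
  · refine lt_of_le_of_lt (setLIntegral_mono (by fun_prop) fun r (hr : 1 ≤ r) =>
      hC₂ r (by linarith)) ?_
    refine fin measurableSet_Ici (fun x (hx : 1 ≤ x) => lt_of_lt_of_le one_pos hx) ?_ C₂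
    rw [integrableOn_Ici_iff_integrableOn_Ioi, integrableOn_Ioi_rpow_iff one_pos]
    have : (2 * (1 / 2 - b + 1 / s) + θ) * s = (1 - 2 * b + θ) * s + 2 := by
      field_simp
      ring
    nlinarith

end KGS

/-! ### The `TT*` identity and Gaussian subordination of the weight -/

namespace KGS

open scoped ComplexConjugate

/-- The `TT*` identity, with the absolute value inside: for a bounded kernel on finite measure
spaces. -/
theorem lintegral_enorm_integral_sq_le {Z S : Type*} [MeasurableSpace Z] [MeasurableSpace S]
    {μ : Measure Z} {l : Measure S} [IsFiniteMeasure μ] [IsFiniteMeasure l] {E : Z → S → ℂ}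
    (hE : Measurable (Function.uncurry E)) {C : ℝ} (hC : ∀ z s, ‖E z s‖ ≤ C) :
    ∫⁻ z, ‖∫ s, E z s ∂l‖ₑ ^ 2 ∂μ ≤
      ∫⁻ t, ∫⁻ s, ‖∫ z, E z t * conj (E z s) ∂μ‖ₑ ∂l ∂l := by
  have hG : StronglyMeasurable fun z => ∫ s, E z s ∂l :=
    hE.stronglyMeasurable.integral_prod_right
  have hGb : ∀ z, ‖∫ s, E z s ∂l‖ ≤ C * l.real Set.univ := fun z =>
    norm_integral_le_of_norm_le_const (Filter.Eventually.of_forall (hC z))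
  have hF : Measurable fun w : Z × (S × S) => E w.1 w.2.1 * conj (E w.1 w.2.2) := by
    have h1 : Measurable fun w : Z × (S × S) => E w.1 w.2.1 :=
      hE.comp (f := fun w : Z × (S × S) => (w.1, w.2.1)) (by fun_prop)
    have h2 : Measurable fun w : Z × (S × S) => E w.1 w.2.2 :=
      hE.comp (f := fun w : Z × (S × S) => (w.1, w.2.2)) (by fun_prop)
    exact h1.mul (Complex.continuous_conj.measurable.comp h2)
  have hFi : Integrable (fun w : Z × (S × S) => E w.1 w.2.1 * conj (E w.1 w.2.2))
      (μ.prod (l.prod l)) := by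
    refine Integrable.of_bound hF.aestronglyMeasurable (C * C)
      (Filter.Eventually.of_forall fun w => ?_)
    rw [norm_mul, RCLike.norm_conj]
    exact mul_le_mul (hC _ _) (hC _ _) (norm_nonneg _) ((norm_nonneg _).trans (hC w.1 w.2.1))
  have hsq : Integrable (fun z => ‖∫ s, E z s ∂l‖ ^ 2) μ := by
    refine Integrable.of_bound (hG.norm.pow 2).aestronglyMeasurable ((C * l.real Set.univ) ^ 2)
      (Filter.Eventually.of_forall fun z => ?_)
    rw [Real.norm_of_nonneg (by positivity)]
    gcongr
    exact hGb z
  -- The square is written as the norm of one complex integral, so that Fubini is applied to the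
  -- signed double integral. Absolute values are taken only after the `z`-integration, which
  -- preserves its oscillation.
  have e1 : ∫⁻ z, ‖∫ s, E z s ∂l‖ₑ ^ 2 ∂μ = ‖∫ z, ((‖∫ s, E z s ∂l‖ ^ 2 : ℝ) : ℂ) ∂μ‖ₑ := by
    rw [integral_complex_ofReal]
    have h0 : 0 ≤ ∫ z, ‖∫ s, E z s ∂l‖ ^ 2 ∂μ := integral_nonneg fun z => by positivity
    rw [← ofReal_norm, Complex.norm_of_nonneg h0,
      ofReal_integral_eq_lintegral_ofReal hsq
      (Filter.Eventually.of_forall fun z => by positivity)]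
    refine lintegral_congr fun z => ?_
    rw [ENNReal.ofReal_pow (norm_nonneg _), ofReal_norm]
  have e2 : ∀ z, ((‖∫ s, E z s ∂l‖ ^ 2 : ℝ) : ℂ) =
      ∫ w, E z w.1 * conj (E z w.2) ∂(l.prod l) := by
    intro z
    rw [integral_prod_mul (E z) (fun s => conj (E z s)), integral_conj, RCLike.mul_conj]
    push_cast
    rfl
  rw [e1]
  simp_rw [e2]
  have e3 := integral_integral_swap (f := fun z (w : S × S) => E z w.1 * conj (E z w.2)) hFi
  rw [e3]
  refine (enorm_integral_le_lintegral_enorm _).trans ?_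
  rw [lintegral_prod]
  refine AEStronglyMeasurable.enorm ?_
  exact (StronglyMeasurable.integral_prod_left' (f := fun w : Z × (S × S) =>
    E w.1 w.2.1 * conj (E w.1 w.2.2)) hF.stronglyMeasurable).aestronglyMeasurable

/-- The character `e^{2πix}`. -/
noncomputable def wave (x : ℝ) : ℂ := Complex.exp (((2 * Real.pi * x : ℝ) : ℂ) * Complex.I)

theorem norm_wave (x : ℝ) : ‖wave x‖ = 1 := Complex.norm_exp_ofReal_mul_I _

theorem enorm_wave (x : ℝ) : ‖wave x‖ₑ = 1 := by
  rw [← ofReal_norm, norm_wave, ENNReal.ofReal_one]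

theorem wave_add (x y : ℝ) : wave (x + y) = wave x * wave y := by
  unfold wave
  rw [← Complex.exp_add]
  congr 1
  push_cast
  ring

theorem conj_wave (x : ℝ) : conj (wave x) = wave (-x) := by
  unfold wave
  rw [← Complex.exp_conj]
  congr 1
  rw [map_mul, Complex.conj_ofReal, Complex.conj_I]
  push_cast
  ring

theorem continuous_wave : Continuous wave := by
  unfold wave
  fun_prop

@[fun_prop]
theorem measurable_wave : Measurable wave := continuous_wave.measurable

theorem wave_mul_conj_wave (x y : ℝ) : wave x * conj (wave y) = wave (x - y) := by
  rw [conj_wave, ← wave_add, sub_eq_add_neg]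

theorem integral_wave_mul_cexp {β : ℂ} (hβ : 0 < β.re) (r : ℝ) :
    ∫ σ : ℝ, wave (r * σ) * Complex.exp (-β * σ ^ 2) =
      (Real.pi / β) ^ (1 / 2 : ℂ) * Complex.exp (-(2 * Real.pi * r) ^ 2 / (4 * β)) := by
  rw [← fourierIntegral_gaussian hβ]
  refine integral_congr_ae (Filter.Eventually.of_forall fun σ => ?_)
  unfold wave
  simp only
  congr 2
  push_cast
  ring

/-- The Gaussian measure on the frequency line. -/
noncomputable def gaussMeasure (δ : ℝ) : Measure ℝ :=
  volume.withDensity fun σ => ENNReal.ofReal (Real.exp (-δ * σ ^ 2))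

theorem isFiniteMeasure_gaussMeasure {δ : ℝ} (hδ : 0 < δ) : IsFiniteMeasure (gaussMeasure δ) := by
  refine isFiniteMeasure_withDensity_ofReal ?_
  exact (integrable_exp_neg_mul_sq hδ).2

theorem integral_gaussMeasure (δ : ℝ) (f : ℝ → ℂ) :
    ∫ σ, f σ ∂(gaussMeasure δ) = ∫ σ, f σ * Complex.exp (-δ * σ ^ 2) := by
  unfold gaussMeasure
  rw [integral_withDensity_eq_integral_toReal_smul (by fun_prop)
    (Filter.Eventually.of_forall fun σ => ENNReal.ofReal_lt_top)]
  refine integral_congr_ae (Filter.Eventually.of_forall fun σ => ?_)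
  simp only
  rw [ENNReal.toReal_ofReal (by positivity), Complex.real_smul, mul_comm]
  push_cast
  rfl

theorem lintegral_gaussMeasure (δ : ℝ) {f : ℝ → ℝ≥0∞} (hf : Measurable f) :
    ∫⁻ σ, f σ ∂(gaussMeasure δ) = ∫⁻ σ, ENNReal.ofReal (Real.exp (-δ * σ ^ 2)) * f σ := by
  unfold gaussMeasure
  rw [lintegral_withDensity_eq_lintegral_mul _ (by fun_prop) hf]
  rfl

/-- The width `4π²δ` is chosen so that the transform is the heat kernel at time `δ`, the Gaussian
from which `besselKernel` is built. -/
theorem enorm_integral_gaussMeasure_wave {δ : ℝ} (hδ : 0 < δ) (r : ℝ) :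
    ‖∫ σ, wave (r * σ) ∂(gaussMeasure (4 * Real.pi ^ 2 * δ))‖ₑ =
      ENNReal.ofReal ((4 * Real.pi * δ) ^ (-1 / 2 : ℝ) * Real.exp (-r ^ 2 / (4 * δ))) := by
  have h0 : 0 < 4 * Real.pi ^ 2 * δ := by positivity
  rw [integral_gaussMeasure, integral_wave_mul_cexp (by rw [Complex.ofReal_re]; exact h0),
    ← ofReal_norm, norm_mul]
  congr 2
  · rw [← Complex.ofReal_div, Complex.norm_cpow_eq_rpow_re_of_pos (by positivity)]
    rw [show (-1 / 2 : ℝ) = -(1 / 2) by ring, Real.rpow_neg (by positivity),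
      ← Real.inv_rpow (by positivity)]
    norm_num
    congr 1
    field_simp
  · rw [Complex.norm_exp]
    congr 1
    rw [show -(2 * (Real.pi : ℂ) * r) ^ 2 / (4 * ((4 * Real.pi ^ 2 * δ : ℝ) : ℂ)) =
      ((-(2 * Real.pi * r) ^ 2 / (4 * (4 * Real.pi ^ 2 * δ)) : ℝ) : ℂ) by push_cast; ring,
      Complex.ofReal_re]
    field_simp
    ring

section testing

variable {Y : Type*} [MeasurableSpace Y] {ν : Measure Y} [IsFiniteMeasure ν] {φ : Y → ℝ}
  {g : Y → ℝ → ℂ} {C T : ℝ} {a ρ : ℝ → ℝ≥0∞}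

/-- `TT*` for the finite measure that is the product of `ν` and a Gaussian in `σ = τ - φ`. Its
kernel factors into the correlation of `g` along the free flow, bounded by hypothesis, and the
transform of the Gaussian. The Gaussian stands in for the weight `⟨2πσ⟩^(-2b)`, which is not
integrable for `b ≤ 1/2`. -/
theorem lintegral_gauss_testing (hφ : Measurable φ) (hg : Measurable (Function.uncurry g))
    (hC : ∀ y t, ‖g y t‖ ≤ C)
    (hI : ∀ t s, t ≠ s → ‖∫ y, wave ((t - s) * φ y) * (g y t * conj (g y s)) ∂ν‖ₑ ≤
      a t * a s * ρ (t - s)) {δ : ℝ} (hδ : 0 < δ) :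
    ∫⁻ y, (∫⁻ σ, ENNReal.ofReal (Real.exp (-(4 * Real.pi ^ 2 * δ) * σ ^ 2)) *
        ‖∫ t in Set.Icc (-T) T, wave (t * (σ + φ y)) * g y t‖ₑ ^ 2) ∂ν ≤
      ∫⁻ t in Set.Icc (-T) T, ∫⁻ s in Set.Icc (-T) T, a t * a s * ρ (t - s) *
        ENNReal.ofReal ((4 * Real.pi * δ) ^ (-1 / 2 : ℝ) * Real.exp (-(t - s) ^ 2 / (4 * δ))) := by
  set μ := gaussMeasure (4 * Real.pi ^ 2 * δ) with hμ
  have : IsFiniteMeasure μ := isFiniteMeasure_gaussMeasure (by positivity)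
  set l := (volume : Measure ℝ).restrict (Set.Icc (-T) T) with hl
  let E : Y × ℝ → ℝ → ℂ := fun z t => wave (t * (z.2 + φ z.1)) * g z.1 t
  have hE : Measurable (Function.uncurry E) := by
    have h1 : Measurable fun w : (Y × ℝ) × ℝ => g w.1.1 w.2 :=
      hg.comp (f := fun w : (Y × ℝ) × ℝ => (w.1.1, w.2)) (by fun_prop)
    have h2 : Measurable fun w : (Y × ℝ) × ℝ => wave (w.2 * (w.1.2 + φ w.1.1)) := by fun_prop
    exact h2.mul h1
  have hEC : ∀ z t, ‖E z t‖ ≤ C := by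
    intro z t
    simp only [E, norm_mul, norm_wave, one_mul]
    exact hC _ _
  have h := lintegral_enorm_integral_sq_le (μ := ν.prod μ) (l := l) hE hEC
  have hm : Measurable fun z : Y × ℝ => ‖∫ t, E z t ∂l‖ₑ ^ 2 :=
    (hE.stronglyMeasurable.integral_prod_right (ν := l)).enorm.pow_const 2
  rw [lintegral_prod _ hm.aemeasurable] at h
  have h' : ∫⁻ y, (∫⁻ σ, ‖∫ t, E (y, σ) t ∂l‖ₑ ^ 2 ∂μ) ∂ν =
      ∫⁻ y, (∫⁻ σ, ENNReal.ofReal (Real.exp (-(4 * Real.pi ^ 2 * δ) * σ ^ 2)) *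
        ‖∫ t, wave (t * (σ + φ y)) * g y t ∂l‖ₑ ^ 2) ∂ν := by
    refine lintegral_congr fun y => ?_
    exact lintegral_gaussMeasure _ (hm.comp (by fun_prop : Measurable fun σ : ℝ => (y, σ)))
  rw [h'] at h
  refine h.trans (lintegral_mono fun t => lintegral_mono_ae ?_)
  -- Correlations are controlled only off the diagonal, which is null.
  have hne : ∀ᵐ s ∂l, s ≠ t := by
    refine ae_restrict_of_ae ?_
    rw [ae_iff]
    simp
  filter_upwards [hne] with s hs
  have e : ∫ z, E z t * conj (E z s) ∂(ν.prod μ) =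
      (∫ y, wave ((t - s) * φ y) * (g y t * conj (g y s)) ∂ν) *
        ∫ σ, wave ((t - s) * σ) ∂μ := by
    rw [← integral_prod_mul]
    refine integral_congr_ae (Filter.Eventually.of_forall fun z => ?_)
    simp only [E, map_mul]
    have : wave ((t - s) * φ z.1) * wave ((t - s) * z.2) =
        wave (t * (z.2 + φ z.1)) * conj (wave (s * (z.2 + φ z.1))) := by
      rw [wave_mul_conj_wave, ← wave_add]
      congr 1
      ring
    linear_combination (-(g z.1 t * conj (g z.1 s))) * this
  rw [e, enorm_mul, enorm_integral_gaussMeasure_wave hδ]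
  gcongr
  exact hI t s hs.symm

/-- The Gamma integral `Γ(b) A^(-b) = ∫ e^(-Aδ) δ^(b-1) dδ` at `A = 1 + (2πσ)²`. It writes the
weight as a positive superposition of Gaussians, so the estimate for a single Gaussian can be
integrated in `δ`. -/
theorem lintegral_exp_subordination {b : ℝ} (hb : 0 < b) (σ : ℝ) :
    ∫⁻ δ in Set.Ioi (0 : ℝ), ENNReal.ofReal (Real.exp (-δ) * δ ^ (b - 1)) *
        ENNReal.ofReal (Real.exp (-(4 * Real.pi ^ 2 * δ) * σ ^ 2)) =
      ENNReal.ofReal (Real.Gamma b) * ENNReal.ofReal (bracket (2 * Real.pi * σ) ^ (-(2 * b))) := by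
  have hs : 0 < 1 + (2 * Real.pi * σ) ^ 2 := by positivity
  have h := Real.integral_rpow_mul_exp_neg_mul_Ioi hb hs
  have hG := Real.Gamma_pos_of_pos hb
  have e : bracket (2 * Real.pi * σ) ^ (-(2 * b)) = (1 / (1 + (2 * Real.pi * σ) ^ 2)) ^ b := by
    unfold bracket
    rw [← Real.rpow_mul hs.le, one_div (1 + _), Real.inv_rpow hs.le, ← Real.rpow_neg hs.le]
    congr 1
    ring
  rw [e, ← ENNReal.ofReal_mul hG.le, mul_comm (Real.Gamma b), ← h]
  have hi : IntegrableOn (fun t : ℝ => t ^ (b - 1) * Real.exp (-((1 + (2 * Real.pi * σ) ^ 2) * t)))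
      (Set.Ioi 0) := by
    -- A divergent Bochner integral has the value `0`, whereas the closed formula is positive.
    by_contra hcon
    rw [integral_undef hcon] at h
    have : 0 < (1 / (1 + (2 * Real.pi * σ) ^ 2)) ^ b * Real.Gamma b := by positivity
    linarith
  rw [ofReal_integral_eq_lintegral_ofReal hi]
  · refine setLIntegral_congr_fun measurableSet_Ioi fun δ hδ => ?_
    have hδ' : 0 < δ := hδ
    rw [← ENNReal.ofReal_mul (by positivity), mul_right_comm, ← Real.exp_add, mul_comm]
    congr 3
    ring
  · filter_upwards [ae_restrict_mem measurableSet_Ioi] with δ hδ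
    have : (0 : ℝ) < δ := hδ
    positivity

theorem lintegral_bracket_eq {G : Y × ℝ → ℝ≥0∞} (hG : Measurable G) {b : ℝ} (hb : 0 < b) :
    ENNReal.ofReal (Real.Gamma b) *
      ∫⁻ y, (∫⁻ σ, ENNReal.ofReal (bracket (2 * Real.pi * σ) ^ (-(2 * b))) * G (y, σ)) ∂ν =
    ∫⁻ δ in Set.Ioi (0 : ℝ), ENNReal.ofReal (Real.exp (-δ) * δ ^ (b - 1)) *
      ∫⁻ y, (∫⁻ σ, ENNReal.ofReal (Real.exp (-(4 * Real.pi ^ 2 * δ) * σ ^ 2)) * G (y, σ)) ∂ν := by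
  have hbr : Measurable fun σ : ℝ =>
      ENNReal.ofReal (bracket (2 * Real.pi * σ) ^ (-(2 * b))) := by
    unfold bracket
    fun_prop
  have hm1 : Measurable fun w : Y × ℝ =>
      ENNReal.ofReal (bracket (2 * Real.pi * w.2) ^ (-(2 * b))) * G w :=
    (hbr.comp measurable_snd).fun_mul hG
  have hm2 : ∀ δ : ℝ, Measurable fun w : Y × ℝ =>
      ENNReal.ofReal (Real.exp (-(4 * Real.pi ^ 2 * δ) * w.2 ^ 2)) * G w := by
    intro δ; fun_prop
  have hm3 : Measurable fun w : (Y × ℝ) × ℝ =>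
      ENNReal.ofReal (Real.exp (-w.2) * w.2 ^ (b - 1)) *
      (ENNReal.ofReal (Real.exp (-(4 * Real.pi ^ 2 * w.2) * w.1.2 ^ 2)) * G w.1) := by fun_prop
  have e1 := lintegral_prod (μ := ν) (ν := (volume : Measure ℝ)) _ hm1.aemeasurable
  have e2 := fun δ => lintegral_prod (μ := ν) (ν := (volume : Measure ℝ)) _ (hm2 δ).aemeasurable
  simp only at e1 e2
  simp_rw [← e1, ← e2, ← lintegral_const_mul _ (hm2 _)]
  rw [← lintegral_const_mul _ hm1]
  have e3 := lintegral_lintegral_swap (μ := ν.prod (volume : Measure ℝ))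
    (ν := (volume : Measure ℝ).restrict (Set.Ioi 0)) (f := fun w δ =>
      ENNReal.ofReal (Real.exp (-δ) * δ ^ (b - 1)) *
      (ENNReal.ofReal (Real.exp (-(4 * Real.pi ^ 2 * δ) * w.2 ^ 2)) * G w)) hm3.aemeasurable
  rw [← e3]
  refine lintegral_congr fun w => ?_
  rw [← mul_assoc, ← lintegral_exp_subordination hb, ← lintegral_mul_const _ (by fun_prop)]
  simp only [mul_assoc]

theorem lintegral_mul_besselKernel {l : Measure ℝ} [SFinite l] {F : ℝ × ℝ → ℝ≥0∞}
    (hF : Measurable F) (b : ℝ) :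
    ∫⁻ δ in Set.Ioi (0 : ℝ), ENNReal.ofReal (Real.exp (-δ) * δ ^ (b - 1)) *
        ∫⁻ t, ∫⁻ s, F (t, s) * ENNReal.ofReal
          ((4 * Real.pi * δ) ^ (-1 / 2 : ℝ) * Real.exp (-(t - s) ^ 2 / (4 * δ))) ∂l ∂l =
      ∫⁻ t, ∫⁻ s, F (t, s) * besselKernel b (t - s) ∂l ∂l := by
  have hk := measurable_besselKernel b
  have hm5 : Measurable fun w : (ℝ × ℝ) × ℝ =>
      F w.1 * (ENNReal.ofReal (Real.exp (-w.2) * w.2 ^ (b - 1)) *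
        ENNReal.ofReal ((4 * Real.pi * w.2) ^ (-1 / 2 : ℝ) *
          Real.exp (-(w.1.1 - w.1.2) ^ 2 / (4 * w.2)))) := by fun_prop
  have hm6 : Measurable fun w : ℝ × ℝ => F w * besselKernel b (w.1 - w.2) := by fun_prop
  have hm7 : ∀ δ : ℝ, Measurable fun w : ℝ × ℝ => F w * ENNReal.ofReal
    ((4 * Real.pi * δ) ^ (-1 / 2 : ℝ) * Real.exp (-(w.1 - w.2) ^ 2 / (4 * δ))) := by
    intro δ; fun_prop
  have e1 := lintegral_prod (μ := l) (ν := l) _ hm6.aemeasurable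
  have e2 := fun δ => lintegral_prod (μ := l) (ν := l) _ (hm7 δ).aemeasurable
  simp only at e1 e2
  simp_rw [← e1, ← e2, ← lintegral_const_mul _ (hm7 _)]
  have e3 := lintegral_lintegral_swap (μ := l.prod l)
    (ν := (volume : Measure ℝ).restrict (Set.Ioi 0)) (f := fun w δ =>
      F w * (ENNReal.ofReal (Real.exp (-δ) * δ ^ (b - 1)) *
        ENNReal.ofReal ((4 * Real.pi * δ) ^ (-1 / 2 : ℝ) *
          Real.exp (-(w.1 - w.2) ^ 2 / (4 * δ))))) hm5.aemeasurable
  simp_rw [mul_left_comm _ (F _)]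
  rw [← e3]
  refine lintegral_congr fun w => ?_
  rw [lintegral_const_mul _ (by fun_prop)]
  rfl

/-- The estimate for a single Gaussian, integrated against `e^(-δ) δ^(b-1) dδ`. On the left the
Gaussians add up to the weight, on the right the heat kernels add up to `besselKernel`. All
integrands are nonnegative, so the interchanges need only measurability. -/
theorem lintegral_bracket_testing (hφ : Measurable φ) (hg : Measurable (Function.uncurry g))
    (hC : ∀ y t, ‖g y t‖ ≤ C) (ha : Measurable a) (hρ : Measurable ρ)
    (hI : ∀ t s, t ≠ s → ‖∫ y, wave ((t - s) * φ y) * (g y t * conj (g y s)) ∂ν‖ₑ ≤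
      a t * a s * ρ (t - s)) {b : ℝ} (hb : 0 < b) :
    ENNReal.ofReal (Real.Gamma b) *
      ∫⁻ y, (∫⁻ τ, ENNReal.ofReal (bracket (2 * Real.pi * (τ - φ y)) ^ (-(2 * b))) *
        ‖∫ t in Set.Icc (-T) T, wave (t * τ) * g y t‖ₑ ^ 2) ∂ν ≤
      ∫⁻ t in Set.Icc (-T) T, ∫⁻ s in Set.Icc (-T) T, a t * a s * ρ (t - s) *
        besselKernel b (t - s) := by
  set l := (volume : Measure ℝ).restrict (Set.Icc (-T) T) with hl
  have hmG : Measurable fun w : Y × ℝ => ‖∫ t, wave (t * (w.2 + φ w.1)) * g w.1 t ∂l‖ₑ ^ 2 := by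
    refine (StronglyMeasurable.integral_prod_right (ν := l)
      (f := fun (w : Y × ℝ) t => wave (t * (w.2 + φ w.1)) * g w.1 t)
      (Measurable.stronglyMeasurable ?_)).enorm.pow_const 2
    have h1 : Measurable fun w : (Y × ℝ) × ℝ => g w.1.1 w.2 :=
      hg.comp (f := fun w : (Y × ℝ) × ℝ => (w.1.1, w.2)) (by fun_prop)
    have h2 : Measurable fun w : (Y × ℝ) × ℝ => wave (w.2 * (w.1.2 + φ w.1.1)) := by fun_prop
    exact h2.mul h1
  have e1 : ∀ y, ∫⁻ τ, ENNReal.ofReal (bracket (2 * Real.pi * (τ - φ y)) ^ (-(2 * b))) *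
        ‖∫ t, wave (t * τ) * g y t ∂l‖ₑ ^ 2 =
      ∫⁻ σ, ENNReal.ofReal (bracket (2 * Real.pi * σ) ^ (-(2 * b))) *
        ‖∫ t, wave (t * (σ + φ y)) * g y t ∂l‖ₑ ^ 2 := by
    intro y
    rw [← lintegral_add_right_eq_self _ (φ y)]
    simp only [add_sub_cancel_right]
  simp_rw [e1]
  rw [lintegral_bracket_eq hmG hb,
    ← lintegral_mul_besselKernel (F := fun w => a w.1 * a w.2 * ρ (w.1 - w.2)) (by fun_prop)]
  refine lintegral_mono_ae ?_
  filter_upwards [ae_restrict_mem measurableSet_Ioi] with δ hδ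
  gcongr
  exact lintegral_gauss_testing hφ hg hC hI hδ

end testing

end KGS

/-! ### Duality: the pairing estimate for the synthesis operator -/

namespace KGS

open scoped ComplexConjugate

theorem lintegral_mul_sq_le {Z : Type*} [MeasurableSpace Z] {μ : Measure Z} {f g : Z → ℝ≥0∞}
    (hf : AEMeasurable f μ) (hg : AEMeasurable g μ) :
    (∫⁻ z, f z * g z ∂μ) ^ 2 ≤ (∫⁻ z, f z ^ 2 ∂μ) * ∫⁻ z, g z ^ 2 ∂μ := by
  have h := ENNReal.lintegral_mul_le_Lp_mul_Lq μ Real.HolderConjugate.two_two hf hg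
  calc _ ≤ _ := pow_le_pow_left' h 2
    _ = _ := by
      rw [mul_pow, ← ENNReal.rpow_natCast, ← ENNReal.rpow_natCast, ← ENNReal.rpow_mul,
        ← ENNReal.rpow_mul]
      norm_num

/-- Absorption at the end of a duality argument. -/
theorem le_rpow_of_sq_le_mul_rpow {X B : ℝ≥0∞} (hX : X ≠ ∞) {q : ℝ} (hq : 2 ≤ q)
    (h : X ^ 2 ≤ B * X ^ (2 * (q - 1) / q)) : X ≤ B ^ (q / 2) := by
  rcases eq_or_ne X 0 with rfl | h0
  · exact bot_le
  have h1 : X ^ (2 / q) ≤ B := by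
    have e : X ^ 2 = X ^ (2 / q) * X ^ (2 * (q - 1) / q) := by
      rw [← ENNReal.rpow_add _ _ h0 hX, ← ENNReal.rpow_natCast]
      congr 1
      field_simp
      push_cast
      ring
    rw [e] at h
    refine (ENNReal.mul_le_mul_iff_left ?_ ?_).1 h
    · exact (ENNReal.rpow_pos (pos_iff_ne_zero.2 h0) hX).ne'
    · exact ENNReal.rpow_ne_top_of_ne_zero h0 hX
  calc X = (X ^ (2 / q)) ^ (q / 2) := by
        rw [← ENNReal.rpow_mul]
        convert (ENNReal.rpow_one X).symm using 2
        field_simp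
    _ ≤ _ := by gcongr

/-- Absorption requires finite quantities, which bounded functions provide only on bounded time
intervals; monotone convergence then removes the cutoff. -/
theorem lintegral_le_of_forall_Icc {f : ℝ → ℝ≥0∞} {B : ℝ≥0∞}
    (h : ∀ T : ℝ, ∫⁻ t in Set.Icc (-T) T, f t ≤ B) : ∫⁻ t, f t ≤ B := by
  have hU : (⋃ n : ℕ, Set.Icc (-(n : ℝ)) n) = Set.univ := by
    refine Set.eq_univ_of_forall fun x => Set.mem_iUnion.2 ?_
    obtain ⟨n, hn⟩ := exists_nat_ge |x|
    exact ⟨n, abs_le.1 hn⟩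
  rw [← setLIntegral_univ, ← hU, setLIntegral_iUnion_of_directed]
  · exact iSup_le fun n => h n
  · refine Monotone.directed_le fun m n hmn => ?_
    have : (m : ℝ) ≤ n := by exact_mod_cast hmn
    exact Set.Icc_subset_Icc (by linarith) this

/-- The synthesis operator in the time variable. -/
noncomputable def evol {Y : Type*} (R : ℝ) (h : Y → ℝ → ℂ) (y : Y) (t : ℝ) : ℂ :=
  ∫ τ in Set.Icc (-R) R, wave (t * τ) * h y τ

theorem norm_evol_le {Y : Type*} {h : Y → ℝ → ℂ} {D R : ℝ} (hD : ∀ y τ, ‖h y τ‖ ≤ D) (y : Y) (t : ℝ) :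
    ‖evol R h y t‖ ≤ D * (volume.restrict (Set.Icc (-R) R)).real Set.univ := by
  refine norm_integral_le_of_norm_le_const (Filter.Eventually.of_forall fun τ => ?_)
  rw [norm_mul, norm_wave, one_mul]
  exact hD y τ

/-- The constant of the embedding with decay `|r| ^ (-θ)`. -/
noncomputable def embConst (b θ q : ℝ) : ℝ≥0∞ :=
  (ENNReal.ofReal (Real.Gamma b))⁻¹ *
    (∫⁻ r, (ENNReal.ofReal (|r| ^ (-θ)) * besselKernel b r) ^ (q / 2)) ^ (2 / q)

/-- This is where the admissible `q` are decided: `(1-2b+θ) q < 2` says that the kernel `|r|^(-θ)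
k_b(r)` of `TT*` is in `L^{q/2}`. -/
theorem embConst_lt_top {b θ q : ℝ} (hb0 : 0 < b) (hb : b < 1 / 2) (hθ : 0 ≤ θ) (hq : 2 ≤ q)
    (h : (1 - 2 * b + θ) * q < 2) : embConst b θ q < ∞ := by
  refine ENNReal.mul_lt_top ?_ ?_
  · rw [ENNReal.inv_lt_top, ENNReal.ofReal_pos]
    exact Real.Gamma_pos_of_pos hb0
  · refine ENNReal.rpow_lt_top_of_nonneg (by positivity)
      (lintegral_besselKernel_lt_top hb hθ (by linarith) (by linarith)).ne

/-- The square of the norm of Bourgain type of `h`. -/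
noncomputable def modNormSq {Y : Type*} [MeasurableSpace Y] (ν : Measure Y) (φ : Y → ℝ)
    (b R : ℝ) (h : Y → ℝ → ℂ) : ℝ≥0∞ :=
  ∫⁻ y, (∫⁻ τ in Set.Icc (-R) R,
    ENNReal.ofReal (bracket (2 * Real.pi * (τ - φ y)) ^ (2 * b)) * ‖h y τ‖ₑ ^ 2) ∂ν

section evol

variable {Y : Type*} [MeasurableSpace Y] {ν : Measure Y} [IsFiniteMeasure ν] {φ : Y → ℝ}
  {g h : Y → ℝ → ℂ} {C D T R : ℝ} {a : ℝ → ℝ≥0∞} {b θ q : ℝ} {K : ℝ≥0∞}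

theorem measurable_evol (hh : Measurable (Function.uncurry h)) :
    Measurable (Function.uncurry (evol R h)) := by
  refine (StronglyMeasurable.integral_prod_right (ν := volume.restrict (Set.Icc (-R) R))
    (f := fun (w : Y × ℝ) τ => wave (w.2 * τ) * h w.1 τ)
    (Measurable.stronglyMeasurable ?_)).measurable
  have h1 : Measurable fun w : (Y × ℝ) × ℝ => h w.1.1 w.2 :=
    hh.comp (f := fun w : (Y × ℝ) × ℝ => (w.1.1, w.2)) (by fun_prop)
  have h2 : Measurable fun w : (Y × ℝ) × ℝ => wave (w.1.2 * w.2) := by fun_prop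
  exact h2.mul h1

/-- Moves the synthesis operator to the other side of the pairing; with bounded data on bounded
intervals Fubini applies without further conditions. -/
theorem integral_evol_mul (hg : Measurable (Function.uncurry g)) (hC : ∀ y t, ‖g y t‖ ≤ C)
    (hh : Measurable (Function.uncurry h)) (hD : ∀ y τ, ‖h y τ‖ ≤ D) :
    ∫ t in Set.Icc (-T) T, (∫ y, evol R h y t * g y t ∂ν) =
      ∫ y, (∫ τ in Set.Icc (-R) R, h y τ *
        ∫ t in Set.Icc (-T) T, wave (t * τ) * g y t) ∂ν := by
  set l := (volume : Measure ℝ).restrict (Set.Icc (-T) T) with hl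
  set k := (volume : Measure ℝ).restrict (Set.Icc (-R) R) with hk
  have hb : ∀ w : (Y × ℝ) × ℝ, ‖wave (w.1.2 * w.2) * h w.1.1 w.2 * g w.1.1 w.1.2‖ ≤ D * C := by
    intro w
    rw [norm_mul, norm_mul, norm_wave, one_mul]
    exact mul_le_mul (hD _ _) (hC _ _) (norm_nonneg _) ((norm_nonneg _).trans (hD w.1.1 w.2))
  have hev : Measurable fun w : Y × ℝ => evol R h w.1 w.2 * g w.1 w.2 :=
    (measurable_evol hh).mul hg
  have hevi : Integrable (fun w : Y × ℝ => evol R h w.1 w.2 * g w.1 w.2) (ν.prod l) := by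
    refine Integrable.of_bound hev.aestronglyMeasurable (D * k.real Set.univ * C)
      (Filter.Eventually.of_forall fun w => ?_)
    rw [norm_mul]
    have := norm_evol_le (R := R) hD w.1 w.2
    exact mul_le_mul this (hC _ _) (norm_nonneg _) ((norm_nonneg _).trans this)
  have e1 := integral_integral_swap (μ := ν) (ν := l) (f := fun y t => evol R h y t * g y t) hevi
  rw [← e1]
  refine integral_congr_ae (Filter.Eventually.of_forall fun y => ?_)
  simp only
  have eu : (Function.uncurry fun τ t => h y τ * (wave (t * τ) * g y t)) =
      fun w : ℝ × ℝ => wave (w.2 * w.1) * h y w.1 * g y w.2 := by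
    funext w
    simp only [Function.uncurry]
    ring
  have hmy : Measurable fun w : ℝ × ℝ => wave (w.2 * w.1) * h y w.1 * g y w.2 := by
    fun_prop
  have hby : ∀ w : ℝ × ℝ, ‖wave (w.2 * w.1) * h y w.1 * g y w.2‖ ≤ D * C :=
    fun w => hb ((y, w.2), w.1)
  have hi : Integrable (Function.uncurry fun τ t => h y τ * (wave (t * τ) * g y t)) (k.prod l) := by
    rw [eu]
    exact Integrable.of_bound hmy.aestronglyMeasurable (D * C) (Filter.Eventually.of_forall hby)
  have e2 := integral_integral_swap hi
  simp_rw [integral_const_mul] at e2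
  rw [e2]
  refine integral_congr_ae (Filter.Eventually.of_forall fun t => ?_)
  simp only
  unfold evol
  rw [← integral_mul_const]
  refine integral_congr_ae (Filter.Eventually.of_forall fun τ => ?_)
  simp only
  ring

/-- Cauchy-Schwarz with the weights `⟨·⟩^b` and `⟨·⟩^(-b)` separates `h` from the time transform of
`g`. The second factor is bounded by `TT*` and Young's inequality. The test function `g` enters only
through the size `a` of its correlations, so one statement serves scalar observables as well as
`L²`-valued functions. -/
theorem enorm_pairing_sq_le (hφ : Measurable φ) (hg : Measurable (Function.uncurry g))
    (hC : ∀ y t, ‖g y t‖ ≤ C) (ha : Measurable a)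
    (hI : ∀ t s, t ≠ s → ‖∫ y, wave ((t - s) * φ y) * (g y t * conj (g y s)) ∂ν‖ₑ ≤
      a t * a s * (K * ENNReal.ofReal (|t - s| ^ (-θ)))) (hb : 0 < b) (hq : 2 ≤ q)
    (hh : Measurable (Function.uncurry h)) (hD : ∀ y τ, ‖h y τ‖ ≤ D) :
    ‖∫ t in Set.Icc (-T) T, (∫ y, evol R h y t * g y t ∂ν)‖ₑ ^ 2 ≤
      embConst b θ q * K * modNormSq ν φ b R h *
        (∫⁻ t in Set.Icc (-T) T, a t ^ (q / (q - 1))) ^ (2 * (q - 1) / q) := by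
  have hq1 : 0 < q - 1 := by linarith
  rw [integral_evol_mul hg hC hh hD]
  set l := (volume : Measure ℝ).restrict (Set.Icc (-T) T) with hl
  set k := (volume : Measure ℝ).restrict (Set.Icc (-R) R) with hk
  set G : Y → ℝ → ℂ := fun y τ => ∫ t, wave (t * τ) * g y t ∂l with hG
  have hmG : Measurable (Function.uncurry G) := by
    refine (StronglyMeasurable.integral_prod_right (ν := l)
      (f := fun (w : Y × ℝ) t => wave (t * w.2) * g w.1 t)
      (Measurable.stronglyMeasurable ?_)).measurable
    have h1 : Measurable fun w : (Y × ℝ) × ℝ => g w.1.1 w.2 :=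
      hg.comp (f := fun w : (Y × ℝ) × ℝ => (w.1.1, w.2)) (by fun_prop)
    have h2 : Measurable fun w : (Y × ℝ) × ℝ => wave (w.2 * w.1.2) := by fun_prop
    exact h2.mul h1
  have hΓ : ENNReal.ofReal (Real.Gamma b) ≠ 0 := by
    simpa using Real.Gamma_pos_of_pos hb
  have hdual : ∫⁻ y, (∫⁻ τ, ENNReal.ofReal (bracket (2 * Real.pi * (τ - φ y)) ^ (-(2 * b))) *
      ‖G y τ‖ₑ ^ 2) ∂ν ≤ embConst b θ q * K *
        (∫⁻ t, a t ^ (q / (q - 1)) ∂l) ^ (2 * (q - 1) / q) := by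
    have h1 := lintegral_bracket_testing (T := T)
      (ρ := fun r => K * ENNReal.ofReal (|r| ^ (-θ))) hφ hg hC ha
      (by fun_prop) hI hb
    have hk := measurable_besselKernel b
    -- Young's inequality is on the whole line, so the restriction to the time interval is put into
    -- `a` as an indicator.
    have h2 := lintegral_bilinear_le
      (κ := fun r => ENNReal.ofReal (|r| ^ (-θ)) * besselKernel b r)
      (a := (Set.Icc (-T) T).indicator a) (by fun_prop) (ha.indicator measurableSet_Icc) hq
    have e1 : ∫⁻ t, (Set.Icc (-T) T).indicator a t ^ (q / (q - 1)) =
        ∫⁻ t, a t ^ (q / (q - 1)) ∂l := by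
      rw [hl, ← lintegral_indicator measurableSet_Icc]
      refine lintegral_congr fun t => ?_
      by_cases ht : t ∈ Set.Icc (-T) T
      · simp [ht]
      · simp only [ht, Set.indicator_of_notMem, not_false_eq_true]
        exact ENNReal.zero_rpow_of_pos (by positivity)
    have e2 : ∫⁻ t, ∫⁻ s, a t * a s * (K * ENNReal.ofReal (|t - s| ^ (-θ))) *
        besselKernel b (t - s) ∂l ∂l = K * ∫⁻ t, ∫⁻ s, (Set.Icc (-T) T).indicator a t *
          (Set.Icc (-T) T).indicator a s *
            (ENNReal.ofReal (|t - s| ^ (-θ)) * besselKernel b (t - s)) := by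
      have hai := ha.indicator (measurableSet_Icc (a := -T) (b := T))
      have hm : Measurable fun w : ℝ × ℝ => (Set.Icc (-T) T).indicator a w.1 *
          (Set.Icc (-T) T).indicator a w.2 *
            (ENNReal.ofReal (|w.1 - w.2| ^ (-θ)) * besselKernel b (w.1 - w.2)) := by fun_prop
      rw [← lintegral_const_mul _ hm.lintegral_prod_right', hl,
        ← lintegral_indicator measurableSet_Icc]
      refine lintegral_congr fun t => ?_
      rw [← lintegral_const_mul _ (by fun_prop)]
      by_cases ht : t ∈ Set.Icc (-T) T
      · rw [Set.indicator_of_mem ht, ← lintegral_indicator measurableSet_Icc]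
        refine lintegral_congr fun s => ?_
        by_cases hs : s ∈ Set.Icc (-T) T
        · simp only [hs, ht, Set.indicator_of_mem]
          ring
        · simp [hs]
      · simp [ht]
    rw [e2] at h1
    rw [e1] at h2
    have h3 := h1.trans (mul_le_mul_right h2 K)
    rw [ENNReal.mul_le_iff_le_inv hΓ ENNReal.ofReal_ne_top] at h3
    refine h3.trans (le_of_eq ?_)
    unfold embConst
    ring
  have hbr : ∀ c : ℝ, Measurable fun w : Y × ℝ =>
      ENNReal.ofReal (bracket (2 * Real.pi * (w.2 - φ w.1)) ^ c) := by
    intro c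
    unfold bracket
    fun_prop
  have hmul : ∀ x : ℝ, ENNReal.ofReal (bracket x ^ b) * ENNReal.ofReal (bracket x ^ (-b)) = 1 := by
    intro x
    have := bracket_pos x
    rw [← ENNReal.ofReal_mul (by positivity), ← Real.rpow_add this]
    simp
  have hsq : ∀ (x c : ℝ), ENNReal.ofReal (bracket x ^ c) ^ 2 = ENNReal.ofReal (bracket x ^ (2 * c)) := by
    intro x c
    have := bracket_pos x
    rw [← ENNReal.ofReal_pow (by positivity), ← Real.rpow_natCast, ← Real.rpow_mul this.le]
    congr 2
    push_cast
    ring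
  have hCS := lintegral_mul_sq_le (μ := ν.prod k)
    (f := fun w => ENNReal.ofReal (bracket (2 * Real.pi * (w.2 - φ w.1)) ^ b) * ‖h w.1 w.2‖ₑ)
    (g := fun w => ENNReal.ofReal (bracket (2 * Real.pi * (w.2 - φ w.1)) ^ (-b)) * ‖G w.1 w.2‖ₑ)
    (by fun_prop) (by fun_prop)
  calc ‖∫ y, (∫ τ, h y τ * G y τ ∂k) ∂ν‖ₑ ^ 2
      ≤ (∫⁻ y, (∫⁻ τ, ‖h y τ * G y τ‖ₑ ∂k) ∂ν) ^ 2 := by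
        gcongr
        refine (enorm_integral_le_lintegral_enorm _).trans (lintegral_mono fun y => ?_)
        exact enorm_integral_le_lintegral_enorm _
    _ = (∫⁻ w, ENNReal.ofReal (bracket (2 * Real.pi * (w.2 - φ w.1)) ^ b) * ‖h w.1 w.2‖ₑ *
          (ENNReal.ofReal (bracket (2 * Real.pi * (w.2 - φ w.1)) ^ (-b)) * ‖G w.1 w.2‖ₑ)
          ∂(ν.prod k)) ^ 2 := by
        rw [← lintegral_prod (fun w : Y × ℝ => ‖h w.1 w.2 * G w.1 w.2‖ₑ) (by fun_prop)]
        congr 1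
        refine lintegral_congr fun w => ?_
        rw [mul_mul_mul_comm, hmul, one_mul, enorm_mul]
    _ ≤ _ := hCS
    _ = modNormSq ν φ b R h * ∫⁻ y, (∫⁻ τ, ENNReal.ofReal
          (bracket (2 * Real.pi * (τ - φ y)) ^ (-(2 * b))) * ‖G y τ‖ₑ ^ 2 ∂k) ∂ν := by
        rw [lintegral_prod _ (by fun_prop), lintegral_prod _ (by fun_prop)]
        simp only [mul_pow, hsq]
        unfold modNormSq
        congr 1
        simp only [mul_neg]
    _ ≤ modNormSq ν φ b R h * (embConst b θ q * K *
        (∫⁻ t, a t ^ (q / (q - 1)) ∂l) ^ (2 * (q - 1) / q)) := by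
        refine mul_le_mul_right ((lintegral_mono fun y => ?_).trans hdual) _
        exact lintegral_mono' Measure.restrict_le_self le_rfl
    _ = _ := by ring

end evol

end KGS

/-! ### Embeddings in time: scalar observables and `L²` values -/

namespace KGS

open scoped ComplexConjugate

section evol

variable {Y : Type*} [MeasurableSpace Y] {ν : Measure Y} [IsFiniteMeasure ν] {φ : Y → ℝ}
  {h e : Y → ℝ → ℂ} {D R : ℝ} {b θ q : ℝ} {K : ℝ≥0}

/-- Scalar observables of the evolution with decaying correlations are in `L^q` in time. -/
theorem lintegral_evol_observable_le (hφ : Measurable φ) (he : Measurable (Function.uncurry e))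
    (he1 : ∀ y t, ‖e y t‖ ≤ 1)
    (hI : ∀ t s, t ≠ s → ‖∫ y, wave ((t - s) * φ y) * (e y t * conj (e y s)) ∂ν‖ₑ ≤
      K * ENNReal.ofReal (|t - s| ^ (-θ))) (hb : 0 < b) (hq : 2 ≤ q)
    (hh : Measurable (Function.uncurry h)) (hD : ∀ y τ, ‖h y τ‖ ≤ D) :
    ∫⁻ t, ‖∫ y, evol R h y t * e y t ∂ν‖ₑ ^ q ≤
      (embConst b θ q * K * modNormSq ν φ b R h) ^ (q / 2) := by
  have hq0 : 0 < q := by linarith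
  have hq1 : 0 < q - 1 := by linarith
  set F : ℝ → ℂ := fun t => ∫ y, evol R h y t * e y t ∂ν with hF
  have hFm : Measurable F := by
    refine (StronglyMeasurable.integral_prod_left (μ := ν)
      (f := fun y t => evol R h y t * e y t) (Measurable.stronglyMeasurable ?_)).measurable
    exact (measurable_evol hh).mul he
  set D' := D * (volume.restrict (Set.Icc (-R) R)).real Set.univ with hD'
  have hFb : ∀ t, ‖F t‖ ≤ D' * ν.real Set.univ := by
    intro t
    refine norm_integral_le_of_norm_le_const (Filter.Eventually.of_forall fun y => ?_)
    rw [norm_mul]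
    have h1 := norm_evol_le (R := R) hD y t
    calc _ ≤ D' * 1 := mul_le_mul h1 (he1 y t) (norm_nonneg _) ((norm_nonneg _).trans h1)
      _ = _ := mul_one _
  -- The extremizer of `L^q` duality, `conj F |F|^(q-2)`. Pairing with it gives `∫ |F|^q`, and its
  -- size `a = |F|^(q-1)` satisfies `a^(q/(q-1)) = |F|^q`, so the same quantity occurs on both sides
  -- and can be absorbed.
  set g : Y → ℝ → ℂ := fun y t => e y t * (conj (F t) * ((‖F t‖ ^ (q - 2) : ℝ) : ℂ)) with hg
  have hψ : ∀ t, ‖conj (F t) * ((‖F t‖ ^ (q - 2) : ℝ) : ℂ)‖ = ‖F t‖ ^ (q - 1) := by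
    intro t
    rw [norm_mul, RCLike.norm_conj, Complex.norm_real, Real.norm_of_nonneg (by positivity)]
    nth_rw 1 [← Real.rpow_one ‖F t‖]
    rw [← Real.rpow_add' (norm_nonneg _) (by linarith)]
    congr 1
    ring
  have hψm : Measurable fun t => conj (F t) * ((‖F t‖ ^ (q - 2) : ℝ) : ℂ) := by
    have := Complex.continuous_conj.measurable.comp hFm
    have h2 : Measurable fun t => ((‖F t‖ ^ (q - 2) : ℝ) : ℂ) :=
      Complex.measurable_ofReal.comp (hFm.norm.pow_const _)
    exact this.mul h2
  have hgm : Measurable (Function.uncurry g) := he.mul (hψm.comp measurable_snd)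
  have hgb : ∀ y t, ‖g y t‖ ≤ (D' * ν.real Set.univ) ^ (q - 1) := by
    intro y t
    simp only [hg]
    rw [norm_mul, hψ]
    calc _ ≤ 1 * ‖F t‖ ^ (q - 1) := by gcongr; exact he1 y t
      _ ≤ _ := by
        rw [one_mul]
        exact Real.rpow_le_rpow (norm_nonneg _) (hFb t) hq1.le
  refine lintegral_le_of_forall_Icc fun T => ?_
  have key := enorm_pairing_sq_le (T := T) (R := R) (K := K) (θ := θ) (q := q) (b := b)
    (a := fun t => ‖F t‖ₑ ^ (q - 1)) hφ hgm hgb (by fun_prop) (by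
    intro t s hts
    have : ∫ y, wave ((t - s) * φ y) * (g y t * conj (g y s)) ∂ν =
        (∫ y, wave ((t - s) * φ y) * (e y t * conj (e y s)) ∂ν) *
          ((conj (F t) * ((‖F t‖ ^ (q - 2) : ℝ) : ℂ)) *
            conj (conj (F s) * ((‖F s‖ ^ (q - 2) : ℝ) : ℂ))) := by
      rw [← integral_mul_const]
      refine integral_congr_ae (Filter.Eventually.of_forall fun y => ?_)
      simp only [hg, map_mul]
      ring
    rw [this, enorm_mul, enorm_mul, mul_comm]
    have hψe : ∀ t, ‖conj (F t) * ((‖F t‖ ^ (q - 2) : ℝ) : ℂ)‖ₑ = ‖F t‖ₑ ^ (q - 1) := by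
      intro t
      rw [← ofReal_norm, hψ, ← ENNReal.ofReal_rpow_of_nonneg (norm_nonneg _) hq1.le, ofReal_norm]
    rw [← ofReal_norm (conj _), RCLike.norm_conj, ofReal_norm, hψe, hψe]
    exact mul_le_mul_right (hI t s hts) _) hb hq hh hD
  have e1 : ∫ t in Set.Icc (-T) T, (∫ y, evol R h y t * g y t ∂ν) =
      ((∫ t in Set.Icc (-T) T, ‖F t‖ ^ q : ℝ) : ℂ) := by
    rw [← integral_complex_ofReal]
    refine integral_congr_ae (Filter.Eventually.of_forall fun t => ?_)
    simp only [hg, ← mul_assoc]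
    rw [integral_mul_const, integral_mul_const]
    change F t * conj (F t) * _ = _
    rw [Complex.mul_conj', ← Complex.ofReal_pow, ← Complex.ofReal_mul]
    congr 1
    rw [← Real.rpow_natCast, ← Real.rpow_add' (norm_nonneg _) (by push_cast; linarith)]
    congr 1
    push_cast
    ring
  have hint : IntegrableOn (fun t => ‖F t‖ ^ q) (Set.Icc (-T) T) := by
    refine Integrable.of_bound (hFm.norm.pow_const q).aestronglyMeasurable
      ((D' * ν.real Set.univ) ^ q) (Filter.Eventually.of_forall fun t => ?_)
    rw [Real.norm_of_nonneg (by positivity)]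
    exact Real.rpow_le_rpow (norm_nonneg _) (hFb t) hq0.le
  have e2 : ‖∫ t in Set.Icc (-T) T, (∫ y, evol R h y t * g y t ∂ν)‖ₑ =
      ∫⁻ t in Set.Icc (-T) T, ‖F t‖ₑ ^ q := by
    rw [e1, ← ofReal_norm, Complex.norm_of_nonneg (integral_nonneg fun t => by positivity),
      ofReal_integral_eq_lintegral_ofReal hint (Filter.Eventually.of_forall fun t => by positivity)]
    refine lintegral_congr fun t => ?_
    rw [← ENNReal.ofReal_rpow_of_nonneg (norm_nonneg _) hq0.le, ofReal_norm]
  have e3 : ∀ t, (‖F t‖ₑ ^ (q - 1)) ^ (q / (q - 1)) = ‖F t‖ₑ ^ q := by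
    intro t
    rw [← ENNReal.rpow_mul]
    congr 1
    field_simp
  simp only [e2, e3] at key
  refine le_rpow_of_sq_le_mul_rpow ?_ hq key
  rw [← e2]
  exact enorm_ne_top

/-- The embedding into `L^q` in time with values in `L²`. -/
theorem lintegral_evol_le (hφ : Measurable φ) (hb : 0 < b) (hq : 2 ≤ q)
    (hh : Measurable (Function.uncurry h)) (hD : ∀ y τ, ‖h y τ‖ ≤ D) :
    ∫⁻ t, (∫⁻ y, ‖evol R h y t‖ₑ ^ 2 ∂ν) ^ (q / 2) ≤
      (embConst b 0 q * modNormSq ν φ b R h) ^ (q / 2) := by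
  have hq1 : 0 < q - 1 := by linarith
  have hem := measurable_evol (R := R) hh
  set S : ℝ → ℝ≥0∞ := fun t => ∫⁻ y, ‖evol R h y t‖ₑ ^ 2 ∂ν with hS
  set D' := D * (volume.restrict (Set.Icc (-R) R)).real Set.univ with hD'
  have hev : ∀ y t, ‖evol R h y t‖ ≤ D' := norm_evol_le hD
  have hSr : ∀ t, S t = ENNReal.ofReal (∫ y, ‖evol R h y t‖ ^ 2 ∂ν) := by
    intro t
    rw [ofReal_integral_eq_lintegral_ofReal]
    · refine lintegral_congr fun y => ?_
      rw [ENNReal.ofReal_pow (norm_nonneg _), ofReal_norm]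
    · have : Measurable fun y => ‖evol R h y t‖ ^ 2 := by fun_prop
      refine Integrable.of_bound this.aestronglyMeasurable (D' ^ 2)
        (Filter.Eventually.of_forall fun y => ?_)
      rw [Real.norm_of_nonneg (by positivity)]
      gcongr
      exact hev y t
    · exact Filter.Eventually.of_forall fun y => by positivity
  set σ : ℝ → ℝ := fun t => ∫ y, ‖evol R h y t‖ ^ 2 ∂ν with hσ
  have hσ0 : ∀ t, 0 ≤ σ t := fun t => integral_nonneg fun y => by positivity
  have hσm : Measurable σ := by
    have : σ = fun t => (S t).toReal := by
      funext t
      rw [hSr, ENNReal.toReal_ofReal (hσ0 t)]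
    rw [this]
    fun_prop
  have hσb : ∀ t, σ t ≤ D' ^ 2 * ν.real Set.univ := by
    intro t
    refine (Real.le_norm_self _).trans (norm_integral_le_of_norm_le_const
      (Filter.Eventually.of_forall fun y => ?_))
    rw [Real.norm_of_nonneg (by positivity)]
    gcongr
    exact hev y t
  -- The vector-valued extremizer: `conj u(t)` times `‖u(t)‖^(q-2)`, where `u` is the evolution and
  -- `σ = ‖u‖²` in `L²(ν)`. Its pairing with `u` is `∫ σ^(q/2)`.
  set ψ : ℝ → ℝ := fun t => σ t ^ ((q - 2) / 2) with hψ
  have hψ0 : ∀ t, 0 ≤ ψ t := fun t => Real.rpow_nonneg (hσ0 t) _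
  have hψm : Measurable ψ := hσm.pow_const _
  set g : Y → ℝ → ℂ := fun y t => conj (evol R h y t) * (ψ t : ℂ) with hg
  have hgm : Measurable (Function.uncurry g) :=
    (Complex.continuous_conj.measurable.comp hem).mul
      (Complex.measurable_ofReal.comp (hψm.comp measurable_snd))
  have hgb : ∀ y t, ‖g y t‖ ≤ D' * (D' ^ 2 * ν.real Set.univ) ^ ((q - 2) / 2) := by
    intro y t
    simp only [hg]
    rw [norm_mul, RCLike.norm_conj, Complex.norm_real, Real.norm_of_nonneg (hψ0 t)]
    exact mul_le_mul (hev y t) (Real.rpow_le_rpow (hσ0 t) (hσb t) (by linarith)) (hψ0 t)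
      ((norm_nonneg _).trans (hev y t))
  have hψS : ∀ t, ENNReal.ofReal (ψ t) = S t ^ ((q - 2) / 2) := by
    intro t
    rw [hSr, ENNReal.ofReal_rpow_of_nonneg (hσ0 t) (by linarith)]
  refine lintegral_le_of_forall_Icc fun T => ?_
  -- No decay is used, hence `θ = 0` and `K = 1`: the phase has modulus one and Cauchy-Schwarz in
  -- `y` bounds the correlation by `‖g t‖ ‖g s‖ = a t * a s`.
  have key := enorm_pairing_sq_le (T := T) (R := R) (K := 1) (θ := 0) (q := q) (b := b)
    (a := fun t => S t ^ ((q - 1) / 2)) hφ hgm hgb (by fun_prop) (by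
    intro t s hts
    have hx : ∀ t, S t ^ ((q - 1) / 2) = S t ^ ((q - 2) / 2) * S t ^ (1 / 2 : ℝ) := by
      intro t
      rw [← ENNReal.rpow_add_of_nonneg _ _ (by linarith) (by norm_num)]
      congr 1
      ring
    have hCS : ∫⁻ y, ‖evol R h y t‖ₑ * ‖evol R h y s‖ₑ ∂ν ≤ S t ^ (1 / 2 : ℝ) * S s ^ (1 / 2 : ℝ) := by
      have := ENNReal.lintegral_mul_le_Lp_mul_Lq ν Real.HolderConjugate.two_two
        (f := fun y => ‖evol R h y t‖ₑ) (g := fun y => ‖evol R h y s‖ₑ) (by fun_prop) (by fun_prop)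
      simpa [hS] using this
    calc _ ≤ ∫⁻ y, ‖wave ((t - s) * φ y) * (g y t * conj (g y s))‖ₑ ∂ν :=
          enorm_integral_le_lintegral_enorm _
      _ = ∫⁻ y, (S t ^ ((q - 2) / 2) * S s ^ ((q - 2) / 2)) *
            (‖evol R h y t‖ₑ * ‖evol R h y s‖ₑ) ∂ν := by
          refine lintegral_congr fun y => ?_
          have hgn : ∀ t, ‖g y t‖ₑ = S t ^ ((q - 2) / 2) * ‖evol R h y t‖ₑ := by
            intro t
            simp only [hg]
            rw [enorm_mul, ← ofReal_norm, RCLike.norm_conj, ofReal_norm, ← hψS,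
              ← ofReal_norm (ψ t : ℂ), Complex.norm_of_nonneg (hψ0 t), mul_comm]
          rw [enorm_mul, enorm_mul, enorm_wave, one_mul, ← ofReal_norm (conj _), RCLike.norm_conj,
            ofReal_norm, hgn, hgn]
          ring
      _ ≤ (S t ^ ((q - 2) / 2) * S s ^ ((q - 2) / 2)) * (S t ^ (1 / 2 : ℝ) * S s ^ (1 / 2 : ℝ)) := by
          rw [lintegral_const_mul _ (by fun_prop)]
          gcongr
      _ = _ := by
          rw [hx, hx]
          simp
          ring) hb hq hh hD
  have e1 : ∫ t in Set.Icc (-T) T, (∫ y, evol R h y t * g y t ∂ν) =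
      ((∫ t in Set.Icc (-T) T, σ t ^ (q / 2) : ℝ) : ℂ) := by
    rw [← integral_complex_ofReal]
    refine integral_congr_ae (Filter.Eventually.of_forall fun t => ?_)
    simp only [hg, ← mul_assoc]
    rw [integral_mul_const]
    have : ∫ y, evol R h y t * conj (evol R h y t) ∂ν = (σ t : ℂ) := by
      rw [hσ, ← integral_complex_ofReal]
      refine integral_congr_ae (Filter.Eventually.of_forall fun y => ?_)
      simp only
      rw [Complex.mul_conj', ← Complex.ofReal_pow]
    rw [this, ← Complex.ofReal_mul]
    congr 1
    simp only [hψ]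
    nth_rw 1 [← Real.rpow_one (σ t)]
    rw [← Real.rpow_add' (hσ0 t) (by linarith)]
    congr 1
    ring
  have hint : IntegrableOn (fun t => σ t ^ (q / 2)) (Set.Icc (-T) T) := by
    refine Integrable.of_bound (hσm.pow_const _).aestronglyMeasurable
      ((D' ^ 2 * ν.real Set.univ) ^ (q / 2)) (Filter.Eventually.of_forall fun t => ?_)
    rw [Real.norm_of_nonneg (Real.rpow_nonneg (hσ0 t) _)]
    exact Real.rpow_le_rpow (hσ0 t) (hσb t) (by linarith)
  have e2 : ‖∫ t in Set.Icc (-T) T, (∫ y, evol R h y t * g y t ∂ν)‖ₑ =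
      ∫⁻ t in Set.Icc (-T) T, S t ^ (q / 2) := by
    rw [e1, ← ofReal_norm, Complex.norm_of_nonneg
      (integral_nonneg fun t => Real.rpow_nonneg (hσ0 t) _),
      ofReal_integral_eq_lintegral_ofReal hint
      (Filter.Eventually.of_forall fun t => Real.rpow_nonneg (hσ0 t) _)]
    refine lintegral_congr fun t => ?_
    rw [hSr, ← ENNReal.ofReal_rpow_of_nonneg (hσ0 t) (by linarith)]
  have e3 : ∀ t, (S t ^ ((q - 1) / 2)) ^ (q / (q - 1)) = S t ^ (q / 2) := by
    intro t
    rw [← ENNReal.rpow_mul]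
    congr 1
    field_simp
  simp only [e2, e3] at key
  have := le_rpow_of_sq_le_mul_rpow (by rw [← e2]; exact enorm_ne_top) hq key
  simpa using this

end evol

end KGS

/-! ### Space-time embeddings for band-limited functions: Sobolev and dispersion -/

namespace KGS

open scoped ComplexConjugate

theorem one_le_bracket (y : ℝ) : 1 ≤ bracket y :=
  Real.one_le_rpow (by nlinarith [sq_nonneg y]) (by norm_num)

theorem bracket_le_bracket {x y : ℝ} (h : |x| ≤ |y|) : bracket x ≤ bracket y := by
  unfold bracket
  have := sq_le_sq.2 h
  gcongr

@[fun_prop]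
theorem measurable_bracket : Measurable bracket := by
  unfold bracket
  fun_prop

/-- A Sobolev inequality on the line, for band-limited functions. -/
def SobolevBound (p s : ℝ) (A : ℝ≥0∞) : Prop :=
  ∀ (R D : ℝ) (F : ℝ → ℂ), Measurable F → (∀ ξ, ‖F ξ‖ ≤ D) →
    ∫⁻ x, ‖∫ ξ in Set.Icc (-R) R, wave (x * ξ) * F ξ‖ₑ ^ p ≤
      (A * ∫⁻ ξ in Set.Icc (-R) R,
        ENNReal.ofReal (bracket (2 * Real.pi * ξ) ^ (2 * s)) * ‖F ξ‖ₑ ^ 2) ^ (p / 2)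

/-- The embedding of `H^{1/2}` into `L^p`. -/
theorem sobolevBound_half {p : ℝ} (hp : 2 ≤ p) :
    SobolevBound p (1 / 2) (embConst (1 / 2 - 1 / (2 * p)) 0 p) := by
  intro R D F hF hD
  have hp' : 1 / (2 * p) ≤ 1 / 4 := by
    apply one_div_le_one_div_of_le <;> linarith
  -- The time embedding over a one-point space with zero phase, `x` in the role of time. The
  -- exponent `1/2 - 1/(2p)` is midway between the Sobolev threshold `1/2 - 1/p` and `1/2`; the
  -- weight is then enlarged to `H^{1/2}`.
  have h := lintegral_evol_le (Y := Unit) (ν := Measure.dirac ()) (φ := fun _ => 0)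
    (h := fun _ => F) (D := D) (R := R) (b := 1 / 2 - 1 / (2 * p)) (q := p) measurable_const
    (by linarith) hp (hF.comp measurable_snd) (fun _ => hD)
  simp only [lintegral_dirac, evol, modNormSq, sub_zero] at h
  calc _ = _ := by
        refine lintegral_congr fun x => ?_
        rw [← ENNReal.rpow_natCast, ← ENNReal.rpow_mul]
        congr 1
        push_cast
        ring
    _ ≤ _ := h
    _ ≤ _ := by
        gcongr
        · exact one_le_bracket _
        · have : 0 < 1 / (2 * p) := by positivity
          linarith

theorem embConst_half_lt_top {p : ℝ} (hp : 2 ≤ p) :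
    embConst (1 / 2 - 1 / (2 * p)) 0 p < ∞ := by
  have hp' : 1 / (2 * p) ≤ 1 / 4 := by
    apply one_div_le_one_div_of_le <;> linarith
  have hp0 : 0 < 1 / (2 * p) := by positivity
  refine embConst_lt_top (by linarith) (by linarith) le_rfl hp ?_
  have : (1 - 2 * (1 / 2 - 1 / (2 * p)) + 0) * p = 1 := by
    field_simp
    ring
  linarith

/-- The function on the plane with the compactly supported Fourier transform `H`. -/
noncomputable def synth (R : ℝ) (H : ℝ → ℝ → ℂ) (x t : ℝ) : ℂ :=
  evol R (fun t ξ => evol R H ξ t) t x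

/-- The square of the weighted `L²` norm of `H`. -/
noncomputable def planeNormSq (φ : ℝ → ℝ) (s b R : ℝ) (H : ℝ → ℝ → ℂ) : ℝ≥0∞ :=
  ∫⁻ ξ in Set.Icc (-R) R, ∫⁻ τ in Set.Icc (-R) R,
    ENNReal.ofReal (bracket (2 * Real.pi * ξ) ^ (2 * s)) *
      (ENNReal.ofReal (bracket (2 * Real.pi * (τ - φ ξ)) ^ (2 * b)) * ‖H ξ τ‖ₑ ^ 2)

section plane

variable {φ : ℝ → ℝ} {H : ℝ → ℝ → ℂ} {D R : ℝ} {b s p q : ℝ} {A : ℝ≥0∞}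

theorem measurable_evol_swap (hH : Measurable (Function.uncurry H)) :
    Measurable (Function.uncurry fun t ξ => evol R H ξ t) := by
  have h : Measurable (Function.uncurry (evol R H)) := measurable_evol hH
  have e : (Function.uncurry fun t ξ => evol R H ξ t) =
      fun w => Function.uncurry (evol R H) (w.2, w.1) := rfl
  rw [e]
  exact h.comp (measurable_snd.prodMk measurable_fst)

theorem measurable_synth (hH : Measurable (Function.uncurry H)) :
    Measurable (Function.uncurry (synth R H)) := by
  have h : Measurable (Function.uncurry (evol R fun t ξ => evol R H ξ t)) :=
    measurable_evol (measurable_evol_swap hH)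
  have e : Function.uncurry (synth R H) =
      fun w => Function.uncurry (evol R fun t ξ => evol R H ξ t) (w.2, w.1) := rfl
  rw [e]
  exact h.comp (measurable_snd.prodMk measurable_fst)

theorem continuous_synth_left (hH : Measurable (Function.uncurry H)) (hD : ∀ ξ τ, ‖H ξ τ‖ ≤ D)
    (t : ℝ) : Continuous fun x => synth R H x t := by
  unfold synth
  set G : ℝ → ℂ := fun ξ => evol R H ξ t with hG
  have hGm : Measurable G := (measurable_evol (R := R) hH).comp (measurable_id.prodMk measurable_const)
  unfold evol
  refine continuous_of_dominated (bound := fun _ => D * (volume.restrict (Set.Icc (-R) R)).real Set.univ)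
    (fun x => ?_) (fun x => Filter.Eventually.of_forall fun ξ => ?_) (integrable_const _)
    (Filter.Eventually.of_forall fun ξ => ?_)
  · exact Measurable.aestronglyMeasurable (by
      change Measurable fun ξ => wave (x * ξ) * G ξ
      fun_prop)
  · rw [norm_mul, norm_wave, one_mul]
    exact norm_evol_le hD ξ t
  · have := continuous_wave
    fun_prop

theorem evol_eq_zero (hR : ∀ ξ τ, R < |ξ| → H ξ τ = 0) {ξ : ℝ} (hξ : R < |ξ|) (t : ℝ) :
    evol R H ξ t = 0 := by
  simp [evol, hR ξ _ hξ]

/-- The embedding into `L^q` in time with values in `L^p`. -/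
theorem lintegral_synth_le (hφ : Measurable φ) (hb : 0 < b) (hq : 2 ≤ q) (hp : 2 ≤ p) (hs : 0 ≤ s)
    (hA : SobolevBound p s A)
    (hH : Measurable (Function.uncurry H)) (hD : ∀ ξ τ, ‖H ξ τ‖ ≤ D)
    (hR : ∀ ξ τ, R < |ξ| → H ξ τ = 0) :
    ∫⁻ t, (∫⁻ x, ‖synth R H x t‖ₑ ^ p) ^ (q / p) ≤
      (A * embConst b 0 q * planeNormSq φ s b R H) ^ (q / 2) := by
  -- The spatial weight is absorbed into the data, which stay bounded because the support in `ξ` is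
  -- compact. Sobolev at fixed `t` thus reduces matters to the `L²`-valued embedding.
  set h : ℝ → ℝ → ℂ := fun ξ τ => ((bracket (2 * Real.pi * ξ) ^ s : ℝ) : ℂ) * H ξ τ with hh
  have hc : Measurable fun ξ : ℝ => ((bracket (2 * Real.pi * ξ) ^ s : ℝ) : ℂ) := by fun_prop
  have hhm : Measurable (Function.uncurry h) := (hc.comp measurable_fst).mul hH
  have hhD : ∀ ξ τ, ‖h ξ τ‖ ≤ bracket (2 * Real.pi * R) ^ s * D := by
    intro ξ τ
    have hD0 : 0 ≤ D := (norm_nonneg _).trans (hD ξ τ)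
    have hb1 := bracket_pos (2 * Real.pi * R)
    have hb2 := bracket_pos (2 * Real.pi * ξ)
    rcases lt_or_ge R |ξ| with h1 | h1
    · simp only [hh, hR ξ τ h1, mul_zero, norm_zero]
      positivity
    · simp only [hh]
      rw [norm_mul, Complex.norm_of_nonneg (by positivity)]
      have : bracket (2 * Real.pi * ξ) ≤ bracket (2 * Real.pi * R) := by
        refine bracket_le_bracket ?_
        rw [abs_mul, abs_mul _ R]
        exact mul_le_mul_of_nonneg_left (h1.trans (le_abs_self R)) (abs_nonneg _)
      gcongr
      exact hD ξ τ
  have hev : ∀ ξ t, evol R h ξ t = ((bracket (2 * Real.pi * ξ) ^ s : ℝ) : ℂ) * evol R H ξ t := by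
    intro ξ t
    unfold evol
    rw [← integral_const_mul]
    refine integral_congr_ae (Filter.Eventually.of_forall fun τ => ?_)
    simp only [hh]
    ring
  have hsq : ∀ (ξ : ℝ) (z : ℂ), ‖((bracket (2 * Real.pi * ξ) ^ s : ℝ) : ℂ) * z‖ₑ ^ 2 =
      ENNReal.ofReal (bracket (2 * Real.pi * ξ) ^ (2 * s)) * ‖z‖ₑ ^ 2 := by
    intro ξ z
    have hb2 := bracket_pos (2 * Real.pi * ξ)
    rw [enorm_mul, mul_pow, ← ofReal_norm (Complex.ofReal _), Complex.norm_of_nonneg (by positivity),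
      ← ENNReal.ofReal_pow (by positivity), ← Real.rpow_natCast (_ ^ s), ← Real.rpow_mul hb2.le,
      show s * ((2 : ℕ) : ℝ) = 2 * s by push_cast; ring]
  have key := lintegral_evol_le (ν := (volume : Measure ℝ).restrict (Set.Icc (-R) R)) (R := R)
    hφ hb hq hhm hhD
  have e : modNormSq ((volume : Measure ℝ).restrict (Set.Icc (-R) R)) φ b R h =
      planeNormSq φ s b R H := by
    unfold modNormSq planeNormSq
    refine lintegral_congr fun ξ => lintegral_congr fun τ => ?_
    rw [hsq]
    ring
  rw [e] at key
  calc _ ≤ ∫⁻ t, A ^ (q / 2) *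
        (∫⁻ ξ in Set.Icc (-R) R, ‖evol R h ξ t‖ₑ ^ 2) ^ (q / 2) := by
        refine lintegral_mono fun t => ?_
        have h1 := hA R _ (fun ξ => evol R H ξ t)
          ((measurable_evol (R := R) hH).comp (measurable_id.prodMk measurable_const))
          (fun ξ => norm_evol_le hD ξ t)
        simp_rw [hev, hsq]
        calc _ ≤ _ := ENNReal.rpow_le_rpow h1 (by positivity)
          _ = _ := by
            rw [← ENNReal.rpow_mul, ← ENNReal.mul_rpow_of_nonneg _ _ (by positivity)]
            congr 1
            field_simp
    _ ≤ A ^ (q / 2) * (embConst b 0 q * planeNormSq φ s b R H) ^ (q / 2) := by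
        have hm : Measurable fun w : ℝ × ℝ => evol R h w.1 w.2 := measurable_evol hhm
        rw [lintegral_const_mul _ (by fun_prop)]
        gcongr
    _ = _ := by
        rw [← ENNReal.mul_rpow_of_nonneg _ _ (by positivity), mul_assoc]

/-- An explicit Gaussian integral with complex parameter `β = η + 4π² i r`. Its modulus is
`|π/β|^(1/2)` times an exponential with nonpositive real exponent, and `|β| ≥ 4π²|r|`. The bound is
uniform in the regularization `η` and in `X`, as needed along arbitrary paths. -/
theorem enorm_oscillatory_integral_le {η : ℝ} (hη : 0 < η) {r : ℝ} (hr : r ≠ 0) (X : ℝ) :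
    ‖∫ ξ, wave (r * (-(2 * Real.pi * ξ ^ 2))) * wave (X * ξ) ∂(gaussMeasure η)‖ₑ ≤
      ENNReal.ofReal (|r| ^ (-(1 / 2) : ℝ)) := by
  set β : ℂ := ⟨η, 4 * Real.pi ^ 2 * r⟩ with hβ
  have hβre : β.re = η := rfl
  have hβim : β.im = 4 * Real.pi ^ 2 * r := rfl
  have hr' : 0 < |r| := abs_pos.2 hr
  rw [integral_gaussMeasure]
  have e : ∀ ξ : ℝ, wave (r * (-(2 * Real.pi * ξ ^ 2))) * wave (X * ξ) *
      Complex.exp (-η * ξ ^ 2) = wave (X * ξ) * Complex.exp (-β * ξ ^ 2) := by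
    intro ξ
    rw [mul_comm (wave (r * _)), mul_assoc]
    congr 1
    unfold wave
    rw [← Complex.exp_add]
    congr 1
    rw [hβ, Complex.mk_eq_add_mul_I]
    push_cast
    ring
  simp_rw [e]
  rw [integral_wave_mul_cexp (by rw [hβre]; exact hη), ← ofReal_norm]
  refine ENNReal.ofReal_le_ofReal ?_
  have hβn : 4 * Real.pi ^ 2 * |r| ≤ ‖β‖ := by
    have := Complex.abs_im_le_norm β
    rwa [hβim, abs_mul, abs_of_pos (by positivity)] at this
  have h1 : ‖(Real.pi / β : ℂ) ^ (1 / 2 : ℂ)‖ ≤ |r| ^ (-(1 / 2) : ℝ) := by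
    rw [show (1 / 2 : ℂ) = ((1 / 2 : ℝ) : ℂ) by push_cast; ring, Complex.norm_cpow_real, norm_div,
      Complex.norm_of_nonneg Real.pi_pos.le, Real.rpow_neg hr'.le, ← Real.inv_rpow hr'.le]
    refine Real.rpow_le_rpow (by positivity) ?_ (by norm_num)
    calc Real.pi / ‖β‖ ≤ Real.pi / (4 * Real.pi ^ 2 * |r|) := by gcongr
      _ = (4 * Real.pi)⁻¹ * |r|⁻¹ := by field_simp
      _ ≤ 1 * |r|⁻¹ := by
        gcongr
        apply inv_le_one_of_one_le₀
        nlinarith [Real.pi_gt_three]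
      _ = _ := one_mul _
  have h2 : ‖Complex.exp (-(2 * Real.pi * X) ^ 2 / (4 * β))‖ ≤ 1 := by
    rw [Complex.norm_exp]
    refine Real.exp_le_one_iff.2 ?_
    have : (-(2 * (Real.pi : ℂ) * X) ^ 2 / (4 * β)) =
        ((-((2 * Real.pi * X) ^ 2 / 4) : ℝ) : ℂ) * β⁻¹ := by
      push_cast
      rw [div_eq_mul_inv, mul_inv]
      ring
    rw [this, Complex.re_ofReal_mul, Complex.inv_re, hβre]
    refine mul_nonpos_of_nonpos_of_nonneg ?_ ?_
    · have : 0 ≤ (2 * Real.pi * X) ^ 2 / 4 := by positivity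
      linarith
    · exact div_nonneg hη.le (Complex.normSq_nonneg _)
  calc _ ≤ |r| ^ (-(1 / 2) : ℝ) * 1 := by
        rw [norm_mul]
        gcongr
    _ = _ := mul_one _

/-- The dispersive estimate along a measurable path. -/
theorem lintegral_synth_path_le (hb : 0 < b) (hq : 2 ≤ q)
    (hH : Measurable (Function.uncurry H)) (hD : ∀ ξ τ, ‖H ξ τ‖ ≤ D) (hR0 : 0 < R)
    (hR : ∀ ξ τ, R < |ξ| → H ξ τ = 0) {X : ℝ → ℝ} (hX : Measurable X) :
    ∫⁻ t, ‖synth R H (X t) t‖ₑ ^ q ≤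
      (embConst b (1 / 2) q * ENNReal.ofReal (Real.exp 1) *
        planeNormSq (fun ξ => -(2 * Real.pi * ξ ^ 2)) 0 b R H) ^ (q / 2) := by
  -- The Gaussian serves as the finite measure in frequency, and the data are multiplied by its
  -- inverse. With this width `ηξ² ≤ 1` on the support `|ξ| ≤ R`, so the change costs only a factor
  -- `e` in the squared norm, whatever `R` is.
  set η : ℝ := (R ^ 2)⁻¹ with hη
  have hη0 : 0 < η := by positivity
  have : IsFiniteMeasure (gaussMeasure η) := isFiniteMeasure_gaussMeasure hη0
  set h : ℝ → ℝ → ℂ := fun ξ τ => (Real.exp (η * ξ ^ 2) : ℂ) * H ξ τ with hh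
  have hηξ : ∀ ξ, |ξ| ≤ R → η * ξ ^ 2 ≤ 1 := by
    intro ξ hξ
    rw [hη, inv_mul_le_iff₀ (by positivity), mul_one, ← sq_abs]
    gcongr
  have hhm : Measurable (Function.uncurry h) := by
    have hc : Measurable fun ξ : ℝ => (Real.exp (η * ξ ^ 2) : ℂ) := by fun_prop
    exact (hc.comp measurable_fst).mul hH
  have hhD : ∀ ξ τ, ‖h ξ τ‖ ≤ Real.exp 1 * D := by
    intro ξ τ
    have hD0 : 0 ≤ D := (norm_nonneg _).trans (hD ξ τ)
    simp only [hh]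
    rcases lt_or_ge R |ξ| with h1 | h1
    · simp only [hR ξ τ h1, mul_zero, norm_zero]
      positivity
    · rw [norm_mul, Complex.norm_of_nonneg (by positivity)]
      have := hηξ ξ h1
      gcongr
      exact hD ξ τ
  have hev : ∀ ξ t, evol R h ξ t = (Real.exp (η * ξ ^ 2) : ℂ) * evol R H ξ t := by
    intro ξ t
    unfold evol
    rw [← integral_const_mul]
    refine integral_congr_ae (Filter.Eventually.of_forall fun τ => ?_)
    simp only [hh]
    ring
  -- Evaluation at `X t` is a scalar observable. The correlation of times `t` and `s` is the
  -- oscillatory integral at the point `X t - X s`, so the path does not affect the decay.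
  have key := lintegral_evol_observable_le (ν := gaussMeasure η) (R := R)
    (φ := fun ξ => -(2 * Real.pi * ξ ^ 2)) (θ := 1 / 2) (K := 1) (b := b) (q := q)
    (e := fun ξ t => wave (X t * ξ)) (h := h) (by fun_prop) (by
      have : Measurable fun w : ℝ × ℝ => wave (X w.2 * w.1) := by fun_prop
      exact this) (fun ξ t => (norm_wave _).le) (by
      intro t s hts
      simp_rw [wave_mul_conj_wave, ← sub_mul, ENNReal.coe_one, one_mul]
      exact enorm_oscillatory_integral_le hη0 (sub_ne_zero.2 hts) _) hb hq hhm hhD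
  have e1 : ∀ t, ∫ ξ, evol R h ξ t * wave (X t * ξ) ∂(gaussMeasure η) = synth R H (X t) t := by
    intro t
    rw [integral_gaussMeasure]
    unfold synth
    rw [evol, ← integral_indicator measurableSet_Icc]
    refine integral_congr_ae (Filter.Eventually.of_forall fun ξ => ?_)
    simp only
    rw [hev]
    by_cases hξ : ξ ∈ Set.Icc (-R) R
    · rw [Set.indicator_of_mem hξ]
      have : (Real.exp (η * ξ ^ 2) : ℂ) * Complex.exp (-η * ξ ^ 2) = 1 := by
        push_cast
        rw [← Complex.exp_add]
        simp
      linear_combination (evol R H ξ t * wave (X t * ξ)) * this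
    · rw [Set.indicator_of_notMem hξ]
      have : R < |ξ| := by
        by_contra hcon
        exact hξ (abs_le.1 (not_lt.1 hcon))
      rw [evol_eq_zero hR this]
      simp
  simp_rw [e1] at key
  refine key.trans ?_
  have e2 : modNormSq (gaussMeasure η) (fun ξ => -(2 * Real.pi * ξ ^ 2)) b R h ≤
      ENNReal.ofReal (Real.exp 1) * planeNormSq (fun ξ => -(2 * Real.pi * ξ ^ 2)) 0 b R H := by
    have hHm : Measurable fun w : ℝ × ℝ => H w.1 w.2 := hH
    have hhm' : Measurable fun w : ℝ × ℝ => h w.1 w.2 := hhm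
    unfold modNormSq planeNormSq
    rw [lintegral_gaussMeasure _ (Measurable.lintegral_prod_right' (f := fun w : ℝ × ℝ =>
      ENNReal.ofReal (bracket (2 * Real.pi * (w.2 - -(2 * Real.pi * w.1 ^ 2))) ^ (2 * b)) *
        ‖h w.1 w.2‖ₑ ^ 2) (by fun_prop)),
      ← lintegral_const_mul _ (Measurable.lintegral_prod_right' (f := fun w : ℝ × ℝ =>
      ENNReal.ofReal (bracket (2 * Real.pi * w.1) ^ (2 * (0 : ℝ))) *
      (ENNReal.ofReal (bracket (2 * Real.pi * (w.2 - -(2 * Real.pi * w.1 ^ 2))) ^ (2 * b)) *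
        ‖H w.1 w.2‖ₑ ^ 2)) (by fun_prop)), ← lintegral_indicator measurableSet_Icc]
    refine lintegral_mono fun ξ => ?_
    simp only
    by_cases hξ : ξ ∈ Set.Icc (-R) R
    · rw [Set.indicator_of_mem hξ, ← lintegral_const_mul _ (by
        have := hhm'.comp (measurable_prodMk_left (x := ξ))
        simp only [Function.comp_def] at this
        fun_prop), ← lintegral_const_mul _ (by
        have := hHm.comp (measurable_prodMk_left (x := ξ))
        simp only [Function.comp_def] at this
        fun_prop)]
      refine lintegral_mono fun τ => ?_
      have hen : ‖h ξ τ‖ₑ = ENNReal.ofReal (Real.exp (η * ξ ^ 2)) * ‖H ξ τ‖ₑ := by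
        simp only [hh]
        rw [enorm_mul, ← ofReal_norm (Complex.ofReal _), Complex.norm_of_nonneg (by positivity)]
      have hexp : ENNReal.ofReal (Real.exp (-η * ξ ^ 2)) *
          ENNReal.ofReal (Real.exp (η * ξ ^ 2)) ^ 2 ≤ ENNReal.ofReal (Real.exp 1) := by
        rw [← ENNReal.ofReal_pow (by positivity), ← ENNReal.ofReal_mul (by positivity),
          ← Real.exp_nat_mul, ← Real.exp_add]
        refine ENNReal.ofReal_le_ofReal (Real.exp_le_exp.2 ?_)
        have := hηξ ξ (abs_le.2 hξ)
        push_cast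
        linarith
      rw [hen, mul_pow]
      simp only [mul_zero, Real.rpow_zero, ENNReal.ofReal_one, one_mul]
      calc _ = ENNReal.ofReal (Real.exp (-η * ξ ^ 2)) * ENNReal.ofReal (Real.exp (η * ξ ^ 2)) ^ 2 *
            (ENNReal.ofReal (bracket (2 * Real.pi * (τ - -(2 * Real.pi * ξ ^ 2))) ^ (2 * b)) *
              ‖H ξ τ‖ₑ ^ 2) := by ring
        _ ≤ _ := by gcongr
    · have : R < |ξ| := by
        by_contra hcon
        exact hξ (abs_le.1 (not_lt.1 hcon))
      simp [hh, hR ξ _ this]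
  rw [ENNReal.coe_one, mul_one, mul_assoc]
  gcongr

/-- The running maximum of `synth` over finitely many points, attained along a measurable path. -/
noncomputable def maxPath (R : ℝ) (H : ℝ → ℝ → ℂ) (y : ℕ → ℝ) : ℕ → ℝ → ℝ
  | 0, _ => y 0
  | n + 1, t =>
    if ‖synth R H (maxPath R H y n t) t‖ < ‖synth R H (y (n + 1)) t‖ then y (n + 1)
    else maxPath R H y n t

theorem measurable_maxPath (hH : Measurable (Function.uncurry H)) (y : ℕ → ℝ) (n : ℕ) :
    Measurable (maxPath R H y n) := by
  have hs : Measurable fun w : ℝ × ℝ => synth R H w.1 w.2 := measurable_synth hH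
  induction n with
  | zero => exact measurable_const
  | succ n ih =>
    refine Measurable.ite (measurableSet_lt ?_ ?_) measurable_const ih
    · exact (hs.comp (ih.prodMk measurable_id)).norm
    · exact (hs.comp (measurable_const.prodMk measurable_id)).norm

theorem norm_synth_maxPath_mono (y : ℕ → ℝ) (t : ℝ) :
    Monotone fun n => ‖synth R H (maxPath R H y n t) t‖ := by
  refine monotone_nat_of_le_succ fun n => ?_
  simp only [maxPath]
  split_ifs with h
  · exact h.le
  · exact le_rfl

theorem norm_synth_le_maxPath (y : ℕ → ℝ) (t : ℝ) (n : ℕ) :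
    ‖synth R H (y n) t‖ ≤ ‖synth R H (maxPath R H y n t) t‖ := by
  cases n with
  | zero => exact le_rfl
  | succ n =>
    simp only [maxPath]
    split_ifs with h
    · exact le_rfl
    · exact not_lt.1 h

/-- The dispersive estimate: the embedding into `L^q` in time with values in `L^∞`. -/
theorem exists_lintegral_sup_synth_le (hb : 0 < b) (hq : 2 ≤ q)
    (hH : Measurable (Function.uncurry H)) (hD : ∀ ξ τ, ‖H ξ τ‖ ≤ D) (hR0 : 0 < R)
    (hR : ∀ ξ τ, R < |ξ| → H ξ τ = 0) :
    ∃ M : ℝ → ℝ≥0∞, Measurable M ∧ (∀ x t, ‖synth R H x t‖ₑ ≤ M t) ∧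
      ∫⁻ t, M t ^ q ≤ (embConst b (1 / 2) q * ENNReal.ofReal (Real.exp 1) *
        planeNormSq (fun ξ => -(2 * Real.pi * ξ ^ 2)) 0 b R H) ^ (q / 2) := by
  have hq0 : 0 < q := by linarith
  obtain ⟨y, hy⟩ := TopologicalSpace.exists_dense_seq ℝ
  have hs : Measurable fun w : ℝ × ℝ => synth R H w.1 w.2 := measurable_synth hH
  have hPm : ∀ n, Measurable fun t => ‖synth R H (maxPath R H y n t) t‖ₑ := fun n =>
    (hs.comp ((measurable_maxPath hH y n).prodMk measurable_id)).enorm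
  have hmono : ∀ t, Monotone fun n => ‖synth R H (maxPath R H y n t) t‖ₑ := by
    intro t m n hmn
    exact enorm_le_iff_norm_le.2 (norm_synth_maxPath_mono y t hmn)
  -- The path bound passes to the supremum over a dense sequence by monotone convergence, and to all
  -- `x` by continuity in `x`.
  refine ⟨fun t => ⨆ n, ‖synth R H (maxPath R H y n t) t‖ₑ, .iSup hPm, ?_, ?_⟩
  · intro x t
    have hcl : IsClosed {x | ‖synth R H x t‖ₑ ≤ ⨆ n, ‖synth R H (maxPath R H y n t) t‖ₑ} :=
      isClosed_le (continuous_synth_left hH hD t).enorm continuous_const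
    have hsub : Set.range y ⊆ {x | ‖synth R H x t‖ₑ ≤ ⨆ n, ‖synth R H (maxPath R H y n t) t‖ₑ} := by
      rintro _ ⟨n, rfl⟩
      exact (enorm_le_iff_norm_le.2 (norm_synth_le_maxPath y t n)).trans
        (le_iSup (fun n => ‖synth R H (maxPath R H y n t) t‖ₑ) n)
    exact (hcl.closure_subset_iff.2 hsub) (hy x)
  · have e : ∀ t, (⨆ n, ‖synth R H (maxPath R H y n t) t‖ₑ) ^ q =
        ⨆ n, ‖synth R H (maxPath R H y n t) t‖ₑ ^ q := fun t =>
      (ENNReal.orderIsoRpow q hq0).map_iSup _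
    simp_rw [e]
    rw [lintegral_iSup (fun n => (hPm n).pow_const q)]
    · exact iSup_le fun n => lintegral_synth_path_le hb hq hH hD hR0 hR (measurable_maxPath hH y n)
    · intro m n hmn t
      exact ENNReal.rpow_le_rpow (hmono t hmn) hq0.le

end plane

end KGS

/-! ### Plancherel's theorem and coordinates on the plane -/

namespace KGS

open scoped ComplexConjugate

theorem eLpNorm_two_sq {α E : Type*} [MeasurableSpace α] [NormedAddCommGroup E] (f : α → E)
    (μ : Measure α) : eLpNorm f 2 μ ^ 2 = ∫⁻ z, ‖f z‖ₑ ^ 2 ∂μ := by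
  rw [eLpNorm_eq_lintegral_rpow_enorm_toReal (by norm_num) (by norm_num), ← ENNReal.rpow_natCast,
    ← ENNReal.rpow_mul]
  simp

section plancherel

variable {E : Type*} [NormedAddCommGroup E] [InnerProductSpace ℝ E] [FiniteDimensional ℝ E]
  [MeasurableSpace E] [BorelSpace E]

/-- On `L¹ ∩ L²` the inverse Fourier transform of `L²` is given by the integral. -/
theorem fourierInv_toLp_ae_eq {F : E → ℂ} (h1 : Integrable F) (h2 : MemLp F 2 volume) :
    ((𝓕⁻ (h2.toLp F) : Lp ℂ 2 (volume : Measure E)) : E → ℂ) =ᵐ[volume] 𝓕⁻ F := by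
  have hcont : Continuous (𝓕⁻ F) :=
    VectorFourier.fourierIntegral_continuous Real.continuous_fourierChar
      (by
        simp only [LinearMap.neg_apply, innerₗ_apply_apply]
        fun_prop) h1
  refine ae_eq_of_integral_contDiff_smul_eq ?_ hcont.locallyIntegrable ?_
  · exact (Lp.memLp _).locallyIntegrable (by norm_num)
  intro g hg1 hg2
  have hc : HasCompactSupport (Complex.ofRealCLM ∘ g) := hg2.comp_left rfl
  have hs : ContDiff ℝ ((⊤ : ℕ∞) : WithTop ℕ∞) (Complex.ofRealCLM ∘ g) :=
    Complex.ofRealCLM.contDiff.comp hg1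
  set G : SchwartzMap E ℂ := hc.toSchwartzMap hs with hG
  -- Testing against `G`: on one side `𝓕⁻` moves to `G` in the sense of distributions, on the other
  -- by Fubini for the integral formula.
  have e1 := congrArg (fun T : TemperedDistribution E ℂ => T G)
    (Lp.fourierInv_toTemperedDistribution_eq (h2.toLp F))
  simp only [TemperedDistribution.fourierInv_apply, Lp.toTemperedDistribution_apply] at e1
  have e2 : ∫ x, (𝓕⁻ G : SchwartzMap E ℂ) x • (h2.toLp F) x = ∫ x, (𝓕⁻ G : SchwartzMap E ℂ) x • F x := by
    refine integral_congr_ae ?_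
    filter_upwards [h2.coeFn_toLp] with x hx
    rw [hx]
  have e3 : ∫ x, (𝓕⁻ G : SchwartzMap E ℂ) x • F x = ∫ x, G x • 𝓕⁻ F x := by
    rw [SchwartzMap.fourierInv_coe]
    have := VectorFourier.integral_fourierIntegral_smul_eq_flip (μ := (volume : Measure E))
      (ν := (volume : Measure E)) (L := -innerₗ E) (f := G) (g := F)
      Real.continuous_fourierChar (by
        simp only [LinearMap.neg_apply, innerₗ_apply_apply]
        fun_prop) G.integrable h1
    rw [show (-innerₗ E).flip = -innerₗ E by
      ext x y
      simp [real_inner_comm]] at this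
    exact this
  have e4 : ∀ x, g x • (𝓕⁻ (h2.toLp F) : Lp ℂ 2 (volume : Measure E)) x =
      G x • (𝓕⁻ (h2.toLp F) : Lp ℂ 2 (volume : Measure E)) x := fun x => by
    simp [hG]
  have e5 : ∀ x, g x • 𝓕⁻ F x = G x • 𝓕⁻ F x := fun x => by
    simp [hG]
  simp_rw [e4, e5]
  rw [← e1, e2, e3]

/-- Plancherel's theorem for functions in `L¹ ∩ L²`. -/
theorem lintegral_enorm_sq_fourierInv {F : E → ℂ} (h1 : Integrable F) (h2 : MemLp F 2 volume) :
    ∫⁻ x, ‖𝓕⁻ F x‖ₑ ^ 2 = ∫⁻ x, ‖F x‖ₑ ^ 2 := by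
  rw [← eLpNorm_two_sq, ← eLpNorm_two_sq, ← eLpNorm_congr_ae (fourierInv_toLp_ae_eq h1 h2),
    ← eLpNorm_congr_ae h2.coeFn_toLp, ← Lp.enorm_def, ← Lp.enorm_def]
  congr 1
  rw [← ofReal_norm, ← ofReal_norm]
  congr 1
  exact (Lp.fourierTransformₗᵢ E ℂ).symm.norm_map _

end plancherel

theorem fourierInv_indicator_Icc (R : ℝ) (F : ℝ → ℂ) (x : ℝ) :
    𝓕⁻ ((Set.Icc (-R) R).indicator F) x = ∫ ξ in Set.Icc (-R) R, wave (x * ξ) * F ξ := by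
  rw [Real.fourierInv_eq', ← integral_indicator measurableSet_Icc]
  refine integral_congr_ae (Filter.Eventually.of_forall fun ξ => ?_)
  by_cases h : ξ ∈ Set.Icc (-R) R
  · simp only [Set.indicator_of_mem h, wave, smul_eq_mul]
    simp
  · simp [Set.indicator_of_notMem h]

/-- Plancherel, phrased as the trivial Sobolev embedding so that values in `L²_x` and in `L^p_x` are
treated by the same theorem. -/
theorem sobolevBound_two : SobolevBound 2 0 1 := by
  intro R D F hF hD
  have hi : IntegrableOn F (Set.Icc (-R) R) :=
    Integrable.of_bound hF.aestronglyMeasurable D (Filter.Eventually.of_forall hD)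
  have h2 : MemLp F 2 (volume.restrict (Set.Icc (-R) R)) :=
    MemLp.of_bound hF.aestronglyMeasurable D (Filter.Eventually.of_forall hD)
  have h := lintegral_enorm_sq_fourierInv ((integrable_indicator_iff measurableSet_Icc).2 hi)
    ((memLp_indicator_iff_restrict measurableSet_Icc).2 h2)
  simp_rw [fourierInv_indicator_Icc] at h
  simp only [mul_zero, Real.rpow_zero, ENNReal.ofReal_one, one_mul, ENNReal.rpow_two, div_self
    (two_ne_zero' ℝ), ENNReal.rpow_one]
  rw [h, ← lintegral_indicator measurableSet_Icc]
  refine lintegral_mono fun ξ => ?_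
  by_cases hξ : ξ ∈ Set.Icc (-R) R <;> simp [hξ]

/-- The coordinates on the plane. -/
def planeEquiv : ℝ × ℝ ≃ᵐ Spacetime :=
  MeasurableEquiv.finTwoArrow.symm.trans (MeasurableEquiv.toLp 2 (Fin 2 → ℝ))

theorem planeEquiv_zero (w : ℝ × ℝ) : planeEquiv w 0 = w.1 := rfl

theorem planeEquiv_one (w : ℝ × ℝ) : planeEquiv w 1 = w.2 := rfl

theorem measurePreserving_planeEquiv : MeasurePreserving planeEquiv volume volume :=
  (PiLp.volume_preserving_toLp (Fin 2)).comp (volume_preserving_finTwoArrow ℝ).symm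

theorem ae_ae_planeEquiv {P : Spacetime → Prop} (h : ∀ᵐ z, P z) :
    ∀ᵐ t : ℝ, ∀ᵐ x : ℝ, P (planeEquiv (x, t)) := by
  have h1 : ∀ᵐ w : ℝ × ℝ, P (planeEquiv w) := measurePreserving_planeEquiv.quasiMeasurePreserving.ae h
  have h2 : ∀ᵐ w : ℝ × ℝ, P (planeEquiv w.swap) :=
    (Measure.measurePreserving_swap (μ := (volume : Measure ℝ))
      (ν := (volume : Measure ℝ))).quasiMeasurePreserving.ae h1
  exact Measure.ae_ae_of_ae_prod h2

theorem lintegral_planeEquiv {f : Spacetime → ℝ≥0∞} (hf : AEMeasurable f) :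
    ∫⁻ z, f z = ∫⁻ t : ℝ, ∫⁻ x : ℝ, f (planeEquiv (x, t)) := by
  rw [← measurePreserving_planeEquiv.lintegral_comp_emb planeEquiv.measurableEmbedding]
  exact lintegral_prod_symm _ (hf.comp_quasiMeasurePreserving
    measurePreserving_planeEquiv.quasiMeasurePreserving)

theorem fourierInv_planeEquiv {R D : ℝ} {F : Spacetime → ℂ} (hF : Measurable F)
    (hD : ∀ ζ, ‖F ζ‖ ≤ D) (hR0 : ∀ ζ, R < |ζ 0| → F ζ = 0) (hR1 : ∀ ζ, R < |ζ 1| → F ζ = 0)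
    (x t : ℝ) :
    𝓕⁻ F (planeEquiv (x, t)) = synth R (fun ξ τ => F (planeEquiv (ξ, τ))) x t := by
  have hin : ∀ w : ℝ × ℝ, inner ℝ (planeEquiv w) (planeEquiv (x, t)) = x * w.1 + t * w.2 := by
    intro w
    simp [PiLp.inner_apply, Fin.sum_univ_two, planeEquiv_zero, planeEquiv_one]
  rw [Real.fourierInv_eq', ← measurePreserving_planeEquiv.integral_comp
    planeEquiv.measurableEmbedding]
  have e : ∀ w : ℝ × ℝ, Complex.exp (((2 * Real.pi * inner ℝ (planeEquiv w) (planeEquiv (x, t)) : ℝ)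
      : ℂ) * Complex.I) • F (planeEquiv w) =
      (Set.Icc (-R) R ×ˢ Set.Icc (-R) R).indicator
        (fun w => wave (x * w.1 + t * w.2) * F (planeEquiv w)) w := by
    intro w
    by_cases hw : w ∈ Set.Icc (-R) R ×ˢ Set.Icc (-R) R
    · rw [Set.indicator_of_mem hw, hin, smul_eq_mul]
      rfl
    · rw [Set.indicator_of_notMem hw]
      have : F (planeEquiv w) = 0 := by
        by_contra hne
        refine hw ⟨abs_le.1 (not_lt.1 fun h => hne (hR0 _ h)), abs_le.1 (not_lt.1 fun h => hne (hR1 _ h))⟩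
      simp [this]
  simp_rw [e]
  rw [integral_indicator (measurableSet_Icc.prod measurableSet_Icc), Measure.volume_eq_prod,
    setIntegral_prod]
  · unfold synth
    rw [evol]
    refine integral_congr_ae (Filter.Eventually.of_forall fun ξ => ?_)
    simp only
    unfold evol
    rw [← integral_const_mul]
    refine integral_congr_ae (Filter.Eventually.of_forall fun τ => ?_)
    simp only
    rw [wave_add]
    ring
  · rw [IntegrableOn, ← Measure.prod_restrict]
    have : Measurable fun w : ℝ × ℝ => wave (x * w.1 + t * w.2) * F (planeEquiv w) := by fun_prop
    refine Integrable.of_bound this.aestronglyMeasurable D (Filter.Eventually.of_forall fun w => ?_)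
    rw [norm_mul, norm_wave, one_mul]
    exact hD _

end KGS

/-! ### Passage from band-limited functions to the whole space -/

namespace KGS

open Filter

/-- The dispersion relation in the frequency variables of the Fourier transform of Mathlib. -/
noncomputable def rescale (φ : ℝ → ℝ) (ξ : ℝ) : ℝ := φ (2 * Real.pi * ξ) / (2 * Real.pi)

theorem rescale_schr : rescale schr = fun ξ => -(2 * Real.pi * ξ ^ 2) := by
  funext ξ
  unfold rescale schr
  rw [sq_abs]
  field_simp

theorem enorm_weight_mul_sq (φ : ℝ → ℝ) (s b : ℝ) (ζ : Spacetime) (z : ℂ) :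
    ‖(weight φ s b ζ : ℂ) * z‖ₑ ^ 2 = ENNReal.ofReal (bracket (2 * Real.pi * ζ 0) ^ (2 * s)) *
      (ENNReal.ofReal (bracket (2 * Real.pi * (ζ 1 - rescale φ (ζ 0))) ^ (2 * b)) * ‖z‖ₑ ^ 2) := by
  have h1 := bracket_pos (2 * Real.pi * ζ 0)
  have h2 := bracket_pos (2 * Real.pi * ζ 1 - φ (2 * Real.pi * ζ 0))
  have e : 2 * Real.pi * (ζ 1 - rescale φ (ζ 0)) = 2 * Real.pi * ζ 1 - φ (2 * Real.pi * ζ 0) := by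
    unfold rescale
    field_simp
  have e2 : ∀ (x c : ℝ), 0 < x → x ^ (2 * c) = (x ^ c) ^ 2 := by
    intro x c hx
    rw [← Real.rpow_natCast, ← Real.rpow_mul hx.le]
    congr 1
    push_cast
    ring
  rw [e, e2 _ s h1, e2 _ b h2, enorm_mul, mul_pow, ← ofReal_norm (Complex.ofReal _)]
  unfold weight
  rw [Complex.norm_of_nonneg (by positivity), ENNReal.ofReal_mul (by positivity), mul_pow,
    ENNReal.ofReal_pow (by positivity), ENNReal.ofReal_pow (by positivity)]
  ring

theorem measurable_weight {φ : ℝ → ℝ} (hφ : Measurable φ) (s b : ℝ) : Measurable (weight φ s b) := by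
  unfold weight
  fun_prop

/-- A truncation is pointwise dominated by the original, so one bound holds for all approximants, in
every weighted norm at once. -/
theorem planeNormSq_le {φ : ℝ → ℝ} (hφ : Measurable φ) (s b R : ℝ) {F h : Spacetime → ℂ}
    (hF : Measurable F) (hle : ∀ᵐ ζ, ‖F ζ‖ ≤ ‖h ζ‖) :
    planeNormSq (rescale φ) s b R (fun ξ τ => F (planeEquiv (ξ, τ))) ≤
      eLpNorm (fun ζ => (weight φ s b ζ : ℂ) * h ζ) 2 volume ^ 2 := by
  have hwm := measurable_weight hφ s b
  have hm : Measurable fun ζ => ‖(weight φ s b ζ : ℂ) * F ζ‖ₑ ^ 2 := by fun_prop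
  calc _ ≤ ∫⁻ ξ, ∫⁻ τ, ‖(weight φ s b (planeEquiv (ξ, τ)) : ℂ) * F (planeEquiv (ξ, τ))‖ₑ ^ 2 := by
        unfold planeNormSq
        refine (lintegral_mono' Measure.restrict_le_self fun ξ => ?_)
        refine (lintegral_mono' Measure.restrict_le_self fun τ => ?_)
        rw [enorm_weight_mul_sq]
        rfl
    _ = ∫⁻ ζ, ‖(weight φ s b ζ : ℂ) * F ζ‖ₑ ^ 2 := by
        rw [← measurePreserving_planeEquiv.lintegral_comp_emb planeEquiv.measurableEmbedding]
        exact (lintegral_prod _ (hm.comp planeEquiv.measurable).aemeasurable).symm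
    _ ≤ _ := by
        rw [eLpNorm_two_sq]
        refine lintegral_mono_ae ?_
        filter_upwards [hle] with ζ hζ
        rw [enorm_mul, enorm_mul]
        gcongr
        exact enorm_le_iff_norm_le.2 hζ

/-- Approximation of an `L²` function by functions with bounded, compactly supported Fourier
transforms. -/
theorem exists_synth_approx {h : Spacetime → ℂ} (hh : MemLp h 2 volume) :
    ∃ (R : ℕ → ℝ) (H : ℕ → ℝ → ℝ → ℂ), (∀ n, 0 < R n) ∧
      (∀ n, Measurable (Function.uncurry (H n))) ∧ (∀ n, ∃ D, ∀ ξ τ, ‖H n ξ τ‖ ≤ D) ∧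
      (∀ n ξ τ, R n < |ξ| → H n ξ τ = 0) ∧
      (∀ (φ : ℝ → ℝ) (s b : ℝ), Measurable φ → ∀ n, planeNormSq (rescale φ) s b (R n) (H n) ≤
        eLpNorm (fun ζ => (weight φ s b ζ : ℂ) * h ζ) 2 volume ^ 2) ∧
      ∀ᵐ t : ℝ, ∀ᵐ x : ℝ, Tendsto (fun n => synth (R n) (H n) x t) atTop
        (nhds ((𝓕⁻ (hh.toLp h) : Lp ℂ 2 (volume : Measure Spacetime)) (planeEquiv (x, t)))) := by
  classical
  obtain ⟨h', hh'm, hh'⟩ := hh.1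
  have hm' := hh'm.measurable
  -- Truncation in both frequencies and in size. The bound `n + 1`, not `n`, keeps the band limit
  -- positive, as the dispersive estimate requires.
  let S : ℕ → Set Spacetime := fun n =>
    {ζ | |ζ 0| ≤ n + 1} ∩ {ζ | |ζ 1| ≤ n + 1} ∩ {ζ | ‖h' ζ‖ ≤ n + 1}
  have hS : ∀ n, MeasurableSet (S n) := by
    intro n
    refine ((measurableSet_le ?_ measurable_const).inter
      (measurableSet_le ?_ measurable_const)).inter (measurableSet_le ?_ measurable_const) <;>
    fun_prop
  let F : ℕ → Spacetime → ℂ := fun n => (S n).indicator h'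
  have hFm : ∀ n, Measurable (F n) := fun n => hm'.indicator (hS n)
  have hFle : ∀ n, ∀ᵐ ζ, ‖F n ζ‖ ≤ ‖h ζ‖ := by
    intro n
    filter_upwards [hh'] with ζ hζ
    rw [hζ]
    exact norm_indicator_le_norm_self _ _
  have hFb : ∀ n ζ, ‖F n ζ‖ ≤ n + 1 := by
    intro n ζ
    by_cases hζ : ζ ∈ S n
    · simp only [F, Set.indicator_of_mem hζ]
      exact hζ.2
    · simp only [F, Set.indicator_of_notMem hζ, norm_zero]
      positivity
  have hF0 : ∀ (n : ℕ) (ζ : Spacetime), (n + 1 : ℝ) < |ζ 0| → F n ζ = 0 := fun n ζ hζ =>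
    Set.indicator_of_notMem (fun hc => absurd hc.1.1 (not_le.2 hζ)) _
  have hF1 : ∀ (n : ℕ) (ζ : Spacetime), (n + 1 : ℝ) < |ζ 1| → F n ζ = 0 := fun n ζ hζ =>
    Set.indicator_of_notMem (fun hc => absurd hc.1.2 (not_le.2 hζ)) _
  have hF2 : ∀ n, MemLp (F n) 2 volume := fun n =>
    hh.mono (hFm n).aestronglyMeasurable (hFle n)
  have hFi : ∀ n, Integrable (F n) := by
    intro n
    have hfin : (volume (S n)) < ∞ := by
      have hsub : S n ⊆ planeEquiv '' (Set.Icc (-(n + 1 : ℝ)) (n + 1) ×ˢ Set.Icc (-(n + 1 : ℝ)) (n + 1)) := by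
        intro ζ hζ
        refine ⟨planeEquiv.symm ζ, ⟨abs_le.1 hζ.1.1, abs_le.1 hζ.1.2⟩, planeEquiv.apply_symm_apply ζ⟩
      refine (measure_mono hsub).trans_lt ?_
      rw [← measurePreserving_planeEquiv.measure_preimage_equiv,
        Set.preimage_image_eq _ planeEquiv.injective, Measure.volume_eq_prod, Measure.prod_prod]
      exact ENNReal.mul_lt_top (by simp) (by simp)
    have : IntegrableOn h' (S n) := by
      have : IsFiniteMeasure (volume.restrict (S n)) := ⟨by simpa using hfin⟩
      refine Integrable.of_bound hm'.aestronglyMeasurable (n + 1) ?_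
      filter_upwards [ae_restrict_mem (hS n)] with ζ hζ
      exact hζ.2
    exact (integrable_indicator_iff (hS n)).2 this
  have hlim : Tendsto (fun n => (hF2 n).toLp (F n)) atTop (nhds (hh.toLp h)) := by
    rw [Lp.tendsto_Lp_iff_tendsto_eLpNorm'' (f := F) (f_ℒp := hF2)]
    have h2 : Tendsto (fun n => ∫⁻ ζ, ‖F n ζ - h' ζ‖ₑ ^ 2) atTop (nhds (∫⁻ _ : Spacetime, 0)) := by
      refine tendsto_lintegral_of_dominated_convergence (fun ζ => ‖h' ζ‖ₑ ^ 2) (fun n => ?_)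
        (fun n => Eventually.of_forall fun ζ => ?_) ?_ (Eventually.of_forall fun ζ => ?_)
      · have := hFm n
        fun_prop
      · simp only
        gcongr
        by_cases hζ : ζ ∈ S n
        · simp [F, hζ]
        · simp [F, hζ]
      · rw [← eLpNorm_two_sq, ← eLpNorm_congr_ae hh']
        exact ENNReal.pow_ne_top hh.2.ne
      · refine tendsto_const_nhds.congr' ?_
        obtain ⟨N, hN⟩ := exists_nat_ge (max (max |ζ 0| |ζ 1|) ‖h' ζ‖)
        filter_upwards [eventually_ge_atTop N] with n hn
        have hn' : (N : ℝ) ≤ n := by exact_mod_cast hn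
        have hmem : ζ ∈ S n := by
          have h1 := (le_max_left _ _).trans hN
          have h2 := (le_max_right _ _).trans hN
          have h3 := (le_max_left _ _).trans h1
          have h4 := (le_max_right _ _).trans h1
          refine ⟨⟨?_, ?_⟩, ?_⟩ <;> simp only [Set.mem_ofPred_eq] <;> linarith
        simp [F, hmem]
    have h3 : ∀ n, eLpNorm (F n - h) 2 volume = (∫⁻ ζ, ‖F n ζ - h' ζ‖ₑ ^ 2) ^ (1 / 2 : ℝ) := by
      intro n
      have : eLpNorm (F n - h) 2 volume = eLpNorm (fun ζ => F n ζ - h' ζ) 2 volume := by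
        refine eLpNorm_congr_ae ?_
        filter_upwards [hh'] with ζ hζ
        simp [hζ]
      rw [this, ← eLpNorm_two_sq, ← ENNReal.rpow_natCast, ← ENNReal.rpow_mul]
      simp
    simp_rw [h3]
    rw [lintegral_zero] at h2
    have h4 := h2.ennrpow_const (1 / 2 : ℝ)
    simpa using h4
  have hlim2 : Tendsto (fun n => (𝓕⁻ ((hF2 n).toLp (F n)) : Lp ℂ 2 (volume : Measure Spacetime)))
      atTop (nhds (𝓕⁻ (hh.toLp h))) :=
    ((Lp.fourierTransformₗᵢ Spacetime ℂ).symm.continuous.tendsto _).comp hlim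
  -- `L²` convergence of the inverse transforms gives almost everywhere convergence along a
  -- subsequence, which is what Fatou's lemma needs.
  obtain ⟨ns, -, hns⟩ := (tendstoInMeasure_of_tendsto_Lp hlim2).exists_seq_tendsto_ae
  refine ⟨fun k => ns k + 1, fun k ξ τ => F (ns k) (planeEquiv (ξ, τ)), fun k => by positivity,
    fun k => (hFm _).comp planeEquiv.measurable, fun k => ⟨ns k + 1, fun ξ τ => hFb _ _⟩,
    fun k ξ τ hξ => hF0 (ns k) (planeEquiv (ξ, τ)) hξ, fun φ s b hφ k => planeNormSq_le hφ s b _ (hFm _) (hFle _), ?_⟩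
  have hall : ∀ᵐ z, ∀ n, (𝓕⁻ ((hF2 n).toLp (F n)) : Lp ℂ 2 (volume : Measure Spacetime)) z =
      𝓕⁻ (F n) z := ae_all_iff.2 fun n => fourierInv_toLp_ae_eq (hFi n) (hF2 n)
  have hcomb : ∀ᵐ z, Tendsto (fun k => 𝓕⁻ (F (ns k)) z) atTop
      (nhds ((𝓕⁻ (hh.toLp h) : Lp ℂ 2 (volume : Measure Spacetime)) z)) := by
    filter_upwards [hall, hns] with z h1 h2
    simpa only [h1] using h2
  filter_upwards [ae_ae_planeEquiv hcomb] with t ht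
  filter_upwards [ht] with x hx
  refine hx.congr fun k => ?_
  exact fourierInv_planeEquiv (hFm _) (hFb _) (hF0 _) (hF1 _) x t

theorem rpow_liminf {q : ℝ} (hq : 0 < q) (u : ℕ → ℝ≥0∞) :
    (liminf u atTop) ^ q = liminf (fun n => u n ^ q) atTop :=
  (ENNReal.orderIsoRpow q hq).liminf_apply

theorem half_rpow_mul (K W : ℝ≥0∞) {q : ℝ} (hq : 0 ≤ q) :
    (K * W ^ 2) ^ (q / 2) = (K ^ (1 / 2 : ℝ) * W) ^ q := by
  rw [ENNReal.mul_rpow_of_nonneg _ _ (by positivity), ENNReal.mul_rpow_of_nonneg _ _ hq,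
    ← ENNReal.rpow_mul, ← ENNReal.rpow_natCast, ← ENNReal.rpow_mul]
  congr 2
  · ring
  · push_cast; ring

/-- The embedding of `X^{s,b}` into `L^q` in time with values in `L^p`. -/
theorem exists_lintegral_fourierInv_le {φ : ℝ → ℝ} {s b p q : ℝ} {A : ℝ≥0∞} (hφ : Measurable φ)
    (hb : 0 < b) (hq : 2 ≤ q) (hp : 2 ≤ p) (hs : 0 ≤ s) (hA : SobolevBound p s A)
    {h : Spacetime → ℂ} (hh : MemLp h 2 volume) :
    ∃ B : ℝ → ℝ≥0∞, Measurable B ∧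
      (∀ᵐ t, ∫⁻ x, ‖(𝓕⁻ (hh.toLp h) : Lp ℂ 2 (volume : Measure Spacetime)) (planeEquiv (x, t))‖ₑ ^ p
        ≤ B t ^ p) ∧
      ∫⁻ t, B t ^ q ≤ ((A * embConst b 0 q) ^ (1 / 2 : ℝ) *
        eLpNorm (fun ζ => (weight φ s b ζ : ℂ) * h ζ) 2 volume) ^ q := by
  have hp0 : 0 < p := by linarith
  have hq0 : 0 < q := by linarith
  obtain ⟨R, H, hR, hHm, hHb, hH0, hle, hlim⟩ := exists_synth_approx hh
  have hsm : ∀ n, Measurable fun w : ℝ × ℝ => synth (R n) (H n) w.1 w.2 := fun n =>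
    measurable_synth (hHm n)
  have hBm : ∀ n, Measurable fun t => ∫⁻ x, ‖synth (R n) (H n) x t‖ₑ ^ p := fun n =>
    Measurable.lintegral_prod_left' (f := fun w : ℝ × ℝ => ‖synth (R n) (H n) w.1 w.2‖ₑ ^ p)
      ((hsm n).enorm.pow_const p)
  have hφ' : Measurable (rescale φ) := by
    unfold rescale
    fun_prop
  -- The bound is a lower limit of the approximants' norms: Fatou in `x` shows that it dominates the
  -- limit's norm, Fatou in `t` that it satisfies the uniform estimate.
  refine ⟨fun t => liminf (fun n => (∫⁻ x, ‖synth (R n) (H n) x t‖ₑ ^ p) ^ (1 / p)) atTop,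
    Measurable.liminf fun n => (hBm n).pow_const _, ?_, ?_⟩
  · filter_upwards [hlim] with t ht
    have e : (liminf (fun n => (∫⁻ x, ‖synth (R n) (H n) x t‖ₑ ^ p) ^ (1 / p)) atTop) ^ p =
        liminf (fun n => ∫⁻ x, ‖synth (R n) (H n) x t‖ₑ ^ p) atTop := by
      rw [rpow_liminf hp0]
      simp_rw [← ENNReal.rpow_mul, one_div_mul_cancel hp0.ne', ENNReal.rpow_one]
    rw [e]
    calc _ ≤ ∫⁻ x, liminf (fun n => ‖synth (R n) (H n) x t‖ₑ ^ p) atTop := by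
          refine lintegral_mono_ae ?_
          filter_upwards [ht] with x hx
          exact (hx.enorm.ennrpow_const p).liminf_eq.ge
      _ ≤ _ := lintegral_liminf_le fun n =>
          ((hsm n).comp (measurable_id.prodMk measurable_const)).enorm.pow_const p
  · simp_rw [rpow_liminf hq0, ← ENNReal.rpow_mul, one_div_mul_eq_div]
    refine (lintegral_liminf_le fun n => (hBm n).pow_const _).trans ?_
    refine liminf_le_of_le (by isBoundedDefault) fun c hc => ?_
    obtain ⟨n, hn⟩ := hc.exists
    obtain ⟨D, hD⟩ := hHb n
    refine hn.trans ((lintegral_synth_le hφ' hb hq hp hs hA (hHm n) hD (hH0 n)).trans ?_)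
    rw [← half_rpow_mul _ _ hq0.le]
    gcongr
    exact hle φ s b hφ n

/-- The embedding of `X^{0,b}` into `L^q` in time with values in `L^∞`, for the Schrödinger
equation. -/
theorem exists_sup_fourierInv_le {b q : ℝ} (hb : 0 < b) (hq : 2 ≤ q)
    {h : Spacetime → ℂ} (hh : MemLp h 2 volume) :
    ∃ M : ℝ → ℝ≥0∞, Measurable M ∧
      (∀ᵐ t, ∀ᵐ x, ‖(𝓕⁻ (hh.toLp h) : Lp ℂ 2 (volume : Measure Spacetime)) (planeEquiv (x, t))‖ₑ
        ≤ M t) ∧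
      ∫⁻ t, M t ^ q ≤ ((embConst b (1 / 2) q * ENNReal.ofReal (Real.exp 1)) ^ (1 / 2 : ℝ) *
        eLpNorm (fun ζ => (weight schr 0 b ζ : ℂ) * h ζ) 2 volume) ^ q := by
  have hq0 : 0 < q := by linarith
  obtain ⟨R, H, hR, hHm, hHb, hH0, hle, hlim⟩ := exists_synth_approx hh
  have hex : ∀ n, ∃ M : ℝ → ℝ≥0∞, Measurable M ∧ (∀ x t, ‖synth (R n) (H n) x t‖ₑ ≤ M t) ∧
      ∫⁻ t, M t ^ q ≤ (embConst b (1 / 2) q * ENNReal.ofReal (Real.exp 1) *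
        planeNormSq (fun ξ => -(2 * Real.pi * ξ ^ 2)) 0 b (R n) (H n)) ^ (q / 2) := by
    intro n
    obtain ⟨D, hD⟩ := hHb n
    exact exists_lintegral_sup_synth_le hb hq (hHm n) hD (hR n) (hH0 n)
  choose M hMm hMle hMq using hex
  refine ⟨fun t => liminf (fun n => M n t) atTop, Measurable.liminf hMm, ?_, ?_⟩
  · filter_upwards [hlim] with t ht
    filter_upwards [ht] with x hx
    rw [← hx.enorm.liminf_eq]
    exact liminf_le_liminf (Eventually.of_forall fun n => hMle n x t)
  · simp_rw [rpow_liminf hq0]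
    refine (lintegral_liminf_le fun n => (hMm n).pow_const _).trans ?_
    refine liminf_le_of_le (by isBoundedDefault) fun c hc => ?_
    obtain ⟨n, hn⟩ := hc.exists
    refine hn.trans ((hMq n).trans ?_)
    rw [← half_rpow_mul _ _ hq0.le, ← rescale_schr]
    gcongr
    exact hle schr 0 b schr_temperate.1.continuous.measurable n

end KGS

/-! ### Distributions from dual bounds, and functions from distributions -/

namespace KGS

open scoped ComplexConjugate

theorem eLpNorm_conj_mul_eq (w f : Spacetime → ℂ) (p : ℝ≥0∞) :
    eLpNorm (fun ζ => w ζ * conj (f ζ)) p volume = eLpNorm (fun ζ => w ζ * f ζ) p volume :=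
  eLpNorm_congr_norm_ae (Filter.Eventually.of_forall fun ζ => by simp)

/-- A function which is bounded on the dual space is a distribution in the space. -/
theorem exists_distribution {φ : ℝ → ℝ} (hφ : φ.HasTemperateGrowth) {s b : ℝ}
    {f : Spacetime → ℂ} (hf : AEStronglyMeasurable f) {K : ℝ≥0∞} (hK : K ≠ ∞)
    (hfK : ∀ g : SchwartzMap Spacetime ℂ, ∫⁻ z, ‖g z * f z‖ₑ ≤
      K * eLpNorm (fun ζ => (weight φ (-s) (-b) ζ : ℂ) * (𝓕⁻ g : SchwartzMap Spacetime ℂ) ζ) 2 volume) :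
    ∃ F : TemperedDistribution Spacetime ℂ, IsFunction f F ∧ XNorm φ s b F ≤ K := by
  have hw := weight_temperate hφ s b
  have hw' := weight_temperate hφ (-s) (-b)
  set S : SchwartzMap Spacetime ℂ →L[ℂ] Lp ℂ 2 (volume : Measure Spacetime) :=
    (SchwartzMap.toLpCLM ℂ ℂ 2 volume).comp
      ((SchwartzMap.smulLeftCLM ℂ (fun ζ => (weight φ (-s) (-b) ζ : ℂ))).comp
        (fourierInvCLM ℂ (SchwartzMap Spacetime ℂ))) with hS
  have hSapp : ∀ g, S g = (SchwartzMap.smulLeftCLM ℂ (fun ζ => (weight φ (-s) (-b) ζ : ℂ))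
      (𝓕⁻ g)).toLp 2 volume := fun g => rfl
  have hSae : ∀ g, (S g : Spacetime → ℂ) =ᵐ[volume]
      fun ζ => (weight φ (-s) (-b) ζ : ℂ) * (𝓕⁻ g : SchwartzMap Spacetime ℂ) ζ := by
    intro g
    rw [hSapp]
    filter_upwards [SchwartzMap.coeFn_toLp (SchwartzMap.smulLeftCLM ℂ
      (fun ζ => (weight φ (-s) (-b) ζ : ℂ)) (𝓕⁻ g)) 2 volume] with ζ hζ
    rw [hζ, SchwartzMap.smulLeftCLM_apply_apply hw', smul_eq_mul]
  have hSn : ∀ g, eLpNorm (fun ζ => (weight φ (-s) (-b) ζ : ℂ) *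
      (𝓕⁻ g : SchwartzMap Spacetime ℂ) ζ) 2 volume = ‖S g‖ₑ := by
    intro g
    rw [← eLpNorm_congr_ae (hSae g), Lp.enorm_def]
  -- Multiplication by the weight and the Fourier transform are invertible on Schwartz functions, so
  -- the range contains all of them.
  have hdense : DenseRange S.toLinearMap := by
    refine (SchwartzMap.denseRange_toLpCLM (F := ℂ) (μ := (volume : Measure Spacetime)) (p := 2)
      (by simp)).mono ?_
    rintro _ ⟨k, rfl⟩
    refine ⟨𝓕 (SchwartzMap.smulLeftCLM ℂ (fun ζ => (weight φ s b ζ : ℂ)) k), ?_⟩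
    change S _ = _
    rw [hSapp, FourierTransform.fourierInv_fourier_eq]
    change _ = k.toLp 2 volume
    congr 1
    ext ζ
    rw [SchwartzMap.smulLeftCLM_apply_apply hw', SchwartzMap.smulLeftCLM_apply_apply hw,
      smul_eq_mul, smul_eq_mul, ← mul_assoc, mul_comm (weight φ (-s) (-b) ζ : ℂ), weight_mul_neg,
      one_mul]
  have hint : ∀ g : SchwartzMap Spacetime ℂ, Integrable (fun z => g z * f z) := by
    intro g
    refine ⟨g.continuous.aestronglyMeasurable.mul hf, (hfK g).trans_lt ?_⟩
    rw [hSn]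
    exact ENNReal.mul_lt_top hK.lt_top enorm_lt_top
  let l0 : SchwartzMap Spacetime ℂ →ₗ[ℂ] ℂ :=
    { toFun := fun g => ∫ z, g z * f z
      map_add' := fun g g' => by
        rw [← integral_add (hint g) (hint g')]
        refine integral_congr_ae (Filter.Eventually.of_forall fun z => ?_)
        simp [add_mul]
      map_smul' := fun c g => by
        rw [RingHom.id_apply, smul_eq_mul, ← integral_const_mul]
        refine integral_congr_ae (Filter.Eventually.of_forall fun z => ?_)
        simp [mul_assoc] }
  have hl0 : ∀ g, ‖l0 g‖ ≤ K.toReal * ‖S.toLinearMap g‖ := by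
    intro g
    have h1 : ‖l0 g‖ₑ ≤ K * ‖S g‖ₑ := by
      rw [← hSn]
      exact (enorm_integral_le_lintegral_enorm _).trans (hfK g)
    have h2 := ENNReal.toReal_mono (ENNReal.mul_ne_top hK enorm_ne_top) h1
    rwa [ENNReal.toReal_mul, toReal_enorm, toReal_enorm] at h2
  -- By the hypothesis, `∫ g f` is controlled by the norm of `S g`, so it factors through `S` and
  -- extends to a functional on `L²` of norm at most `K`.
  set l := l0.extendOfNorm S.toLinearMap with hl
  have hlS : ∀ g, l (S g) = ∫ z, g z * f z := fun g =>
    LinearMap.extendOfNorm_eq hdense ⟨_, hl0⟩ g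
  have hlK : ‖l‖ ≤ K.toReal := LinearMap.opNorm_extendOfNorm_le hdense ENNReal.toReal_nonneg hl0
  let F : TemperedDistribution Spacetime ℂ :=
    ContinuousLinearMap.toPointwiseConvergenceCLM _ _ _ _ (l.comp S)
  have hF : ∀ g, F g = l (S g) := fun g => rfl
  refine ⟨F, fun g => ⟨hint g, (hF g).trans (hlS g)⟩, ?_⟩
  set y := (InnerProductSpace.toDual ℂ (Lp ℂ 2 (volume : Measure Spacetime))).symm l with hy
  have hyl : ∀ x, l x = ∫ ζ, conj (y ζ) * x ζ := by
    intro x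
    rw [← InnerProductSpace.toDual_symm_apply, ← hy, L2.inner_def]
    refine integral_congr_ae (Filter.Eventually.of_forall fun ζ => ?_)
    simp [mul_comm]
  have hyn : ‖y‖ ≤ K.toReal := by
    rw [hy, LinearIsometryEquiv.norm_map]
    exact hlK
  -- The Riesz vector `y` of the functional, conjugated and multiplied by the inverse weight, is the
  -- Fourier transform of `F`; multiplying by the weight leaves `conj y`, of norm at most `K`.
  have hFF : IsFunction (fun ζ => (weight φ (-s) (-b) ζ : ℂ) * conj (y ζ)) (𝓕 F) := by
    intro g
    have hae := hSae (𝓕 g)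
    rw [FourierTransform.fourierInv_fourier_eq] at hae
    have hyc : MemLp (fun ζ => conj (y ζ)) 2 volume := (Lp.memLp y).star
    have hi : Integrable (fun ζ => conj (y ζ) * S (𝓕 g) ζ) :=
      MemLp.integrable_mul hyc (Lp.memLp _)
    have hae2 : (fun ζ => conj (y ζ) * S (𝓕 g) ζ) =ᵐ[volume]
        fun ζ => g ζ * ((weight φ (-s) (-b) ζ : ℂ) * conj (y ζ)) := by
      filter_upwards [hae] with ζ hζ
      rw [hζ]
      ring
    refine ⟨hi.congr hae2, ?_⟩
    rw [TemperedDistribution.fourier_apply, hF, hyl, integral_congr_ae hae2]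
  rw [XNorm_eq hFF]
  have e : ∀ ζ, (weight φ s b ζ : ℂ) * ((weight φ (-s) (-b) ζ : ℂ) * conj (y ζ)) = 1 * conj (y ζ) := by
    intro ζ
    rw [← mul_assoc, weight_mul_neg]
  simp_rw [e]
  rw [eLpNorm_conj_mul_eq (fun _ => 1)]
  simp only [one_mul]
  rw [← Lp.enorm_def, ← ofReal_norm]
  exact ENNReal.ofReal_le_of_le_toReal hyn

/-- For nonnegative exponents the distributions in the spaces are `L²` functions. -/
theorem MemX.exists_fourierInv {φ : ℝ → ℝ} {s b : ℝ} (hs : 0 ≤ s) (hb : 0 ≤ b)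
    {T : TemperedDistribution Spacetime ℂ} (hT : MemX φ s b T) :
    ∃ (h : Spacetime → ℂ) (hh : MemLp h 2 volume),
      eLpNorm (fun ζ => (weight φ s b ζ : ℂ) * h ζ) 2 volume = XNorm φ s b T ∧
      IsFunction (𝓕⁻ (hh.toLp h) : Lp ℂ 2 (volume : Measure Spacetime)) T := by
  obtain ⟨h, hh, hlt⟩ : ∃ h, ∃ _ : IsFunction h (𝓕 T),
      eLpNorm (fun ζ => (weight φ s b ζ : ℂ) * h ζ) 2 volume < ∞ := by
    simpa only [MemX, XNorm, iInf_lt_iff] using hT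
  have h2 : MemLp h 2 volume := by
    refine ⟨hh.locallyIntegrable.aestronglyMeasurable, lt_of_le_of_lt (eLpNorm_mono fun ζ => ?_) hlt⟩
    rw [norm_mul, Complex.norm_real]
    have : 1 ≤ ‖weight φ s b ζ‖ := by
      refine le_trans ?_ (Real.le_norm_self _)
      exact one_le_mul_of_one_le_of_one_le (Real.one_le_rpow (one_le_bracket _) hs)
        (Real.one_le_rpow (one_le_bracket _) hb)
    exact le_mul_of_one_le_left (norm_nonneg _) this
  refine ⟨h, h2, (XNorm_eq hh).symm, ?_⟩
  have e1 : 𝓕 T = Lp.toTemperedDistribution (h2.toLp h) := by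
    ext g
    rw [(hh g).2, Lp.toTemperedDistribution_apply]
    refine integral_congr_ae ?_
    filter_upwards [h2.coeFn_toLp] with ζ hζ
    rw [hζ, smul_eq_mul]
  have e2 : T = Lp.toTemperedDistribution (𝓕⁻ (h2.toLp h) : Lp ℂ 2 (volume : Measure Spacetime)) := by
    rw [← Lp.fourierInv_toTemperedDistribution_eq, ← e1, FourierTransform.fourierInv_fourier_eq]
  intro g
  refine ⟨MemLp.integrable_mul (g.memLp 2 volume) (Lp.memLp _), ?_⟩
  conv_lhs => rw [e2]
  rw [Lp.toTemperedDistribution_apply]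
  rfl

/-- A Schwartz function, up to conjugation, as the inverse Fourier transform of an `L²` function. -/
theorem exists_fourierInv_ae_eq_conj (g : SchwartzMap Spacetime ℂ) :
    ∃ (h : Spacetime → ℂ) (hh : MemLp h 2 volume),
      (∀ (φ : ℝ → ℝ) (s b : ℝ), eLpNorm (fun ζ => (weight φ s b ζ : ℂ) * h ζ) 2 volume =
        eLpNorm (fun ζ => (weight φ s b ζ : ℂ) * (𝓕⁻ g : SchwartzMap Spacetime ℂ) ζ) 2 volume) ∧
      ((𝓕⁻ (hh.toLp h) : Lp ℂ 2 (volume : Measure Spacetime)) : Spacetime → ℂ) =ᵐ[volume]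
        fun z => conj (g z) := by
  set k : SchwartzMap Spacetime ℂ := 𝓕⁻ g with hk
  have hm : MemLp (fun ζ => conj (k ζ)) 2 volume := (k.memLp 2 volume).star
  have hi : Integrable (fun ζ => conj (k ζ)) := memLp_one_iff_integrable.1 (k.memLp 1 volume).star
  -- Only `|g|` matters in the integrals, so `conj g` may replace `g`. Its Fourier transform is
  -- `conj (𝓕⁻ g)`, whereas that of `g` is a reflection of `𝓕⁻ g`; conjugation thus keeps the symbol
  -- `φ` in the weight.
  refine ⟨fun ζ => conj (k ζ), hm, fun φ s b => eLpNorm_conj_mul_eq _ _ _, ?_⟩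
  filter_upwards [fourierInv_toLp_ae_eq hi hm] with z hz
  rw [hz]
  have hg : g = 𝓕 k := (FourierTransform.fourier_fourierInv_eq g).symm
  rw [hg, SchwartzMap.fourier_coe, Real.fourierInv_eq', Real.fourier_eq', ← integral_conj]
  refine integral_congr_ae (Filter.Eventually.of_forall fun ζ => ?_)
  simp only [smul_eq_mul, map_mul, ← Complex.exp_conj, Complex.conj_ofReal, Complex.conj_I]
  congr 2
  push_cast
  ring

end KGS

/-! ### Hölder's inequality in mixed norms -/

namespace KGS

open scoped ComplexConjugate

/-- Hölder's inequality for a product of powers of functions bounded in Lebesgue norms. -/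
theorem lintegral_prod_rpow_le {α ι : Type*} [MeasurableSpace α] {μ : Measure α} [Fintype ι]
    {f : ι → α → ℝ≥0∞} (hf : ∀ i, AEMeasurable (f i) μ) {q e : ι → ℝ} (hq : ∀ i, 0 < q i)
    (he : ∀ i, 0 ≤ e i) (hsum : ∑ i, e i / q i = 1) {c : ι → ℝ≥0∞}
    (hc : ∀ i, ∫⁻ a, f i a ^ q i ∂μ ≤ c i ^ q i) :
    ∫⁻ a, ∏ i, f i a ^ e i ∂μ ≤ ∏ i, c i ^ e i := by
  have h := ENNReal.lintegral_prod_norm_pow_le (μ := μ) Finset.univ (f := fun i a => f i a ^ q i)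
    (fun i _ => (hf i).pow_const _) (p := fun i => e i / q i) hsum
    (fun i _ => div_nonneg (he i) (hq i).le)
  have e1 : ∀ (x : ℝ≥0∞) i, (x ^ q i) ^ (e i / q i) = x ^ e i := by
    intro x i
    rw [← ENNReal.rpow_mul, mul_div_cancel₀ _ (hq i).ne']
  simp only [e1] at h
  refine h.trans (Finset.prod_le_prod' fun i _ => ?_)
  rw [← e1 (c i) i]
  exact ENNReal.rpow_le_rpow (hc i) (div_nonneg (he i) (hq i).le)

section holder

variable {m : ℝ} {n u v : Spacetime → ℂ} {M N A V : ℝ → ℝ≥0∞} {cM cN cA cV : ℝ≥0∞}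

/-- Of the `2m-1` powers of `u`, `m` go to the sup norm and `m-1` to `L²_x`. The exponents balance
in space, `(2-m)/2 + (m-1)/2 + 1/2 = 1`, and in time, `(m+1)/4 + 1/(4m) + (m-1)/(4m) + (2-m)/4 = 1`.
-/
theorem lintegral_triple_le (hm1 : 1 ≤ m) (hm2 : m < 2) (hn : Measurable n) (hu : Measurable u)
    (hv : Measurable v) (hM : Measurable M) (hN : Measurable N) (hA : Measurable A)
    (hV : Measurable V)
    (hMu : ∀ᵐ t, ∀ᵐ x, ‖u (planeEquiv (x, t))‖ₑ ≤ M t)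
    (hNn : ∀ᵐ t, ∫⁻ x, ‖n (planeEquiv (x, t))‖ₑ ^ (2 / (2 - m)) ≤ N t ^ (2 / (2 - m)))
    (hAu : ∀ᵐ t, ∫⁻ x, ‖u (planeEquiv (x, t))‖ₑ ^ (2 : ℝ) ≤ A t ^ (2 : ℝ))
    (hVv : ∀ᵐ t, ∫⁻ x, ‖v (planeEquiv (x, t))‖ₑ ^ (2 : ℝ) ≤ V t ^ (2 : ℝ))
    (hcM : ∫⁻ t, M t ^ (4 * m / (m + 1)) ≤ cM ^ (4 * m / (m + 1)))
    (hcN : ∫⁻ t, N t ^ (4 * m) ≤ cN ^ (4 * m))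
    (hcA : ∫⁻ t, A t ^ (4 * m) ≤ cA ^ (4 * m))
    (hcV : ∫⁻ t, V t ^ (4 / (2 - m)) ≤ cV ^ (4 / (2 - m))) :
    ∫⁻ z, ‖n z‖ₑ * ‖u z‖ₑ ^ (2 * m - 1) * ‖v z‖ₑ ≤ cM ^ m * cN * cA ^ (m - 1) * cV := by
  rw [lintegral_planeEquiv (by fun_prop)]
  calc _ ≤ ∫⁻ t, M t ^ m * (N t * A t ^ (m - 1) * V t) := by
        refine lintegral_mono_ae ?_
        filter_upwards [hMu, hNn, hAu, hVv] with t h1 h2 h3 h4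
        calc _ ≤ ∫⁻ x, M t ^ m * (‖n (planeEquiv (x, t))‖ₑ * ‖u (planeEquiv (x, t))‖ₑ ^ (m - 1) *
              ‖v (planeEquiv (x, t))‖ₑ) := by
              refine lintegral_mono_ae ?_
              filter_upwards [h1] with x hx
              have e : 2 * m - 1 = m + (m - 1) := by ring
              rw [e, ENNReal.rpow_add_of_nonneg _ _ (by linarith) (by linarith)]
              calc _ ≤ ‖n (planeEquiv (x, t))‖ₑ * (M t ^ m * ‖u (planeEquiv (x, t))‖ₑ ^ (m - 1)) *
                    ‖v (planeEquiv (x, t))‖ₑ := by gcongr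
                _ = _ := by ring
          _ ≤ _ := by
              rw [lintegral_const_mul _ (by fun_prop)]
              gcongr
              have h := lintegral_prod_rpow_le (μ := (volume : Measure ℝ)) (ι := Fin 3)
                (f := ![fun x => ‖n (planeEquiv (x, t))‖ₑ, fun x => ‖u (planeEquiv (x, t))‖ₑ,
                  fun x => ‖v (planeEquiv (x, t))‖ₑ]) (q := ![2 / (2 - m), 2, 2])
                (e := ![1, m - 1, 1]) (c := ![N t, A t, V t])
                (by
                  simp only [Fin.forall_fin_succ, Matrix.cons_val_zero, Matrix.cons_val_succ]
                  exact ⟨by fun_prop, by fun_prop, by fun_prop, fun i => i.elim0⟩)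
                (by
                  simp only [Fin.forall_fin_succ, Matrix.cons_val_zero, Matrix.cons_val_succ]
                  exact ⟨by positivity, by norm_num, by norm_num, fun i => i.elim0⟩)
                (by
                  simp only [Fin.forall_fin_succ, Matrix.cons_val_zero, Matrix.cons_val_succ]
                  exact ⟨by norm_num, by linarith, by norm_num, fun i => i.elim0⟩)
                (by
                  simp only [Fin.sum_univ_three, Matrix.cons_val]
                  field_simp
                  ring)
                (by
                  simp only [Fin.forall_fin_succ, Matrix.cons_val_zero, Matrix.cons_val_succ]
                  exact ⟨h2, h3, h4, fun i => i.elim0⟩)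
              simpa [Fin.prod_univ_three] using h
    _ ≤ _ := by
        have h := lintegral_prod_rpow_le (μ := (volume : Measure ℝ)) (ι := Fin 4)
          (f := ![M, N, A, V]) (q := ![4 * m / (m + 1), 4 * m, 4 * m, 4 / (2 - m)])
          (e := ![m, 1, m - 1, 1]) (c := ![cM, cN, cA, cV])
          (by
            simp only [Fin.forall_fin_succ, Matrix.cons_val_zero, Matrix.cons_val_succ]
            exact ⟨by fun_prop, by fun_prop, by fun_prop, by fun_prop, fun i => i.elim0⟩)
          (by
            simp only [Fin.forall_fin_succ, Matrix.cons_val_zero, Matrix.cons_val_succ]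
            exact ⟨by positivity, by positivity, by positivity, by positivity, fun i => i.elim0⟩)
          (by
            simp only [Fin.forall_fin_succ, Matrix.cons_val_zero, Matrix.cons_val_succ]
            exact ⟨by linarith, by norm_num, by linarith, by norm_num, fun i => i.elim0⟩)
          (by
            simp only [Fin.sum_univ_four, Matrix.cons_val]
            have : m ≠ 0 := by linarith
            field_simp
            ring)
          (by
            simp only [Fin.forall_fin_succ, Matrix.cons_val_zero, Matrix.cons_val_succ]
            exact ⟨hcM, hcN, hcA, hcV, fun i => i.elim0⟩)
        simpa [Fin.prod_univ_four, mul_assoc] using h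

/-- Of the `2m` powers of `u`, half go to the sup norm and half to `L²_x`. The balance is `m/2 +
(2-m)/2 = 1` in space and `(m+1)/4 + 1/4 + (2-m)/4 = 1` in time. -/
theorem lintegral_double_le (hm1 : 1 ≤ m) (hm2 : m < 2) (hu : Measurable u)
    (hv : Measurable v) (hM : Measurable M) (hA : Measurable A) (hV : Measurable V)
    (hMu : ∀ᵐ t, ∀ᵐ x, ‖u (planeEquiv (x, t))‖ₑ ≤ M t)
    (hAu : ∀ᵐ t, ∫⁻ x, ‖u (planeEquiv (x, t))‖ₑ ^ (2 : ℝ) ≤ A t ^ (2 : ℝ))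
    (hVv : ∀ᵐ t, ∫⁻ x, ‖v (planeEquiv (x, t))‖ₑ ^ (2 / (2 - m)) ≤ V t ^ (2 / (2 - m)))
    (hcM : ∫⁻ t, M t ^ (4 * m / (m + 1)) ≤ cM ^ (4 * m / (m + 1)))
    (hcA : ∫⁻ t, A t ^ (4 * m) ≤ cA ^ (4 * m))
    (hcV : ∫⁻ t, V t ^ (4 / (2 - m)) ≤ cV ^ (4 / (2 - m))) :
    ∫⁻ z, ‖u z‖ₑ ^ (2 * m) * ‖v z‖ₑ ≤ cM ^ m * cA ^ m * cV := by
  rw [lintegral_planeEquiv (by fun_prop)]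
  calc _ ≤ ∫⁻ t, M t ^ m * (A t ^ m * V t) := by
        refine lintegral_mono_ae ?_
        filter_upwards [hMu, hAu, hVv] with t h1 h3 h4
        calc _ ≤ ∫⁻ x, M t ^ m * (‖u (planeEquiv (x, t))‖ₑ ^ m * ‖v (planeEquiv (x, t))‖ₑ) := by
              refine lintegral_mono_ae ?_
              filter_upwards [h1] with x hx
              have e : 2 * m = m + m := by ring
              rw [e, ENNReal.rpow_add_of_nonneg _ _ (by linarith) (by linarith), mul_assoc]
              gcongr
          _ ≤ _ := by
              rw [lintegral_const_mul _ (by fun_prop)]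
              gcongr
              have h := lintegral_prod_rpow_le (μ := (volume : Measure ℝ)) (ι := Fin 2)
                (f := ![fun x => ‖u (planeEquiv (x, t))‖ₑ, fun x => ‖v (planeEquiv (x, t))‖ₑ])
                (q := ![2, 2 / (2 - m)]) (e := ![m, 1]) (c := ![A t, V t])
                (by
                  simp only [Fin.forall_fin_succ, Matrix.cons_val_zero, Matrix.cons_val_succ]
                  exact ⟨by fun_prop, by fun_prop, fun i => i.elim0⟩)
                (by
                  simp only [Fin.forall_fin_succ, Matrix.cons_val_zero, Matrix.cons_val_succ]
                  exact ⟨by norm_num, by positivity, fun i => i.elim0⟩)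
                (by
                  simp only [Fin.forall_fin_succ, Matrix.cons_val_zero, Matrix.cons_val_succ]
                  exact ⟨by linarith, by norm_num, fun i => i.elim0⟩)
                (by
                  simp only [Fin.sum_univ_two, Matrix.cons_val_zero, Matrix.cons_val_one]
                  field_simp
                  ring)
                (by
                  simp only [Fin.forall_fin_succ, Matrix.cons_val_zero, Matrix.cons_val_succ]
                  exact ⟨h3, h4, fun i => i.elim0⟩)
              simpa [Fin.prod_univ_two] using h
    _ ≤ _ := by
        have h := lintegral_prod_rpow_le (μ := (volume : Measure ℝ)) (ι := Fin 3)
          (f := ![M, A, V]) (q := ![4 * m / (m + 1), 4 * m, 4 / (2 - m)])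
          (e := ![m, m, 1]) (c := ![cM, cA, cV])
          (by
            simp only [Fin.forall_fin_succ, Matrix.cons_val_zero, Matrix.cons_val_succ]
            exact ⟨by fun_prop, by fun_prop, by fun_prop, fun i => i.elim0⟩)
          (by
            simp only [Fin.forall_fin_succ, Matrix.cons_val_zero, Matrix.cons_val_succ]
            exact ⟨by positivity, by positivity, by positivity, fun i => i.elim0⟩)
          (by
            simp only [Fin.forall_fin_succ, Matrix.cons_val_zero, Matrix.cons_val_succ]
            exact ⟨by linarith, by linarith, by norm_num, fun i => i.elim0⟩)
          (by
            simp only [Fin.sum_univ_three, Matrix.cons_val]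
            have : m ≠ 0 := by linarith
            field_simp
            ring)
          (by
            simp only [Fin.forall_fin_succ, Matrix.cons_val_zero, Matrix.cons_val_succ]
            exact ⟨hcM, hcA, hcV, fun i => i.elim0⟩)
        simpa [Fin.prod_univ_three, mul_assoc] using h

end holder

theorem enorm_ofReal_norm_rpow (z : ℂ) {r : ℝ} (hr : 0 ≤ r) :
    ‖((‖z‖ ^ r : ℝ) : ℂ)‖ₑ = ‖z‖ₑ ^ r := by
  rw [← ofReal_norm, Complex.norm_of_nonneg (by positivity),
    ← ENNReal.ofReal_rpow_of_nonneg (norm_nonneg _) hr, ofReal_norm]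

theorem kg_measurable (σ : ℝ) : Measurable (kg σ) := (kg_temperate σ).1.continuous.measurable

theorem schr_measurable : Measurable schr := schr_temperate.1.continuous.measurable

end KGS

/-! ### Choice of the exponents and conclusion -/

open KGS in
theorem lemma2p3 (m : ℝ) (hm1 : 1 ≤ m) (hm2 : m < 2) :
    ∃ ε : ℝ, 0 < ε ∧ ε < 1 - m / 2 ∧
      ∀ b b' : ℝ, b = (2 * m - 1) / (4 * m) + ε → b' = -1 / 2 + 2 * m * ε →
      ∃ c : ℝ≥0, ∀ σ : ℝ, σ = 1 ∨ σ = -1 →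
        (∀ N U : TemperedDistribution KGS.Spacetime ℂ,
          KGS.MemX (KGS.kg σ) (1 / 2) b N → KGS.MemX KGS.schr 0 b U →
          (∃ n, KGS.IsFunction n N) ∧ (∃ u, KGS.IsFunction u U) ∧
          ∀ n u : KGS.Spacetime → ℂ, KGS.IsFunction n N → KGS.IsFunction u U →
            ∃ F : TemperedDistribution KGS.Spacetime ℂ,
              KGS.IsFunction
                (fun z => n z * ((‖u z‖ ^ (2 * (m - 1)) : ℝ) : ℂ) * u z) F ∧
              KGS.XNorm KGS.schr 0 b' F ≤
                c * KGS.XNorm (KGS.kg σ) (1 / 2) b N * KGS.XNorm KGS.schr 0 b U ^ (2 * m - 1)) ∧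
        (∀ U : TemperedDistribution KGS.Spacetime ℂ,
          KGS.MemX KGS.schr 0 b U →
          (∃ u, KGS.IsFunction u U) ∧
          ∀ u : KGS.Spacetime → ℂ, KGS.IsFunction u U →
            ∃ G : TemperedDistribution KGS.Spacetime ℂ,
              KGS.IsFunction (fun z => ((‖u z‖ ^ (2 * m) : ℝ) : ℂ)) G ∧
              KGS.XNorm (KGS.kg σ) (-1 / 2) b' G ≤
                c * KGS.XNorm KGS.schr 0 b U ^ (2 * m)) := by
  have h2m : 0 < 2 - m := by linarith
  have hm0 : 0 < m := by linarith
  -- The binding condition is the one for `v`: `(1+2b') · 4/(2-m) = 16mε/(2-m)` must be less than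
  -- `2`. This `ε` gives `m/2`, and it also keeps `b` and `-b'` in `(0, 1/2)`.
  refine ⟨(2 - m) / 32, by linarith, by linarith, ?_⟩
  rintro b b' hbdef hb'def
  set ε := (2 - m) / 32 with hε
  set p := 2 / (2 - m) with hp
  set qV := 4 / (2 - m) with hqV
  set qM := 4 * m / (m + 1) with hqM
  have hb1 : 1 - 2 * b = 1 / (2 * m) - 2 * ε := by
    rw [hbdef]; field_simp; ring
  have hb14 : 1 / 4 < b := by
    have : 1 / 4 ≤ (2 * m - 1) / (4 * m) := by
      rw [div_le_div_iff₀ (by norm_num) (by positivity)]; linarith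
    linarith
  have hb12 : b < 1 / 2 := by
    have : 1 / 4 < 1 / (2 * m) := by
      rw [div_lt_div_iff₀ (by norm_num) (by positivity)]; linarith
    linarith
  have hmε : 2 * m * ε ≤ 1 / 16 := by
    rw [hε]; nlinarith [sq_nonneg (m - 1)]
  have hβ0 : 0 < -b' := by rw [hb'def]; linarith
  have hβ12 : -b' < 1 / 2 := by rw [hb'def]; nlinarith
  have hp2 : 2 ≤ p := by rw [hp, le_div_iff₀ h2m]; linarith
  have hqV2 : 2 ≤ qV := by rw [hqV, le_div_iff₀ h2m]; linarith
  have hqM2 : 2 ≤ qM := by rw [hqM, le_div_iff₀ (by linarith)]; linarith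
  have h4m2 : 2 ≤ 4 * m := by linarith
  -- Here `(1-2b+θ) q` falls short of `2` by a positive multiple of `ε`: both this exponent and `4m`
  -- below are critical for `ε = 0`.
  have hEM : embConst b (1 / 2) qM < ∞ := by
    refine embConst_lt_top (by linarith) hb12 (by norm_num) hqM2 ?_
    have : (1 - 2 * b + 1 / 2) * qM = 2 - 8 * m * ε / (m + 1) := by
      rw [hb1, hqM]; field_simp; ring
    have : 0 < 8 * m * ε / (m + 1) := by positivity
    linarith
  have hEA : embConst b 0 (4 * m) < ∞ := by
    refine embConst_lt_top (by linarith) hb12 le_rfl h4m2 ?_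
    have : (1 - 2 * b + 0) * (4 * m) = 2 - 8 * m * ε := by
      rw [hb1]; field_simp; ring
    have : 0 < 8 * m * ε := by positivity
    linarith
  have hEV : embConst (-b') 0 qV < ∞ := by
    refine embConst_lt_top hβ0 hβ12 le_rfl hqV2 ?_
    have : (1 - 2 * (-b') + 0) * qV = m / 2 := by
      rw [hb'def, hqV, hε]; field_simp; ring
    linarith
  have hES := embConst_half_lt_top hp2
  set A := embConst (1 / 2 - 1 / (2 * p)) 0 p with hA
  have hSob : SobolevBound p (1 / 2) A := sobolevBound_half hp2
  set CM := (embConst b (1 / 2) qM * ENNReal.ofReal (Real.exp 1)) ^ (1 / 2 : ℝ) with hCM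
  set CN := (A * embConst b 0 (4 * m)) ^ (1 / 2 : ℝ) with hCN
  set CA := (1 * embConst b 0 (4 * m)) ^ (1 / 2 : ℝ) with hCA
  set CV := (1 * embConst (-b') 0 qV) ^ (1 / 2 : ℝ) with hCV
  set CW := (A * embConst (-b') 0 qV) ^ (1 / 2 : ℝ) with hCW
  have hCMt : CM ≠ ∞ := ENNReal.rpow_ne_top_of_nonneg (by norm_num)
    (ENNReal.mul_ne_top hEM.ne ENNReal.ofReal_ne_top)
  have hCNt : CN ≠ ∞ := ENNReal.rpow_ne_top_of_nonneg (by norm_num)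
    (ENNReal.mul_ne_top hES.ne hEA.ne)
  have hCAt : CA ≠ ∞ := ENNReal.rpow_ne_top_of_nonneg (by norm_num)
    (ENNReal.mul_ne_top ENNReal.one_ne_top hEA.ne)
  have hCVt : CV ≠ ∞ := ENNReal.rpow_ne_top_of_nonneg (by norm_num)
    (ENNReal.mul_ne_top ENNReal.one_ne_top hEV.ne)
  have hCWt : CW ≠ ∞ := ENNReal.rpow_ne_top_of_nonneg (by norm_num)
    (ENNReal.mul_ne_top hES.ne hEV.ne)
  set K1 := CM ^ m * CN * CA ^ (m - 1) * CV with hK1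
  set K2 := CM ^ m * CA ^ m * CW with hK2
  have hrt : ∀ {x : ℝ≥0∞} {r : ℝ}, 0 ≤ r → x ≠ ∞ → x ^ r ≠ ∞ := fun hr hx =>
    ENNReal.rpow_ne_top_of_nonneg hr hx
  have hK1t : K1 ≠ ∞ := ENNReal.mul_ne_top (ENNReal.mul_ne_top (ENNReal.mul_ne_top
    (hrt hm0.le hCMt) hCNt) (hrt (by linarith) hCAt)) hCVt
  have hK2t : K2 ≠ ∞ := ENNReal.mul_ne_top (ENNReal.mul_ne_top
    (hrt hm0.le hCMt) (hrt hm0.le hCAt)) hCWt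
  -- The embedding constants do not involve the phase, so one constant serves both signs; the sum
  -- covers both estimates.
  refine ⟨(K1 + K2).toNNReal, fun σ _ => ?_⟩
  rw [ENNReal.coe_toNNReal (ENNReal.add_ne_top.2 ⟨hK1t, hK2t⟩)]
  constructor
  · intro N U hN hU
    obtain ⟨hn, hn2, hnX, hnF⟩ := hN.exists_fourierInv (by norm_num) (by linarith)
    obtain ⟨hu, hu2, huX, huF⟩ := hU.exists_fourierInv le_rfl (by linarith)
    refine ⟨⟨_, hnF⟩, ⟨_, huF⟩, fun n u hnN huU => ?_⟩
    have hnae := hnN.ae_eq hnF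
    have huae := huU.ae_eq huF
    obtain ⟨BM, hBMm, hBM, hBMq⟩ := exists_sup_fourierInv_le (b := b) (q := qM) (by linarith) hqM2 hu2
    obtain ⟨BN, hBNm, hBN, hBNq⟩ := exists_lintegral_fourierInv_le (b := b) (q := 4 * m)
      (kg_measurable σ) (by linarith) h4m2 hp2 (by norm_num) hSob hn2
    obtain ⟨BA, hBAm, hBA, hBAq⟩ := exists_lintegral_fourierInv_le (b := b) (q := 4 * m)
      schr_measurable (by linarith) h4m2 le_rfl le_rfl sobolevBound_two hu2
    rw [huX] at hBMq hBAq
    rw [hnX] at hBNq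
    -- The norms of `N` and `U` are part of the bound of the functional, so their finiteness is
    -- needed before duality applies.
    have hK : K1 * XNorm (kg σ) (1 / 2) b N * XNorm schr 0 b U ^ (2 * m - 1) ≠ ∞ :=
      ENNReal.mul_ne_top (ENNReal.mul_ne_top hK1t hN.ne) (hrt (by linarith) hU.ne)
    obtain ⟨F, hF, hFX⟩ := exists_distribution (s := 0) (b := b') schr_temperate
      (f := fun z => n z * ((‖u z‖ ^ (2 * (m - 1)) : ℝ) : ℂ) * u z) (by
        have h1 := hnN.locallyIntegrable.aestronglyMeasurable
        have h2 := huU.locallyIntegrable.aestronglyMeasurable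
        have h3 : AEStronglyMeasurable (fun z => ((‖u z‖ ^ (2 * (m - 1)) : ℝ) : ℂ)) :=
          (Complex.measurable_ofReal.comp_aemeasurable
            (h2.norm.aemeasurable.pow_const _)).aestronglyMeasurable
        exact (h1.mul h3).mul h2) hK (fun g => by
        obtain ⟨k, hk2, hkX, hkae⟩ := exists_fourierInv_ae_eq_conj g
        obtain ⟨BV, hBVm, hBV, hBVq⟩ := exists_lintegral_fourierInv_le (b := -b') (q := qV)
          schr_measurable hβ0 hqV2 le_rfl le_rfl sobolevBound_two hk2
        rw [hkX] at hBVq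
        have key := lintegral_triple_le hm1 hm2 (Lp.stronglyMeasurable _).measurable
          (Lp.stronglyMeasurable _).measurable (Lp.stronglyMeasurable _).measurable
          hBMm hBNm hBAm hBVm hBM hBN hBA hBV hBMq hBNq hBAq hBVq
        rw [neg_zero]
        calc _ = _ := by
              refine lintegral_congr_ae ?_
              filter_upwards [hnae, huae, hkae] with z h1 h2 h3
              rw [← h1, ← h2, h3, enorm_mul, enorm_mul, enorm_mul,
                enorm_ofReal_norm_rpow _ (by linarith), ← ofReal_norm (starRingEnd ℂ _), RCLike.norm_conj,
                ofReal_norm]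
              have e : ‖u z‖ₑ ^ (2 * m - 1) = ‖u z‖ₑ ^ (2 * (m - 1)) * ‖u z‖ₑ := by
                nth_rw 3 [← ENNReal.rpow_one ‖u z‖ₑ]
                rw [← ENNReal.rpow_add_of_nonneg _ _ (by linarith) (by norm_num)]
                congr 1
                ring
              rw [e]
              ring
          _ ≤ _ := key
          _ = _ := by
              rw [ENNReal.mul_rpow_of_nonneg _ _ hm0.le,
                ENNReal.mul_rpow_of_nonneg _ _ (by linarith : 0 ≤ m - 1),
                show 2 * m - 1 = m + (m - 1) by ring,
                ENNReal.rpow_add_of_nonneg _ _ hm0.le (by linarith : 0 ≤ m - 1), hK1]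
              ring)
    refine ⟨F, hF, hFX.trans ?_⟩
    gcongr
    exact le_self_add
  · intro U hU
    obtain ⟨hu, hu2, huX, huF⟩ := hU.exists_fourierInv le_rfl (by linarith)
    refine ⟨⟨_, huF⟩, fun u huU => ?_⟩
    have huae := huU.ae_eq huF
    obtain ⟨BM, hBMm, hBM, hBMq⟩ := exists_sup_fourierInv_le (b := b) (q := qM) (by linarith) hqM2 hu2
    obtain ⟨BA, hBAm, hBA, hBAq⟩ := exists_lintegral_fourierInv_le (b := b) (q := 4 * m)
      schr_measurable (by linarith) h4m2 le_rfl le_rfl sobolevBound_two hu2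
    rw [huX] at hBMq hBAq
    have hK : K2 * XNorm schr 0 b U ^ (2 * m) ≠ ∞ :=
      ENNReal.mul_ne_top hK2t (hrt (by linarith) hU.ne)
    obtain ⟨G, hG, hGX⟩ := exists_distribution (s := -1 / 2) (b := b') (kg_temperate σ)
      (f := fun z => ((‖u z‖ ^ (2 * m) : ℝ) : ℂ)) (by
        have h2 := huU.locallyIntegrable.aestronglyMeasurable
        exact (Complex.measurable_ofReal.comp_aemeasurable
            (h2.norm.aemeasurable.pow_const _)).aestronglyMeasurable) hK (fun g => by
        obtain ⟨k, hk2, hkX, hkae⟩ := exists_fourierInv_ae_eq_conj g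
        obtain ⟨BV, hBVm, hBV, hBVq⟩ := exists_lintegral_fourierInv_le (b := -b') (q := qV)
          (kg_measurable σ) hβ0 hqV2 hp2 (by norm_num) hSob hk2
        rw [hkX] at hBVq
        have key := lintegral_double_le hm1 hm2 (Lp.stronglyMeasurable _).measurable
          (Lp.stronglyMeasurable _).measurable
          hBMm hBAm hBVm hBM hBA hBV hBMq hBAq hBVq
        rw [show -(-1 / 2 : ℝ) = 1 / 2 by norm_num]
        calc _ = _ := by
              refine lintegral_congr_ae ?_
              filter_upwards [huae, hkae] with z h2 h3
              rw [← h2, h3, enorm_mul, enorm_ofReal_norm_rpow _ (by linarith),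
                ← ofReal_norm (starRingEnd ℂ _), RCLike.norm_conj, ofReal_norm, mul_comm]
          _ ≤ _ := key
          _ = _ := by
              rw [ENNReal.mul_rpow_of_nonneg _ _ hm0.le, ENNReal.mul_rpow_of_nonneg _ _ hm0.le,
                show 2 * m = m + m by ring, ENNReal.rpow_add_of_nonneg _ _ hm0.le hm0.le, hK2]
              ring)
    refine ⟨G, hG, hGX.trans ?_⟩
    gcongr
    exact le_add_self
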